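/- **Setting.** Let $d\ge 3$ and let $\eta=\mathrm{diag}(\eta_1,\dots,\eta_d)$, $\eta_\mu=\pm1$, be a flat metric. Let $\mathcal H^{T}$ be the complex vector space of formal power series in commuting variables $y^\mu$ and polynomials in commuting variables $a^{\dagger\mu}$ and in anticommuting variables $\mathcal C^\mu,\theta,c^\dagger,b^\dagger,\xi$ ($\mu=1,\dots,d$). The ghost number of $b^\dagger$ is $-1$, that of $\theta,c^\dagger,\xi,\mathcal C^\mu$ is $1$, and that of $y^\mu,a^{\dagger\mu}$ is $0$. For a subspace $W\subset\mathcal H^T$ let $\Gamma(W)$ be the space of smooth sections over $\mathbb R^d\ni x$ with values in $W$ (component fields smooth, $a^\dagger$-degree bounded). Put $$\Box=\eta^{\mu\nu}\partial_{y^\mu}\partial_{y^\nu},\quad S=\eta^{\mu\nu}\partial_{a^{\dagger\mu}}\partial_{y^\nu},\quad T=\eta^{\mu\nu}\partial_{a^{\dagger\mu}}\partial_{a^{\dagger\nu}},\quad S^\dagger=a^{\dagger\mu}\partial_{y^\mu},\quad \bar S^\dagger=y^\mu\partial_{a^{\dagger\mu}},$$ $$\boldsymbol d=\mathcal C^\mu\partial_{x^\mu},\quad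 \sigma=-\mathcal C^\mu\partial_{y^\mu},\quad \bar\sigma=-\mathcal C^\mu\partial_{a^{\dagger\mu}}.$$ The parent BRST operator $\Omega^T$ of the Fronsdal system acts on $\Gamma(\mathcal H^T)$ by $$ i\Omega^T=\boldsymbol d+\sigma-i\theta\Box+c^\dagger S+S^\dagger\partial_{b^\dagger}-i c^\dagger\partial_{b^\dagger}\partial_\theta+i\xi T-2i\xi\,\partial_{b^\dagger}\partial_{c^\dagger},$$ and $\Omega^T_{-1}$ is its part given by $i\Omega^T_{-1}=-i\theta\Box+c^\dagger S+i\xi T$. If $V=\mathcal E\oplus\mathcal F\oplus\mathcal G$ and $\Omega:V\to V$ has the blocks $\Omega^{\mathcal X\mathcal Y}:\mathcal Y\to\mathcal X$, and $\Omega^{\mathcal G\mathcal F}$ is invertible, the *reduction* of $\Omega$ to $\mathcal E$ is $\Omega^{\mathcal E\mathcal E}-\Omega^{\mathcal E\mathcal F}(\Omega^{\mathcal G\mathcal F})^{-1}\Omega^{\mathcal G\mathcal E}$. It is *algebraic* if $(\Omega^{\mathcal G\mathcal F})^{-1}$ contains no $x$-derivatives (is linear over the smooth functions of $x$). Let $\hat{\mathcal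 E}$ be the space of $\Phi(y,a^\dagger,b^\dagger,\mathcal C)$ with $\Box\Phi=S\Phi=T\Phi=0$, and $\hat{\mathcal E}_0$ the subspace of its $b^\dagger$-independent elements. Let $$\mathcal E_0=\{\phi\in\hat{\mathcal E}_0:\bar S^\dagger\phi=0\},\quad \mathcal L=\{\lambda\in\hat{\mathcal E}_0: S^\dagger\lambda=0\},\quad \mathcal E_1=b^\dagger\mathcal L,\quad \mathcal E=\mathcal E_0\oplus\mathcal E_1,$$ $$\tilde{\mathcal F}=b^\dagger\bar S^\dagger\hat{\mathcal E},\qquad \tilde{\mathcal G}=S^\dagger\partial_{b^\dagger}\hat{\mathcal E}.$$ Elements of $\mathcal E_0$ of degree $n$ in $y$ and $m$ in $a^\dagger$ are traceless tensors with the symmetry of the two-row Young tableau with rows of lengths $n\ge m$. Let $\Pi^{\mathcal R}$ be the projector that keeps the terms with $m=n$ (rectangular tableaux). With $e=S^\dagger$, $f=\bar S^\dagger$, $h=a^{\dagger\mu}\partial_{a^{\dagger\mu}}-y^\mu\partial_{y^\mu}$, let $\Pi^{\mathcal E_0}$ be the operator that vanishes on the terms with $h>0$ and equals $\sum_{n\ge0}\bigl(n!\prod_{j=1}^n(h-j-1)\bigr)^{-1}e^nf^n$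 on the terms with $h\le0$. **Proposition.** 1. $\hat{\mathcal E}+\mathrm{Im}\,\Omega^T_{-1}=\mathrm{Ker}\,\Omega^T_{-1}$ in $\mathcal H^T$, and there is a subspace $\mathcal F\subset\mathcal H^T$, homogeneous in the ghost number, such that $\Gamma(\mathcal H^T)=\Gamma(\hat{\mathcal E})\oplus\Gamma(\mathcal F)\oplus\Gamma(\mathrm{Im}\,\Omega^T_{-1})$ and $\Omega^T$ reduces algebraically to $\Gamma(\hat{\mathcal E})$. Moreover $\mathcal E+\tilde{\mathcal G}=\hat{\mathcal E}\cap\mathrm{Ker}(S^\dagger\partial_{b^\dagger})$. 2. On sections, $\Pi^{\mathcal E_0}$ is the projector of $\Gamma(\hat{\mathcal E}_0)$ onto $\Gamma(\mathcal E_0)$ along $\Gamma(\tilde{\mathcal G})$, and $\Pi^{\mathcal R}$ maps $\Gamma(\mathcal E_0)$ to the elements of $\Gamma(\mathcal E_0)$ annihilated by $S^\dagger$ and is the identity on these. 3. For every subspace $\mathcal F$ such that $\Gamma(\mathcal H^T)=\Gamma(\hat{\mathcal E})\oplus\Gamma(\mathcal F)\oplus\Gamma(\mathrm{Im}\,\Omega^T_{-1})$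 and the corresponding block of $\Omega^T$, from $\Gamma(\mathcal F)$ to $\Gamma(\mathrm{Im}\,\Omega^T_{-1})$, is invertible, the reduction $\hat\Omega^T$ of $\Omega^T$ to $\Gamma(\hat{\mathcal E})$ is given by $i\hat\Omega^T=\boldsymbol d+\sigma+S^\dagger\partial_{b^\dagger}$. Furthermore $\Gamma(\hat{\mathcal E})=\Gamma(\mathcal E)\oplus\Gamma(\tilde{\mathcal F})\oplus\Gamma(\tilde{\mathcal G})$, and $\hat\Omega^T$ reduces algebraically to an operator $\tilde\Omega^T$ on $\Gamma(\mathcal E)$ with the following properties. - (*Equations of motion.*) The elements of $\Gamma(\mathcal E)$ of ghost number $0$ are exactly the $\tilde\Psi^{(0)}=\tilde\Psi_0+b^\dagger\tilde\Psi_1$ with $\tilde\Psi_0\in\Gamma(\mathcal E_0)$ of ghost number $0$ and $\tilde\Psi_1\in\Gamma(\mathcal L)$ of ghost number $1$; $\tilde\Psi_0$ and $\tilde\Psi_1$ are uniquely determined. The equation $\tilde\Omega^T\tilde\Psi^{(0)}=0$ is equivalent to the system $$(\boldsymbol d+\Pi^{\mathcal E_0}\sigma)\tilde\Psi_0=0,\qquad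 (\boldsymbol d+\sigma)\tilde\Psi_1=-\sigma\bar\sigma\,\Pi^{\mathcal R}\tilde\Psi_0.$$ - (*Gauge transformations.*) The elements of $\Gamma(\mathcal E)$ of ghost number $-1$ are exactly the $\tilde\Psi^{(1)}=-i b^\dagger\tilde\Lambda$ with $\tilde\Lambda\in\Gamma(\mathcal L)$ of ghost number $0$, and $\tilde\Lambda$ is uniquely determined. Under $\delta\tilde\Psi^{(0)}=\tilde\Omega^T\tilde\Psi^{(1)}$ one has $$\delta\tilde\Psi_0=0,\qquad \delta\tilde\Psi_1=(\boldsymbol d+\sigma)\tilde\Lambda,$$ so $\tilde\Psi_0$ consists of gauge-invariant curvatures and $\tilde\Psi_1$ of gauge fields. -/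

import Mathlib

open scoped ContDiff

noncomputable section

namespace Fronsdal

/-! ### The space of states -/

/-- The anticommuting variables: four ghosts (`θ`, `c†`, `b†`, `ξ`) and `C^1, …, C^d`.  The
lexicographic order on this type fixes the order of the factors in a monomial. -/
abbrev OddVar (d : ℕ) : Type := Lex (Fin 4 ⊕ Fin d)

def gTheta (d : ℕ) : OddVar d := toLex (Sum.inl 0)
def gCdag (d : ℕ) : OddVar d := toLex (Sum.inl 1)
def gBdag (d : ℕ) : OddVar d := toLex (Sum.inl 2)
def gXi (d : ℕ) : OddVar d := toLex (Sum.inl 3)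
def gC {d : ℕ} (μ : Fin d) : OddVar d := toLex (Sum.inr μ)

/-- Ghost numbers: `b†` has ghost number `-1`; `θ`, `c†`, `ξ` and the `C^μ` have ghost number
`1`. -/
def oddGh {d : ℕ} (g : OddVar d) : ℤ := if g = gBdag d then -1 else 1

/-- The monomial `y^α (a†)^β g₁ ⋯ g_k` with multi-exponents `α`, `β` and odd variables
`g₁ < ⋯ < g_k` running through a finite set. -/
structure Mono (d : ℕ) where
  y : Fin d → ℕ
  a : Fin d → ℕ
  odd : Finset (OddVar d)

namespace Mono
variable {d : ℕ}

/-- Homogeneity degree in `y`. -/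
def ydeg (i : Mono d) : ℕ := ∑ μ, i.y μ
/-- Homogeneity degree in `a†`. -/
def adeg (i : Mono d) : ℕ := ∑ μ, i.a μ
/-- The ghost number of a monomial. -/
def gh (i : Mono d) : ℤ := ∑ g ∈ i.odd, oddGh g
/-- The sign `(-1)^(number of factors of the monomial that precede g)`, acquired when `g` or
`∂/∂g` is moved from the left to its place. -/
def sgn (i : Mono d) (g : OddVar d) : ℂ := (-1) ^ (i.odd.filter (· < g)).card

def yUp (μ : Fin d) (i : Mono d) : Mono d := ⟨i.y + Pi.single μ 1, i.a, i.odd⟩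
def yDown (μ : Fin d) (i : Mono d) : Mono d := ⟨i.y - Pi.single μ 1, i.a, i.odd⟩
def aUp (μ : Fin d) (i : Mono d) : Mono d := ⟨i.y, i.a + Pi.single μ 1, i.odd⟩
def aDown (μ : Fin d) (i : Mono d) : Mono d := ⟨i.y, i.a - Pi.single μ 1, i.odd⟩
def oddInsert (g : OddVar d) (i : Mono d) : Mono d := ⟨i.y, i.a, insert g i.odd⟩
def oddErase (g : OddVar d) (i : Mono d) : Mono d := ⟨i.y, i.a, i.odd.erase g⟩

lemma adeg_aUp (μ : Fin d) (i : Mono d) : (i.aUp μ).adeg = i.adeg + 1 := by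
  simp [adeg, aUp, Finset.sum_add_distrib]

lemma adeg_aDown (μ : Fin d) (i : Mono d) (h : i.a μ ≠ 0) :
    (i.aDown μ).adeg + 1 = i.adeg := by
  have : (i.aDown μ).aUp μ = i := by
    cases i with
    | mk y a o =>
      simp only [aDown, aUp, Mono.mk.injEq, true_and, and_true]
      apply tsub_add_cancel_of_le
      intro ν
      by_cases hν : ν = μ
      · subst hν
        simpa [Nat.one_le_iff_ne_zero] using h
      · simp [hν]
  rw [← adeg_aUp, this]

end Mono

/-- The states with coefficients in `R`: the families `φ` of coefficients of the monomials
`y^α (a†)^β g₁ ⋯ g_k`, i.e. formal power series in `y^μ` and polynomials in `a†^μ` (there is a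
bound on the `a†`-degree) and in the finitely many anticommuting variables.
For `R = ℂ` this is the space of states of the extended system; for `R` the smooth functions of
`x`, it is the space of sections of the trivial bundle with this fibre. -/
def Fock (d : ℕ) (R : Type) [AddCommGroup R] [Module ℂ R] : Submodule ℂ (Mono d → R) where
  carrier := {φ | ∃ M : ℕ, ∀ i : Mono d, M < i.adeg → φ i = 0}
  zero_mem' := ⟨0, fun _ _ => rfl⟩
  add_mem' := by
    rintro φ ψ ⟨M, hM⟩ ⟨N, hN⟩
    refine ⟨max M N, fun i hi => ?_⟩
    simp [hM i (lt_of_le_of_lt (le_max_left _ _) hi),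
      hN i (lt_of_le_of_lt (le_max_right _ _) hi)]
  smul_mem' := by
    rintro c φ ⟨M, hM⟩
    exact ⟨M, fun i hi => by simp [hM i hi]⟩

section Instances

variable (d : ℕ) (R : Type) [AddCommGroup R] [Module ℂ R]

instance : AddCommGroup (Fock d R) := Submodule.addCommGroup _
instance : Module ℂ (Fock d R) := Submodule.module _

end Instances

section Operators

variable {d : ℕ} {R : Type} [AddCommGroup R] [Module ℂ R]

/-- The operator whose value at the monomial `i` is `c i` times the coefficient at `t i`. -/
def wshift (c : Mono d → ℂ) (t : Mono d → Mono d)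
    (h : ∀ i, c i ≠ 0 → i.adeg ≤ (t i).adeg + 1) : Fock d R →ₗ[ℂ] Fock d R where
  toFun φ := ⟨fun i => c i • φ.1 (t i), by
    obtain ⟨M, hM⟩ := φ.2
    refine ⟨M + 1, fun i hi => ?_⟩
    by_cases hc : c i = 0
    · simp [hc]
    · have := h i hc
      have h0 : φ.1 (t i) = 0 := hM (t i) (by omega)
      simp [h0]⟩
  map_add' φ ψ := by ext i; simp
  map_smul' a φ := by
    apply Subtype.ext
    funext i
    exact smul_comm (c i) a (φ.1 (t i))

/-- Coefficientwise application of a linear map. -/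
def coeffMap {R' : Type} [AddCommGroup R'] [Module ℂ R'] (l : R →ₗ[ℂ] R') :
    Fock d R →ₗ[ℂ] Fock d R' where
  toFun φ := ⟨fun i => l (φ.1 i), by
    obtain ⟨M, hM⟩ := φ.2
    exact ⟨M, fun i hi => by simp [hM i hi]⟩⟩
  map_add' φ ψ := by ext i; simp
  map_smul' a φ := by ext i; simp

/-- `∂/∂y^μ`. -/
def dy (μ : Fin d) : Fock d R →ₗ[ℂ] Fock d R :=
  wshift (fun i => (i.y μ : ℂ) + 1) (fun i => i.yUp μ) (fun i _ => by simp [Mono.adeg, Mono.yUp])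

/-- Multiplication by `y^μ`. -/
def my (μ : Fin d) : Fock d R →ₗ[ℂ] Fock d R :=
  wshift (fun i => if i.y μ = 0 then 0 else 1) (fun i => i.yDown μ)
    (fun i _ => by simp [Mono.adeg, Mono.yDown])

/-- `∂/∂a†^μ`. -/
def da (μ : Fin d) : Fock d R →ₗ[ℂ] Fock d R :=
  wshift (fun i => (i.a μ : ℂ) + 1) (fun i => i.aUp μ)
    (fun i _ => by rw [Mono.adeg_aUp]; omega)

/-- Multiplication by `a†^μ`. -/
def ma (μ : Fin d) : Fock d R →ₗ[ℂ] Fock d R :=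
  wshift (fun i => if i.a μ = 0 then 0 else 1) (fun i => i.aDown μ)
    (fun i h => by
      have h' : i.a μ ≠ 0 := fun h0 => h (by simp [h0])
      rw [Mono.adeg_aDown μ i h'])

/-- Left multiplication by the anticommuting variable `g`. -/
def mo (g : OddVar d) : Fock d R →ₗ[ℂ] Fock d R :=
  wshift (fun i => if g ∈ i.odd then i.sgn g else 0) (fun i => i.oddErase g)
    (fun i _ => by simp [Mono.adeg, Mono.oddErase])

/-- The left derivative `∂/∂g` with respect to the anticommuting variable `g`. -/
def dod (g : OddVar d) : Fock d R →ₗ[ℂ] Fock d R :=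
  wshift (fun i => if g ∈ i.odd then 0 else i.sgn g) (fun i => i.oddInsert g)
    (fun i _ => by simp [Mono.adeg, Mono.oddInsert])

/-- The component of ghost number `k`. -/
def ghPart (k : ℤ) : Fock d R →ₗ[ℂ] Fock d R :=
  wshift (fun i => if i.gh = k then 1 else 0) id (fun i _ => by simp)

/-- The states of ghost number `k`. -/
def ghSpace (d : ℕ) (R : Type) [AddCommGroup R] [Module ℂ R] (k : ℤ) :
    Submodule ℂ (Fock d R) := LinearMap.ker (ghPart k - LinearMap.id)

/-! The flat metric is `η = diag(η 1, …, η d)`. -/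

/-- `□ = η^{μν} ∂/∂y^μ ∂/∂y^ν`. -/
def opBox (η : Fin d → ℝ) : Fock d R →ₗ[ℂ] Fock d R := ∑ μ, (η μ : ℂ) • (dy μ ∘ₗ dy μ)
/-- `S = η^{μν} ∂/∂a†^μ ∂/∂y^ν`. -/
def opS (η : Fin d → ℝ) : Fock d R →ₗ[ℂ] Fock d R := ∑ μ, (η μ : ℂ) • (da μ ∘ₗ dy μ)
/-- `T = η^{μν} ∂/∂a†^μ ∂/∂a†^ν`. -/
def opT (η : Fin d → ℝ) : Fock d R →ₗ[ℂ] Fock d R := ∑ μ, (η μ : ℂ) • (da μ ∘ₗ da μ)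
/-- `S† = a†^μ ∂/∂y^μ`. -/
def opSdag : Fock d R →ₗ[ℂ] Fock d R := ∑ μ, ma μ ∘ₗ dy μ
/-- `S̄† = y^μ ∂/∂a†^μ`. -/
def opSbardag : Fock d R →ₗ[ℂ] Fock d R := ∑ μ, my μ ∘ₗ da μ
/-- `σ = -C^μ ∂/∂y^μ`. -/
def sig : Fock d R →ₗ[ℂ] Fock d R := -∑ μ, mo (gC μ) ∘ₗ dy μ
/-- `σ̄ = -C^μ ∂/∂a†^μ`. -/
def sigbar : Fock d R →ₗ[ℂ] Fock d R := -∑ μ, mo (gC μ) ∘ₗ da μ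

/-! ### The internal part of the BRST operator -/

/-- `p^y_μ = -i ∂/∂y^μ`. -/
def py (μ : Fin d) : Fock d R →ₗ[ℂ] Fock d R := -Complex.I • dy μ
/-- `a^μ = η^{μν} ∂/∂a†^ν`. -/
def aop (η : Fin d → ℝ) (μ : Fin d) : Fock d R →ₗ[ℂ] Fock d R := (η μ : ℂ) • da μ
/-- The ghost momentum `P = -i ∂/∂θ`. -/
def ghP : Fock d R →ₗ[ℂ] Fock d R := -Complex.I • dod (gTheta d)
/-- The annihilation operator `b = -∂/∂c†`. -/
def ghb : Fock d R →ₗ[ℂ] Fock d R := -dod (gCdag d)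
/-- The annihilation operator `c = ∂/∂b†`. -/
def ghc : Fock d R →ₗ[ℂ] Fock d R := dod (gBdag d)

/-- The constraint `η^{μν} p_μ p_ν`, with `p` replaced by `p^y`. -/
def conL (η : Fin d → ℝ) : Fock d R →ₗ[ℂ] Fock d R := ∑ μ, (η μ : ℂ) • (py μ ∘ₗ py μ)
/-- The constraint `p_μ a^μ`, with `p` replaced by `p^y`. -/
def conS (η : Fin d → ℝ) : Fock d R →ₗ[ℂ] Fock d R := ∑ μ, py μ ∘ₗ aop η μ
/-- The constraint `p_μ a†^μ`, with `p` replaced by `p^y`. -/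
def conSdag : Fock d R →ₗ[ℂ] Fock d R := ∑ μ, py μ ∘ₗ ma μ
/-- The trace `η_{μν} a^μ a^ν` (`η_{μν} = η^{μν}` for a diagonal metric with entries `±1`). -/
def conT (η : Fin d → ℝ) : Fock d R →ₗ[ℂ] Fock d R :=
  ∑ μ, (η μ : ℂ) • (aop η μ ∘ₗ aop η μ)

/-- `Ω^y = θ 𝓛 + c† 𝓢 + 𝓢† c - i P c† c + ξ (η_{μν} a^μ a^ν + 2 c b)`: the BRST operator of the
Fronsdal system with `p` replaced by `p^y`. -/
def OmegaY (η : Fin d → ℝ) : Fock d R →ₗ[ℂ] Fock d R :=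
  mo (gTheta d) ∘ₗ conL η + mo (gCdag d) ∘ₗ conS η + conSdag ∘ₗ ghc
    - Complex.I • (ghP ∘ₗ mo (gCdag d) ∘ₗ ghc)
    + mo (gXi d) ∘ₗ (conT η + (2 : ℂ) • (ghc ∘ₗ ghb))

/-- `θ 𝓛 + c† 𝓢 + ξ η_{μν} a^μ a^ν`: the part of the BRST operator of degree `-1`, where the
degree is minus the homogeneity degree in `θ`, `c†`, `ξ`. -/
def OmegaMinus (η : Fin d → ℝ) : Fock d R →ₗ[ℂ] Fock d R :=
  mo (gTheta d) ∘ₗ conL η + mo (gCdag d) ∘ₗ conS η + mo (gXi d) ∘ₗ conT η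

/-- `S† ∂/∂b†`: the part of degree `-1` of the intermediate BRST operator, up to a factor, where
the degree is the homogeneity degree in `b†`. -/
def SdagDb : Fock d R →ₗ[ℂ] Fock d R := opSdag ∘ₗ dod (gBdag d)

/-! ### The projectors -/

/-- `Π^R`: the terms with equal degrees in `y` and in `a†`.  A traceless state of bidegree `m` in
`a†` and `n` in `y` that is annihilated by `S̄†` is a tensor with the symmetry of the two-row
Young tableau with rows of lengths `n` and `m`; the tableau is rectangular iff `m = n`. -/
def projRect : Fock d R →ₗ[ℂ] Fock d R :=
  wshift (fun i => if i.adeg = i.ydeg then 1 else 0) id (fun i _ => by simp)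

lemma opSbardag_bound (φ : Fock d R) (k : ℤ) (h : ∀ i, k < i.adeg → φ.1 i = 0) :
    ∀ i, k - 1 < i.adeg → (opSbardag φ).1 i = 0 := by
  intro i hi
  simp only [opSbardag, LinearMap.sum_apply, LinearMap.comp_apply, Submodule.coe_sum,
    Finset.sum_apply]
  refine Finset.sum_eq_zero fun μ _ => ?_
  have : φ.1 ((i.yDown μ).aUp μ) = 0 := h _ (by
    have : ((i.yDown μ).aUp μ).adeg = i.adeg + 1 := by rw [Mono.adeg_aUp]; rfl
    rw [this]; push_cast; omega)
  simp [my, da, wshift, this]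

lemma opSdag_bound (φ : Fock d R) (k : ℤ) (h : ∀ i, k < i.adeg → φ.1 i = 0) :
    ∀ i, k + 1 < i.adeg → (opSdag φ).1 i = 0 := by
  intro i hi
  simp only [opSdag, LinearMap.sum_apply, LinearMap.comp_apply, Submodule.coe_sum,
    Finset.sum_apply]
  refine Finset.sum_eq_zero fun μ _ => ?_
  by_cases h0 : i.a μ = 0
  · simp [ma, wshift, h0]
  · have : φ.1 ((i.aDown μ).yUp μ) = 0 := h _ (by
      have h1 := Mono.adeg_aDown μ i h0
      have : ((i.aDown μ).yUp μ).adeg = (i.aDown μ).adeg := rfl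
      rw [this]; omega)
    simp [ma, dy, wshift, this]

lemma sl2_bound (φ : Fock d R) (k : ℤ) (h : ∀ i, k < i.adeg → φ.1 i = 0) (n : ℕ) :
    ∀ i, k < i.adeg → (((opSdag ^ n) ((opSbardag ^ n) φ) : Fock d R)).1 i = 0 := by
  have h1 : ∀ i, k - n < i.adeg → (((opSbardag ^ n) φ : Fock d R)).1 i = 0 := by
    induction n with
    | zero => simpa using h
    | succ n ih =>
      intro i hi
      rw [pow_succ', Module.End.mul_apply]
      refine opSbardag_bound _ _ ih i ?_
      push_cast at hi
      omega
  have h2 : ∀ (m : ℕ) (ψ : Fock d R) (l : ℤ), (∀ i, l < i.adeg → ψ.1 i = 0) →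
      ∀ i, l + m < i.adeg → (((opSdag ^ m) ψ : Fock d R)).1 i = 0 := by
    intro m ψ l hl
    induction m with
    | zero => simpa using hl
    | succ m ih =>
      intro i hi
      rw [pow_succ', Module.End.mul_apply]
      refine opSdag_bound _ _ ih i ?_
      push_cast at hi
      omega
  intro i hi
  exact h2 n _ _ h1 i (by omega)

/-- `Π^{E₀}`: the projector on the lowest-weight vectors of the algebra `sl(2)` generated by
`e = S†`, `f = S̄†`, `h = a†^μ ∂/∂a†^μ - y^μ ∂/∂y^μ`.  On the terms with `h ≤ 0` it is
`∑ₙ (n! ∏_{j=1}^{n} (h - j - 1))⁻¹ eⁿ fⁿ`; the terms with `h > 0` contain no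
lowest-weight vectors, and it vanishes there. -/
def projE0 : Fock d R →ₗ[ℂ] Fock d R where
  toFun φ := ⟨fun i => if i.adeg ≤ i.ydeg then
      ∑ n ∈ Finset.range (i.adeg + 1),
        ((n.factorial : ℂ) * ∏ j ∈ Finset.Icc 1 n, ((i.adeg : ℂ) - i.ydeg - j - 1))⁻¹ •
          ((opSdag ^ n) ((opSbardag ^ n) φ)).1 i
    else 0, by
    obtain ⟨M, hM⟩ := φ.2
    refine ⟨M, fun i hi => ?_⟩
    dsimp only
    split_ifs with hle
    · refine Finset.sum_eq_zero fun n _ => ?_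
      rw [sl2_bound φ M (fun j hj => hM j (by exact_mod_cast hj)) n i (by exact_mod_cast hi),
        smul_zero]
    · rfl⟩
  map_add' φ ψ := by
    apply Subtype.ext
    funext i
    by_cases hle : i.adeg ≤ i.ydeg <;> simp [hle, Finset.sum_add_distrib]
  map_smul' a φ := by
    apply Subtype.ext
    funext i
    by_cases hle : i.adeg ≤ i.ydeg
    · simp [hle, Finset.smul_sum, smul_comm a]
    · simp [hle]

end Operators

/-! ### Sections -/

/-- The smooth complex functions of `x ∈ ℝ^d`. -/
def smoothFn (d : ℕ) : Subalgebra ℂ ((Fin d → ℝ) → ℂ) where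
  carrier := {f | ContDiff ℝ ∞ f}
  mul_mem' {f g} (hf : ContDiff ℝ ∞ f) (hg : ContDiff ℝ ∞ g) :=
    show ContDiff ℝ ∞ fun x => f x * g x from hf.mul hg
  add_mem' {f g} (hf : ContDiff ℝ ∞ f) (hg : ContDiff ℝ ∞ g) :=
    show ContDiff ℝ ∞ fun x => f x + g x from hf.add hg
  algebraMap_mem' c := show ContDiff ℝ ∞ fun _ : Fin d → ℝ => c from contDiff_const

/-- The type of smooth complex functions of `x ∈ ℝ^d`. -/
def Fld (d : ℕ) : Type := smoothFn d

instance (d : ℕ) : CommRing (Fld d) := inferInstanceAs (CommRing (smoothFn d))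
instance (d : ℕ) : Algebra ℂ (Fld d) := inferInstanceAs (Algebra ℂ (smoothFn d))

/-- `∂/∂x^μ` on functions. -/
def dxFld {d : ℕ} (μ : Fin d) : Fld d →ₗ[ℂ] Fld d where
  toFun f := ⟨fun x => fderiv ℝ f.1 x (Pi.single μ 1), by
    have hf : ContDiff ℝ ∞ f.1 := f.2
    exact (hf.fderiv_right (m := ∞) (by simp)).clm_apply contDiff_const⟩
  map_add' f g := by
    apply Subtype.ext
    funext x
    have hf : ContDiff ℝ ∞ f.1 := f.2
    have hg : ContDiff ℝ ∞ g.1 := g.2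
    have h := fderiv_add (hf.differentiable (by simp) x) (hg.differentiable (by simp) x)
    exact DFunLike.congr_fun h (Pi.single μ 1)
  map_smul' c f := by
    apply Subtype.ext
    funext x
    have hf : ContDiff ℝ ∞ f.1 := f.2
    have h := fderiv_const_smul (hf.differentiable (by simp) x) c
    exact DFunLike.congr_fun h (Pi.single μ 1)

/-- Evaluation of a function at `x`. -/
def evFld {d : ℕ} (x : Fin d → ℝ) : Fld d →ₗ[ℂ] ℂ where
  toFun f := f.1 x
  map_add' _ _ := rfl
  map_smul' _ _ := rfl

/-- The states of the extended system. -/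
abbrev State (d : ℕ) : Type := Fock d ℂ

/-- The sections `Γ(H)` of the trivial bundle over `ℝ^d` whose fibre is the space of states. -/
abbrev Sec (d : ℕ) : Type := Fock d (Fld d)

section Sections

variable {d : ℕ}

/-- The value of a section at a point. -/
def evalAt (x : Fin d → ℝ) : Sec d →ₗ[ℂ] State d := coeffMap (evFld x)

/-- The sections `Γ(W)` with values in a subspace `W` of the space of states. -/
def secs (W : Submodule ℂ (State d)) : Submodule ℂ (Sec d) := ⨅ x : Fin d → ℝ, W.comap (evalAt x : Sec d →ₗ[ℂ] State d)

/-- Multiplication of a section by a function. -/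
def fmul (f : Fld d) : Sec d →ₗ[ℂ] Sec d := coeffMap (LinearMap.mulLeft ℂ f : Fld d →ₗ[ℂ] Fld d)

/-- `∂/∂x^μ` on sections. -/
def dx (μ : Fin d) : Sec d →ₗ[ℂ] Sec d := coeffMap (dxFld μ)

/-- `𝐝 = C^μ ∂/∂x^μ`. -/
def dTot : Sec d →ₗ[ℂ] Sec d := ∑ μ : Fin d, mo (gC μ) ∘ₗ dx μ

/-- The BRST operator `C^μ (p_μ - p^y_μ) + Ω^y` of the parent system, `p_μ = -i ∂/∂x^μ`. -/
def OmegaT (η : Fin d → ℝ) : Sec d →ₗ[ℂ] Sec d :=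
  (∑ μ : Fin d, mo (gC μ) ∘ₗ (-Complex.I • dx μ - py μ)) + OmegaY η

end Sections

/-! ### The subspaces of states -/

section Subspaces

variable {d : ℕ}

/-- The states `Φ(y, a†, b†, C)` with `□ Φ = S Φ = T Φ = 0`. -/
def hatE (η : Fin d → ℝ) : Submodule ℂ (State d) :=
  LinearMap.ker (dod (gTheta d)) ⊓ LinearMap.ker (dod (gCdag d)) ⊓ LinearMap.ker (dod (gXi d)) ⊓
    LinearMap.ker (opBox η) ⊓ LinearMap.ker (opS η) ⊓ LinearMap.ker (opT η)

/-- The states `φ(y, a†, C)` with `□ φ = S φ = T φ = 0`. -/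
def hatE0 (η : Fin d → ℝ) : Submodule ℂ (State d) := hatE η ⊓ LinearMap.ker (dod (gBdag d))

/-- The states `φ(y, a†, C)` with `□ φ = S φ = T φ = 0` and `S̄† φ = 0`. -/
def spE0 (η : Fin d → ℝ) : Submodule ℂ (State d) := hatE0 η ⊓ LinearMap.ker opSbardag

/-- The states `λ(y, a†, C)` with `□ λ = S λ = T λ = 0` and `S† λ = 0`. -/
def spL1 (η : Fin d → ℝ) : Submodule ℂ (State d) := hatE0 η ⊓ LinearMap.ker opSdag

/-- `E₁`: the states `b† λ` with `λ` as in `spL1`. -/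
def spE1 (η : Fin d → ℝ) : Submodule ℂ (State d) := (spL1 η).map (mo (gBdag d))

/-- `E = E₀ + E₁`. -/
def spE (η : Fin d → ℝ) : Submodule ℂ (State d) := spE0 η ⊔ spE1 η

/-- `F̃ = b† S̄† Ê`. -/
def spF (η : Fin d → ℝ) : Submodule ℂ (State d) := (hatE η).map (mo (gBdag d) ∘ₗ opSbardag)

/-- `G̃`: the image of `Ê` under `S† ∂/∂b†`. -/
def spG (η : Fin d → ℝ) : Submodule ℂ (State d) := (hatE η).map SdagDb

end Subspaces

/-! ### Algebraic reduction -/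

section Reduction

variable {V : Type} [AddCommGroup V] [Module ℂ V]

/-- `V` is the direct sum of its subspaces `E`, `F`, `G`. -/
structure IsEFG (E F G : Submodule ℂ V) : Prop where
  complE : IsCompl E (F ⊔ G)
  complF : IsCompl F (E ⊔ G)
  complG : IsCompl G (E ⊔ F)

variable {E F G : Submodule ℂ V}

/-- The block `Ω^{EE}`. -/
def IsEFG.blockEE (h : IsEFG E F G) (Om : V →ₗ[ℂ] V) : E →ₗ[ℂ] E :=
  E.projectionOnto (F ⊔ G) h.complE ∘ₗ Om ∘ₗ E.subtype
/-- The block `Ω^{EF}`, which maps `F` to `E`. -/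
def IsEFG.blockEF (h : IsEFG E F G) (Om : V →ₗ[ℂ] V) : F →ₗ[ℂ] E :=
  E.projectionOnto (F ⊔ G) h.complE ∘ₗ Om ∘ₗ F.subtype
/-- The block `Ω^{GE}`, which maps `E` to `G`. -/
def IsEFG.blockGE (h : IsEFG E F G) (Om : V →ₗ[ℂ] V) : E →ₗ[ℂ] G :=
  G.projectionOnto (E ⊔ F) h.complG ∘ₗ Om ∘ₗ E.subtype
/-- The block `Ω^{GF}`, which maps `F` to `G`. -/
def IsEFG.blockGF (h : IsEFG E F G) (Om : V →ₗ[ℂ] V) : F →ₗ[ℂ] G :=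
  G.projectionOnto (E ⊔ F) h.complG ∘ₗ Om ∘ₗ F.subtype

/-- The reduced operator `Ω^{EE} - Ω^{EF} (Ω^{GF})⁻¹ Ω^{GE}` on `E`, for invertible `Ω^{GF}`. -/
def IsEFG.reduced (h : IsEFG E F G) (Om : V →ₗ[ℂ] V)
    (hb : Function.Bijective (h.blockGF Om)) : E →ₗ[ℂ] E :=
  h.blockEE Om -
    h.blockEF Om ∘ₗ (LinearEquiv.ofBijective (h.blockGF Om) hb).symm.toLinearMap ∘ₗ h.blockGE Om

end Reduction

/-- A linear map between spaces of sections is algebraically invertible if it is invertible and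
the inverse is linear over the functions of `x`, i.e. contains no `x`-derivatives. -/
def AlgInvertible {d : ℕ} {P Q : Type} [AddCommGroup P] [Module ℂ P] [AddCommGroup Q] [Module ℂ Q]
    (iP : P → Sec d) (iQ : Q → Sec d) (A : P →ₗ[ℂ] Q) : Prop :=
  Function.Bijective A ∧
    ∀ (f : Fld d) (p p' : P), iQ (A p') = fmul f (iQ (A p)) → iP p' = fmul f (iP p)

/-- The sections with values in `W`, as a subspace of the sections with values in `Ê`. -/
def subSecs {d : ℕ} (η : Fin d → ℝ) (W : Submodule ℂ (State d)) :
    Submodule ℂ (secs (hatE η)) := (secs W).comap (secs (hatE η)).subtype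

end Fronsdal

end

/-!
Everything is done for states with coefficients in an arbitrary complex vector space `R`; states are
the case `R = ℂ` and sections the case of smooth functions. The operators of the system are natural
in `R` (`Intertw`), so they commute with evaluation at a point, with multiplication by functions and
with the derivatives along `x`. A statement proved for all `R` therefore holds for states and for
sections alike, operators without `x`-derivatives are linear over the functions, and a section with
values in the kernel of a natural operator is a section annihilated by it.

**First reduction.** `OmegaMinus` is the Koszul differential, with odd variables `θ`, `c†`, `ξ`, of
the commuting operators `-□`, `-i S`, `T`. As `d ≥ 3`, there are three distinct indices
`k₁`, `k₂`, `k₃`, and the terms `∂²/∂y²` with index `k₁`, `∂/∂a† ∂/∂y` with index `k₃` and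
`∂²/∂a†²` with index `k₂` involve disjoint sets of variables. Integration gives right inverses of
these three leading terms that commute with each other and with the other leading terms, so the
Koszul complex of the leading terms is a tensor product of three contractible factors
(`contraction_three`, `lead_contraction`). The remaining terms raise a suitable nonnegative degree;
hence the Neumann series converges coefficientwise (`neumann`), and the perturbation lemma
(`perturbation`) yields a homotopy `contr` for `OmegaMinus`, with `contr² = 0`,
`contr Ω₋₁ contr = contr` and `Ω₋₁ contr Ω₋₁ = Ω₋₁` (`contr_relations`). The common kernel of
`OmegaMinus` and `contr` is the space of traceless states (`mem_hatS_iff`), so every state is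
uniquely the sum of a traceless state, an element of the image of `contr`, which serves as `F`, and
an element of the image of `OmegaMinus` (`hodge`, `isEFG_first`). The block of the parent operator
from `F` to the image of `OmegaMinus` is invertible because `contr` composed with the rest of the
parent operator lowers the degree in `θ`, `c†`, `ξ` and is therefore nilpotent (`isUnit_block`,
`algInvertible_first`). On traceless sections the parent operator is already
`-i (𝐝 + σ + S† ∂/∂b†)` and preserves them (`omegaT_hatS`); so for every choice of `F` the reduction
has this form (`reduced_first`).

**Decompositions for `sl(2)`.** On the traceless states `e = S†` and `f = S̄†` generate `sl(2)`, and
powers of `f` are locally nilpotent since the `a†`-degree is bounded. The sums that define the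
projector on the lowest-weight states, multiplied by `f` or `e`, telescope
(`SlTriple.lower_lowProj`, `SlTriple.lowProj_raise`); this shows that `projE0` projects on the
kernel of `f` along the image of `e` (`lower_projE0`, `sub_projE0`, `projE0_raise`). With the roles
of `e` and `f` exchanged one obtains that the traceless states are the direct sum of the kernel of
`e` and the image of `f` (`highest_decomp`, `lower_eq_zero`). Lowest-weight states of weight `0` are
invariant, which describes `projRect` (`raise_projRect`, `projRect_of_invariant`).

**Second reduction.** These decompositions, for the two terms of the expansion in `b†`, give the
decomposition of the traceless sections (`isEFG_second`), and the block of the intermediate operator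
from `F̃` to `G̃` is `-i S† ∂/∂b†`, which is bijective (`algInvertible_second`). To reduce the operator
at `Ψ₀ + b† Ψ₁` one has to solve `e ω = (1 - Π) σ Ψ₀` with `ω` in the image of `f`, where `Π` is
`projE0`. The solution is `ω = σ̄ (h - 1)⁻¹ Ψ₀` (`raise_omegaSol`). Modulo the image of `f` one has
`σ ω = -σ σ̄ Π' Ψ₀`, where `Π'` is `projRect`, since a lowest-weight state without terms of weight
`0` is in the image of `f`, with which `σ σ̄` commutes (`sig_omegaSol`). This gives the reduced operator
(`reduced_second`), whose two components are the equations of motion and the gauge transformations.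
-/

open scoped ContDiff

noncomputable section

namespace Fronsdal

/-! ### Operators acting on one kind of variables -/

section Modes

variable {d : ℕ} {R : Type} [AddCommGroup R] [Module ℂ R]

/-- The algebra of linear operators on the states. -/
abbrev Op (d : ℕ) (R : Type) [AddCommGroup R] [Module ℂ R] := Module.End ℂ (Fock d R)

@[simp] lemma wshift_apply (c : Mono d → ℂ) (t : Mono d → Mono d) (h) (φ : Fock d R) (i : Mono d) :
    (wshift c t h φ).1 i = c i • φ.1 (t i) := rfl

lemma Fock.ext' {φ ψ : Fock d R} (h : ∀ i, φ.1 i = ψ.1 i) : φ = ψ := Subtype.ext (funext h)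

lemma coe_add' (φ ψ : Fock d R) (i : Mono d) : (φ + ψ).1 i = φ.1 i + ψ.1 i := rfl
lemma coe_sub' (φ ψ : Fock d R) (i : Mono d) : (φ - ψ).1 i = φ.1 i - ψ.1 i := rfl
lemma coe_neg' (φ : Fock d R) (i : Mono d) : (-φ).1 i = -φ.1 i := rfl
lemma coe_smul' (c : ℂ) (φ : Fock d R) (i : Mono d) : (c • φ).1 i = c • φ.1 i := rfl
lemma coe_zero' (i : Mono d) : (0 : Fock d R).1 i = 0 := rfl

/-- An operator acting on the powers of a single variable `y^μ`: its value at `(y^μ)ⁿ` is `c n`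
times the coefficient at `(y^μ)^(t n)`. -/
def yMode (μ : Fin d) (c : ℕ → ℂ) (t : ℕ → ℕ) : Op d R :=
  wshift (fun i => c (i.y μ)) (fun i => ⟨Function.update i.y μ (t (i.y μ)), i.a, i.odd⟩)
    (fun i _ => by simp [Mono.adeg])

/-- An operator acting on the powers of a single variable `a†^μ`. -/
def aMode (μ : Fin d) (c : ℕ → ℂ) (t : ℕ → ℕ) (h : ∀ n, c n ≠ 0 → n ≤ t n + 1) : Op d R :=
  wshift (fun i => c (i.a μ)) (fun i => ⟨i.y, Function.update i.a μ (t (i.a μ)), i.odd⟩)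
    (fun i hi => by
      have := h _ hi
      simp only [Mono.adeg]
      rw [← Finset.add_sum_erase _ _ (Finset.mem_univ μ),
        ← Finset.add_sum_erase (a := μ) (f := Function.update i.a μ _) _ (Finset.mem_univ μ)]
      have e : ∑ x ∈ Finset.univ.erase μ, Function.update i.a μ (t (i.a μ)) x
          = ∑ x ∈ Finset.univ.erase μ, i.a x :=
        Finset.sum_congr rfl fun x hx => by
          rw [Function.update_of_ne (Finset.ne_of_mem_erase hx)]
      rw [e, Function.update_self]
      omega)

/-- An operator acting on the anticommuting variables. -/
def oMode (c : Finset (OddVar d) → ℂ) (t : Finset (OddVar d) → Finset (OddVar d)) : Op d R :=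
  wshift (fun i => c i.odd) (fun i => ⟨i.y, i.a, t i.odd⟩) (fun i _ => by simp [Mono.adeg])

lemma yMode_apply (μ : Fin d) (c t) (φ : Fock d R) (i : Mono d) : (yMode μ c t φ).1 i =
    c (i.y μ) • φ.1 ⟨Function.update i.y μ (t (i.y μ)), i.a, i.odd⟩ := rfl
lemma aMode_apply (μ : Fin d) (c t h) (φ : Fock d R) (i : Mono d) : (aMode μ c t h φ).1 i =
    c (i.a μ) • φ.1 ⟨i.y, Function.update i.a μ (t (i.a μ)), i.odd⟩ := rfl
lemma oMode_apply (c t) (φ : Fock d R) (i : Mono d) : (oMode c t φ).1 i =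
    c i.odd • φ.1 ⟨i.y, i.a, t i.odd⟩ := rfl

lemma yMode_comm (μ ν : Fin d) (h : μ ≠ ν) (c c' : ℕ → ℂ) (t t' : ℕ → ℕ) :
    (yMode μ c t : Op d R) * yMode ν c' t' = yMode ν c' t' * yMode μ c t := by
  ext φ : 1
  refine Fock.ext' fun i => ?_
  simp only [Module.End.mul_apply, yMode_apply, Function.update_of_ne h,
    Function.update_of_ne h.symm, Function.update_comm h]
  rw [smul_comm]

lemma aMode_comm (μ ν : Fin d) (h : μ ≠ ν) (c c' : ℕ → ℂ) (t t' : ℕ → ℕ) (hc hc') :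
    (aMode μ c t hc : Op d R) * aMode ν c' t' hc' = aMode ν c' t' hc' * aMode μ c t hc := by
  ext φ : 1
  refine Fock.ext' fun i => ?_
  simp only [Module.End.mul_apply, aMode_apply, Function.update_of_ne h,
    Function.update_of_ne h.symm, Function.update_comm h]
  rw [smul_comm]

lemma yMode_aMode (μ ν : Fin d) (c c' : ℕ → ℂ) (t t' : ℕ → ℕ) (hc') :
    (yMode μ c t : Op d R) * aMode ν c' t' hc' = aMode ν c' t' hc' * yMode μ c t := by
  ext φ : 1
  refine Fock.ext' fun i => ?_
  simp only [Module.End.mul_apply, yMode_apply, aMode_apply]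
  rw [smul_comm]

lemma oMode_yMode (μ : Fin d) (c : ℕ → ℂ) (t : ℕ → ℕ) (c' t') :
    (oMode c' t' : Op d R) * yMode μ c t = yMode μ c t * oMode c' t' := by
  ext φ : 1
  refine Fock.ext' fun i => ?_
  simp only [Module.End.mul_apply, yMode_apply, oMode_apply]
  rw [smul_comm]

lemma oMode_aMode (μ : Fin d) (c : ℕ → ℂ) (t : ℕ → ℕ) (hc) (c' t') :
    (oMode c' t' : Op d R) * aMode μ c t hc = aMode μ c t hc * oMode c' t' := by
  ext φ : 1
  refine Fock.ext' fun i => ?_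
  simp only [Module.End.mul_apply, aMode_apply, oMode_apply]
  rw [smul_comm]

/-- Termwise integration `∫ dy^μ`, a right inverse of `∂/∂y^μ`. -/
def iy (μ : Fin d) : Op d R := yMode μ (fun n => (n : ℂ)⁻¹) (fun n => n - 1)
/-- Termwise integration `∫ da†^μ`, a right inverse of `∂/∂a†^μ`. -/
def ia (μ : Fin d) : Op d R := aMode μ (fun n => (n : ℂ)⁻¹) (fun n => n - 1) (fun n _ => by omega)

lemma add_single (f : Fin d → ℕ) (μ : Fin d) (k : ℕ) :
    f + Pi.single μ k = Function.update f μ (f μ + k) := by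
  funext ν
  by_cases h : ν = μ
  · subst h; simp
  · simp [h]

lemma sub_single (f : Fin d → ℕ) (μ : Fin d) (k : ℕ) :
    f - Pi.single μ k = Function.update f μ (f μ - k) := by
  funext ν
  by_cases h : ν = μ
  · subst h; simp
  · simp [h]

lemma dy_apply (μ : Fin d) (φ : Fock d R) (i : Mono d) :
    (dy μ φ).1 i = ((i.y μ : ℂ) + 1) • φ.1 (i.yUp μ) := rfl
lemma my_apply (μ : Fin d) (φ : Fock d R) (i : Mono d) :
    (my μ φ).1 i = (if i.y μ = 0 then 0 else 1 : ℂ) • φ.1 (i.yDown μ) := rfl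
lemma da_apply (μ : Fin d) (φ : Fock d R) (i : Mono d) :
    (da μ φ).1 i = ((i.a μ : ℂ) + 1) • φ.1 (i.aUp μ) := rfl
lemma ma_apply (μ : Fin d) (φ : Fock d R) (i : Mono d) :
    (ma μ φ).1 i = (if i.a μ = 0 then 0 else 1 : ℂ) • φ.1 (i.aDown μ) := rfl

lemma dy_eq (μ : Fin d) : (dy μ : Op d R) = yMode μ (fun n => n + 1) (fun n => n + 1) := by
  ext φ : 1
  refine Fock.ext' fun i => ?_
  simp only [dy_apply, yMode_apply, Mono.yUp, add_single]

lemma my_eq (μ : Fin d) :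
    (my μ : Op d R) = yMode μ (fun n => if n = 0 then 0 else 1) (fun n => n - 1) := by
  ext φ : 1
  refine Fock.ext' fun i => ?_
  simp only [my_apply, yMode_apply, Mono.yDown, sub_single]

lemma da_eq (μ : Fin d) : (da μ : Op d R) =
    aMode μ (fun n => n + 1) (fun n => n + 1) (fun n _ => by omega) := by
  ext φ : 1
  refine Fock.ext' fun i => ?_
  simp only [da_apply, aMode_apply, Mono.aUp, add_single]

lemma ma_eq (μ : Fin d) :
    (ma μ : Op d R) =
      aMode μ (fun n => if n = 0 then 0 else 1) (fun n => n - 1) (fun n _ => by omega) := by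
  ext φ : 1
  refine Fock.ext' fun i => ?_
  simp only [ma_apply, aMode_apply, Mono.aDown, sub_single]

/-- The sign of `g` relative to a set of anticommuting variables. -/
def osgn (s : Finset (OddVar d)) (g : OddVar d) : ℂ := (-1) ^ (s.filter (· < g)).card

lemma mo_eq (g : OddVar d) : (mo g : Op d R) =
    oMode (fun s => if g ∈ s then osgn s g else 0) (fun s => s.erase g) := rfl

lemma dod_eq (g : OddVar d) : (dod g : Op d R) =
    oMode (fun s => if g ∈ s then 0 else osgn s g) (fun s => insert g s) := rfl

/-! Canonical commutation relations. -/

lemma dy_dy (μ ν : Fin d) : (dy μ : Op d R) * dy ν = dy ν * dy μ := by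
  by_cases h : μ = ν
  · rw [h]
  · rw [dy_eq, dy_eq, yMode_comm _ _ h]

lemma da_da (μ ν : Fin d) : (da μ : Op d R) * da ν = da ν * da μ := by
  by_cases h : μ = ν
  · rw [h]
  · rw [da_eq, da_eq, aMode_comm _ _ h]

lemma dy_da (μ ν : Fin d) : (dy μ : Op d R) * da ν = da ν * dy μ := by
  rw [dy_eq, da_eq, yMode_aMode]
lemma dy_ma (μ ν : Fin d) : (dy μ : Op d R) * ma ν = ma ν * dy μ := by
  rw [dy_eq, ma_eq, yMode_aMode]
lemma my_da (μ ν : Fin d) : (my μ : Op d R) * da ν = da ν * my μ := by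
  rw [my_eq, da_eq, yMode_aMode]
lemma my_ma (μ ν : Fin d) : (my μ : Op d R) * ma ν = ma ν * my μ := by
  rw [my_eq, ma_eq, yMode_aMode]

lemma dy_my_self (μ : Fin d) : (dy μ : Op d R) * my μ = my μ * dy μ + 1 := by
  rw [dy_eq, my_eq]
  ext φ : 1
  refine Fock.ext' fun i => ?_
  rcases i with ⟨y, a, o⟩
  simp only [Module.End.mul_apply, LinearMap.add_apply, Module.End.one_apply, coe_add', yMode_apply, Function.update_self, Function.update_idem]
  by_cases h : y μ = 0
  · have e : Function.update y μ 0 = y := by rw [← h, Function.update_eq_self]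
    simp [h, e]
  · have e : y μ - 1 + 1 = y μ := by omega
    simp only [Nat.add_sub_cancel, Function.update_eq_self, e]
    simp [h, add_smul, Nat.cast_pred (Nat.pos_of_ne_zero h)]

lemma da_ma_self (μ : Fin d) : (da μ : Op d R) * ma μ = ma μ * da μ + 1 := by
  rw [da_eq, ma_eq]
  ext φ : 1
  refine Fock.ext' fun i => ?_
  rcases i with ⟨y, a, o⟩
  simp only [Module.End.mul_apply, LinearMap.add_apply, Module.End.one_apply, coe_add', aMode_apply, Function.update_self, Function.update_idem]
  by_cases h : a μ = 0
  · have e : Function.update a μ 0 = a := by rw [← h, Function.update_eq_self]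
    simp [h, e]
  · have e : a μ - 1 + 1 = a μ := by omega
    simp only [Nat.add_sub_cancel, Function.update_eq_self, e]
    simp [h, add_smul, Nat.cast_pred (Nat.pos_of_ne_zero h)]

lemma dy_my (μ ν : Fin d) : (dy μ : Op d R) * my ν = my ν * dy μ + if μ = ν then 1 else 0 := by
  by_cases h : μ = ν
  · subst h; simp [dy_my_self]
  · rw [dy_eq, my_eq, yMode_comm _ _ h, if_neg h, add_zero]

lemma da_ma (μ ν : Fin d) : (da μ : Op d R) * ma ν = ma ν * da μ + if μ = ν then 1 else 0 := by
  by_cases h : μ = ν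
  · subst h; simp [da_ma_self]
  · rw [da_eq, ma_eq, aMode_comm _ _ h, if_neg h, add_zero]

lemma dy_iy (μ : Fin d) : (dy μ : Op d R) * iy μ = 1 := by
  rw [dy_eq, iy]
  ext φ : 1
  refine Fock.ext' fun i => ?_
  simp only [Module.End.mul_apply, Module.End.one_apply, yMode_apply, Function.update_self, Function.update_idem, smul_smul]
  have : ((i.y μ : ℂ) + 1) ≠ 0 := Nat.cast_add_one_ne_zero _
  simp [this]

lemma da_ia (μ : Fin d) : (da μ : Op d R) * ia μ = 1 := by
  rw [da_eq, ia]
  ext φ : 1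
  refine Fock.ext' fun i => ?_
  simp only [Module.End.mul_apply, Module.End.one_apply, aMode_apply, Function.update_self, Function.update_idem, smul_smul]
  have : ((i.a μ : ℂ) + 1) ≠ 0 := Nat.cast_add_one_ne_zero _
  simp [this]

lemma osgn_erase (s : Finset (OddVar d)) {g g' : OddVar d} (hg : g ∈ s) (h : g < g') :
    osgn (s.erase g) g' = -osgn s g' := by
  have : (s.filter (· < g')).card = ((s.erase g).filter (· < g')).card + 1 := by
    rw [Finset.filter_erase, Finset.card_erase_of_mem (by simp [hg, h])]
    have : 0 < (s.filter (· < g')).card := Finset.card_pos.2 ⟨g, by simp [hg, h]⟩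
    omega
  simp [osgn, this, pow_succ]

lemma osgn_insert (s : Finset (OddVar d)) {g g' : OddVar d} (hg : g ∉ s) (h : g < g') :
    osgn (insert g s) g' = -osgn s g' := by
  have := osgn_erase (insert g s) (Finset.mem_insert_self g s) h
  rw [Finset.erase_insert hg] at this
  rw [this, neg_neg]

lemma osgn_erase' (s : Finset (OddVar d)) {g g' : OddVar d} (h : ¬ g < g') :
    osgn (s.erase g) g' = osgn s g' := by
  rw [osgn, Finset.filter_erase, Finset.erase_eq_of_notMem (by simp [h]), osgn]

lemma osgn_insert' (s : Finset (OddVar d)) {g g' : OddVar d} (h : ¬ g < g') :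
    osgn (insert g s) g' = osgn s g' := by
  rw [osgn, Finset.filter_insert, if_neg h, osgn]

lemma osgn_mul_self (s : Finset (OddVar d)) (g : OddVar d) : osgn s g * osgn s g = 1 := by
  simp only [osgn]
  exact pow_mul_pow_eq_one _ (by norm_num)

lemma oMode_mul_eq (c c' : Finset (OddVar d) → ℂ) (t t') (b b' : Finset (OddVar d) → ℂ)
    (u u' : Finset (OddVar d) → Finset (OddVar d))
    (h : ∀ s, c s * c' (t s) = -(b s * b' (u s)))
    (ht : ∀ s, c s * c' (t s) ≠ 0 → t' (t s) = u' (u s)) :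
    (oMode c t : Op d R) * oMode c' t' = -(oMode b u * oMode b' u') := by
  ext φ : 1
  refine Fock.ext' fun i => ?_
  simp only [LinearMap.neg_apply, coe_neg', Module.End.mul_apply, oMode_apply, smul_smul]
  rw [← neg_smul, ← h]
  by_cases h0 : c i.odd * c' (t i.odd) = 0
  · simp [h0]
  · rw [ht _ h0]

lemma mo_mo_of_ne {g g' : OddVar d} (hne : g ≠ g') :
    (mo g : Op d R) * mo g' = -(mo g' * mo g) := by
  rw [mo_eq, mo_eq]
  refine oMode_mul_eq _ _ _ _ _ _ _ _ (fun s => ?_) (fun s _ => Finset.erase_right_comm)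
  by_cases hg : g ∈ s <;> by_cases hg' : g' ∈ s <;> simp [hg, hg', hne, hne.symm]
  rcases lt_or_gt_of_ne hne with h | h
  · rw [osgn_erase s hg h, osgn_erase' s h.not_gt]; ring
  · rw [osgn_erase s hg' h, osgn_erase' s h.not_gt]; ring

lemma mo_sq (g : OddVar d) : (mo g : Op d R) * mo g = 0 := by
  ext φ : 1
  refine Fock.ext' fun i => ?_
  simp [mo_eq, oMode_apply, coe_zero']

lemma mo_mo (g g' : OddVar d) : (mo g : Op d R) * mo g' = -(mo g' * mo g) := by
  by_cases h : g = g'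
  · subst h; simp [mo_sq]
  · exact mo_mo_of_ne h

lemma dod_dod (g g' : OddVar d) (hne : g ≠ g') :
    (dod g : Op d R) * dod g' = -(dod g' * dod g) := by
  rw [dod_eq, dod_eq]
  refine oMode_mul_eq _ _ _ _ _ _ _ _ (fun s => ?_) (fun s _ => Finset.insert_comm _ _ _)
  by_cases hg : g ∈ s <;> by_cases hg' : g' ∈ s <;> simp [hg, hg', hne, hne.symm]
  rcases lt_or_gt_of_ne hne with h | h
  · rw [osgn_insert s hg h, osgn_insert' s h.not_gt]; ring
  · rw [osgn_insert s hg' h, osgn_insert' s h.not_gt]; ring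

lemma dod_sq (g : OddVar d) : (dod g : Op d R) * dod g = 0 := by
  ext φ : 1
  refine Fock.ext' fun i => ?_
  simp [dod_eq, oMode_apply, coe_zero']

lemma dod_mo (g g' : OddVar d) (hne : g ≠ g') :
    (dod g : Op d R) * mo g' = -(mo g' * dod g) := by
  rw [dod_eq, mo_eq]
  refine oMode_mul_eq _ _ _ _ _ _ _ _ (fun s => ?_)
    (fun s _ => Finset.erase_insert_of_ne hne)
  by_cases hg : g ∈ s <;> by_cases hg' : g' ∈ s <;> simp [hg, hg', hne, hne.symm]
  rcases lt_or_gt_of_ne hne with h | h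
  · rw [osgn_insert s hg h, osgn_erase' s h.not_gt]; ring
  · rw [osgn_erase s hg' h, osgn_insert' s h.not_gt]; ring

lemma dod_mo_self (g : OddVar d) : (dod g : Op d R) * mo g = 1 - mo g * dod g := by
  rw [eq_sub_iff_add_eq]
  ext φ : 1
  refine Fock.ext' fun i => ?_
  simp only [dod_eq, mo_eq, LinearMap.add_apply, coe_add', Module.End.mul_apply, oMode_apply, smul_smul, Module.End.one_apply]
  by_cases hg : g ∈ i.odd
  · simp [hg, osgn_erase', osgn_mul_self, Finset.insert_erase]
  · simp [hg, osgn_insert', osgn_mul_self]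

section
variable (μ : Fin d) (g : OddVar d)
lemma mo_dy : (mo g : Op d R) * dy μ = dy μ * mo g := by rw [mo_eq, dy_eq, oMode_yMode]
lemma mo_my : (mo g : Op d R) * my μ = my μ * mo g := by rw [mo_eq, my_eq, oMode_yMode]
lemma mo_da : (mo g : Op d R) * da μ = da μ * mo g := by rw [mo_eq, da_eq, oMode_aMode]
lemma mo_ma : (mo g : Op d R) * ma μ = ma μ * mo g := by rw [mo_eq, ma_eq, oMode_aMode]
lemma dod_dy : (dod g : Op d R) * dy μ = dy μ * dod g := by rw [dod_eq, dy_eq, oMode_yMode]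
lemma dod_my : (dod g : Op d R) * my μ = my μ * dod g := by rw [dod_eq, my_eq, oMode_yMode]
lemma dod_da : (dod g : Op d R) * da μ = da μ * dod g := by rw [dod_eq, da_eq, oMode_aMode]
lemma dod_ma : (dod g : Op d R) * ma μ = ma μ * dod g := by rw [dod_eq, ma_eq, oMode_aMode]
lemma mo_iy : (mo g : Op d R) * iy μ = iy μ * mo g := by rw [mo_eq, iy, oMode_yMode]
lemma mo_ia : (mo g : Op d R) * ia μ = ia μ * mo g := by rw [mo_eq, ia, oMode_aMode]
lemma dod_iy : (dod g : Op d R) * iy μ = iy μ * dod g := by rw [dod_eq, iy, oMode_yMode]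
lemma dod_ia : (dod g : Op d R) * ia μ = ia μ * dod g := by rw [dod_eq, ia, oMode_aMode]
end

lemma dy_ia (μ ν : Fin d) : (dy μ : Op d R) * ia ν = ia ν * dy μ := by
  rw [dy_eq, ia, yMode_aMode]
lemma iy_ia (μ ν : Fin d) : (iy μ : Op d R) * ia ν = ia ν * iy μ := by
  rw [iy, ia, yMode_aMode]
lemma iy_da (μ ν : Fin d) : (iy μ : Op d R) * da ν = da ν * iy μ := by
  rw [iy, da_eq, yMode_aMode]
lemma dy_iy_of_ne {μ ν : Fin d} (h : μ ≠ ν) : (dy μ : Op d R) * iy ν = iy ν * dy μ := by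
  rw [dy_eq, iy, yMode_comm _ _ h]
lemma da_ia_of_ne {μ ν : Fin d} (h : μ ≠ ν) : (da μ : Op d R) * ia ν = ia ν * da μ := by
  rw [da_eq, ia, aMode_comm _ _ h]
lemma iy_iy_of_ne {μ ν : Fin d} (h : μ ≠ ν) : (iy μ : Op d R) * iy ν = iy ν * iy μ := by
  rw [iy, iy, yMode_comm _ _ h]
lemma ia_ia_of_ne {μ ν : Fin d} (h : μ ≠ ν) : (ia μ : Op d R) * ia ν = ia ν * ia μ := by
  rw [ia, ia, aMode_comm _ _ h]

end Modes

/-! ### Dependence of coefficients and gradings -/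

section Grading

variable {d : ℕ} {R : Type} [AddCommGroup R] [Module ℂ R]

/-- The coefficient of `A φ` at `i` depends only on the coefficients of `φ` at the `j` with
`r i j`. -/
def Rel (r : Mono d → Mono d → Prop) (A : Op d R) : Prop :=
  ∀ φ i, (∀ j, r i j → φ.1 j = 0) → (A φ).1 i = 0

namespace Rel
variable {r s : Mono d → Mono d → Prop} {A B : Op d R}

lemma mono (h : Rel r A) (hrs : ∀ i j, r i j → s i j) : Rel s A :=
  fun φ i hφ => h φ i fun j hj => hφ j (hrs i j hj)

lemma mul (hA : Rel r A) (hB : Rel s B) : Rel (fun i k => ∃ j, r i j ∧ s j k) (A * B) :=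
  fun _ i hφ => hA _ i fun j hj => hB _ j fun k hk => hφ k ⟨j, hj, hk⟩

lemma add (hA : Rel r A) (hB : Rel r B) : Rel r (A + B) := fun φ i hφ => by
  rw [LinearMap.add_apply, coe_add', hA φ i hφ, hB φ i hφ, add_zero]

lemma neg (hA : Rel r A) : Rel r (-A) := fun φ i hφ => by
  rw [LinearMap.neg_apply, coe_neg', hA φ i hφ, neg_zero]

lemma sub (hA : Rel r A) (hB : Rel r B) : Rel r (A - B) := by
  rw [sub_eq_add_neg]; exact hA.add hB.neg

lemma smul (c : ℂ) (hA : Rel r A) : Rel r (c • A) := fun φ i hφ => by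
  rw [LinearMap.smul_apply, coe_smul', hA φ i hφ, smul_zero]

lemma zero : Rel r (0 : Op d R) := fun _ _ _ => rfl

lemma sum {ι : Type} (s : Finset ι) {f : ι → Op d R} (h : ∀ a ∈ s, Rel r (f a)) :
    Rel r (∑ a ∈ s, f a) := by
  classical
  induction s using Finset.induction_on with
  | empty => simpa using zero
  | insert a s ha ih =>
    rw [Finset.sum_insert ha]
    exact (h a (Finset.mem_insert_self a s)).add
      (ih fun b hb => h b (Finset.mem_insert_of_mem hb))

lemma wshift {c : Mono d → ℂ} {t h} (hr : ∀ i, c i ≠ 0 → r i (t i)) :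
    Rel r (Fronsdal.wshift c t h : Op d R) := fun φ i hφ => by
  rw [wshift_apply]
  by_cases h0 : c i = 0
  · rw [h0, zero_smul]
  · rw [hφ _ (hr i h0), smul_zero]

end Rel

/-- `A` raises the degree `w` by `k`. -/
def Sh (w : Mono d → ℤ) (k : ℤ) (A : Op d R) : Prop := Rel (fun i j => w i = w j + k) A

/-- `A` raises the degree `w` by at least `k`. -/
def Low (w : Mono d → ℤ) (k : ℤ) (A : Op d R) : Prop := Rel (fun i j => w j + k ≤ w i) A

section
variable {w : Mono d → ℤ} {k l : ℤ} {A B : Op d R}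

lemma Sh.low (h : Sh w k A) (hl : l ≤ k) : Low w l A := Rel.mono h fun i j hij => by omega

lemma Sh.mul (hA : Sh w k A) (hB : Sh w l B) {m : ℤ} (hm : k + l = m) : Sh w m (A * B) :=
  (Rel.mul hA hB).mono fun i j ⟨x, h1, h2⟩ => by omega

lemma Low.mul (hA : Low w k A) (hB : Low w l B) {m : ℤ} (hm : k + l = m) : Low w m (A * B) :=
  (Rel.mul hA hB).mono fun i j ⟨x, h1, h2⟩ => by omega

lemma Sh.one : Sh w 0 (1 : Op d R) := fun _ i hφ => hφ i (by simp)

lemma Sh.sub_degree (h : Sh w k A) {m : ℤ} (hm : k = m) : Sh w m A := hm ▸ h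

end

/-- The diagonal operator with eigenvalue `c i` on the monomial `i`. -/
def diag (c : Mono d → ℂ) : Op d R := wshift c id (fun i _ => by simp)

lemma diag_apply (c : Mono d → ℂ) (φ : Fock d R) (i : Mono d) : (diag c φ).1 i = c i • φ.1 i := rfl

lemma Rel.diag_mul {r : Mono d → Mono d → Prop} {A : Op d R} (hA : Rel r A) {c c' : Mono d → ℂ}
    (h : ∀ i j, r i j → c i = c' j) : diag c * A = A * diag c' := by
  ext φ : 1
  refine Fock.ext' fun i => ?_
  have := hA (diag c' φ - c i • φ) i fun j hj => by
    rw [coe_sub', diag_apply, coe_smul', h i j hj, sub_self]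
  rw [map_sub, map_smul, coe_sub', coe_smul', sub_eq_zero] at this
  rw [Module.End.mul_apply, Module.End.mul_apply, this, diag_apply]

lemma Sh.of_comm {w : Mono d → ℤ} {A : Op d R}
    (h : ∀ n : ℤ, diag (fun i => if w i = n then 1 else 0) * A =
      A * diag (fun i => if w i = n then 1 else 0)) : Sh w 0 A := fun φ i hφ => by
  have h1 := congrArg (fun B : Op d R => (B φ).1 i) (h (w i))
  have h2 : diag (fun j => if w j = w i then 1 else 0) φ = 0 := Fock.ext' fun j => by
    rw [diag_apply]
    split_ifs with hj
    · rw [hφ j (by omega), smul_zero]; rfl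
    · rw [zero_smul]; rfl
  simp only [Module.End.mul_apply, h2, map_zero] at h1
  rw [diag_apply, if_pos rfl, one_smul] at h1
  exact h1

/-- The inverse of an operator of degree `0` has degree `0`. -/
lemma Sh.inv {w : Mono d → ℤ} {A B : Op d R} (hA : Sh w 0 A) (h1 : A * B = 1) (h2 : B * A = 1) :
    Sh w 0 B := Sh.of_comm fun n => by
  have h := Rel.diag_mul hA (c := fun i => if w i = n then 1 else 0)
    (c' := fun i => if w i = n then 1 else 0) (fun i j hij => by simp [hij])
  calc _ = B * A * (diag (fun i => if w i = n then 1 else 0) * B) := by rw [h2, one_mul]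
    _ = B * (A * diag (fun i => if w i = n then 1 else 0)) * B := by noncomm_ring
    _ = B * diag (fun i => if w i = n then 1 else 0) * (A * B) := by rw [← h]; noncomm_ring
    _ = _ := by rw [h1, mul_one]

/-- The degree in which `y^μ`, `a†^μ` and the anticommuting variable `g` have weights `α μ`, `β μ`
and `γ g`. -/
def lw (α β : Fin d → ℤ) (γ : OddVar d → ℤ) (i : Mono d) : ℤ :=
  ∑ μ, α μ * i.y μ + ∑ μ, β μ * i.a μ + ∑ g ∈ i.odd, γ g

section
variable (α β : Fin d → ℤ) (γ : OddVar d → ℤ) (μ : Fin d) (g : OddVar d)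

lemma sum_update (f : Fin d → ℕ) (n : ℕ) :
    ∑ ν, α ν * (Function.update f μ n ν : ℤ) = ∑ ν, α ν * (f ν : ℤ) + α μ * (n - f μ) := by
  rw [← Finset.add_sum_erase _ _ (Finset.mem_univ μ),
    ← Finset.add_sum_erase _ (fun ν => α ν * (f ν : ℤ)) (Finset.mem_univ μ)]
  have e : ∑ x ∈ Finset.univ.erase μ, α x * (Function.update f μ n x : ℤ)
      = ∑ x ∈ Finset.univ.erase μ, α x * (f x : ℤ) :=
    Finset.sum_congr rfl fun x hx => by rw [Function.update_of_ne (Finset.ne_of_mem_erase hx)]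
  rw [e, Function.update_self]
  ring

lemma sh_yMode (c : ℕ → ℂ) (t : ℕ → ℕ) (k : ℤ) (h : ∀ n, c n ≠ 0 → (n : ℤ) = t n + k) :
    Sh (lw α β γ) (α μ * k) (yMode μ c t : Op d R) :=
  Rel.wshift fun i hi => by
    have := h _ hi
    simp only [lw, sum_update]
    linear_combination α μ * this

lemma sh_aMode (c : ℕ → ℂ) (t : ℕ → ℕ) (hc) (k : ℤ) (h : ∀ n, c n ≠ 0 → (n : ℤ) = t n + k) :
    Sh (lw α β γ) (β μ * k) (aMode μ c t hc : Op d R) :=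
  Rel.wshift fun i hi => by
    have := h _ hi
    simp only [lw, sum_update]
    linear_combination β μ * this

lemma sh_dy : Sh (lw α β γ) (-α μ) (dy μ : Op d R) := by
  rw [dy_eq, neg_eq_neg_one_mul, mul_comm]
  exact sh_yMode _ _ _ _ _ _ _ fun n _ => by push_cast; ring

lemma sh_da : Sh (lw α β γ) (-β μ) (da μ : Op d R) := by
  rw [da_eq, neg_eq_neg_one_mul, mul_comm]
  exact sh_aMode _ _ _ _ _ _ _ _ fun n _ => by push_cast; ring

lemma sh_my : Sh (lw α β γ) (α μ) (my μ : Op d R) := by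
  rw [my_eq, ← mul_one (α μ)]
  refine sh_yMode _ _ _ _ _ _ _ fun n hn => ?_
  have : n ≠ 0 := fun h0 => hn (by simp [h0])
  omega

lemma sh_ma : Sh (lw α β γ) (β μ) (ma μ : Op d R) := by
  rw [ma_eq, ← mul_one (β μ)]
  refine sh_aMode _ _ _ _ _ _ _ _ fun n hn => ?_
  have : n ≠ 0 := fun h0 => hn (by simp [h0])
  omega

lemma sh_iy : Sh (lw α β γ) (α μ) (iy μ : Op d R) := by
  rw [iy, ← mul_one (α μ)]
  refine sh_yMode _ _ _ _ _ _ _ fun n hn => ?_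
  have : n ≠ 0 := fun h0 => hn (by simp [h0])
  omega

lemma sh_ia : Sh (lw α β γ) (β μ) (ia μ : Op d R) := by
  rw [ia, ← mul_one (β μ)]
  refine sh_aMode _ _ _ _ _ _ _ _ fun n hn => ?_
  have : n ≠ 0 := fun h0 => hn (by simp [h0])
  omega

lemma sh_mo : Sh (lw α β γ) (γ g) (mo g : Op d R) :=
  Rel.wshift fun i hi => by
    have hg : g ∈ i.odd := by by_contra h; simp [h] at hi
    simp only [lw, Mono.oddErase]
    rw [← Finset.add_sum_erase _ _ hg]
    ring

lemma sh_dod : Sh (lw α β γ) (-γ g) (dod g : Op d R) :=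
  Rel.wshift fun i hi => by
    have hg : g ∉ i.odd := by by_contra h; simp [h] at hi
    simp only [lw, Mono.oddInsert]
    rw [Finset.sum_insert hg]
    ring

end

/-! ### Operators that commute with maps of the coefficients -/

/-- The operators `A` and `A'` on states with different coefficients are intertwined by a linear
map of the coefficients. -/
def Intertw {R' : Type} [AddCommGroup R'] [Module ℂ R'] (l : R →ₗ[ℂ] R') (A : Op d R)
    (A' : Op d R') : Prop := ∀ φ, coeffMap l (A φ) = A' (coeffMap l φ)

lemma coeffMap_apply {R' : Type} [AddCommGroup R'] [Module ℂ R'] (l : R →ₗ[ℂ] R') (φ : Fock d R)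
    (i : Mono d) : (coeffMap l φ).1 i = l (φ.1 i) := rfl

namespace Intertw

variable {R' : Type} [AddCommGroup R'] [Module ℂ R'] {l : R →ₗ[ℂ] R'} {A B : Op d R}
  {A' B' : Op d R'}

lemma mul (hA : Intertw l A A') (hB : Intertw l B B') : Intertw l (A * B) (A' * B') := fun φ => by
  rw [Module.End.mul_apply, hA, hB, Module.End.mul_apply]

lemma add (hA : Intertw l A A') (hB : Intertw l B B') : Intertw l (A + B) (A' + B') := fun φ => by
  rw [LinearMap.add_apply, map_add, hA, hB, LinearMap.add_apply]

lemma neg (hA : Intertw l A A') : Intertw l (-A) (-A') := fun φ => by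
  rw [LinearMap.neg_apply, map_neg, hA, LinearMap.neg_apply]

lemma sub (hA : Intertw l A A') (hB : Intertw l B B') : Intertw l (A - B) (A' - B') := by
  rw [sub_eq_add_neg, sub_eq_add_neg]; exact hA.add hB.neg

lemma smul (c : ℂ) (hA : Intertw l A A') : Intertw l (c • A) (c • A') := fun φ => by
  rw [LinearMap.smul_apply, map_smul, hA, LinearMap.smul_apply]

lemma one : Intertw l (1 : Op d R) 1 := fun _ => rfl

lemma sum {ι : Type} (s : Finset ι) {f : ι → Op d R} {f' : ι → Op d R'}
    (h : ∀ a ∈ s, Intertw l (f a) (f' a)) : Intertw l (∑ a ∈ s, f a) (∑ a ∈ s, f' a) := fun φ => by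
  rw [LinearMap.sum_apply, map_sum, LinearMap.sum_apply]
  exact Finset.sum_congr rfl fun a ha => h a ha φ

lemma pow (hA : Intertw l A A') (n : ℕ) : Intertw l (A ^ n) (A' ^ n) := by
  induction n with
  | zero => simpa using one
  | succ n ih => rw [pow_succ, pow_succ]; exact ih.mul hA

lemma inv (hA : Intertw l A A') (h1 : A * B = 1) (h2 : B' * A' = 1) : Intertw l B B' := fun φ => by
  have := hA (B φ)
  rw [← Module.End.mul_apply, h1] at this
  rw [Module.End.one_apply] at this
  rw [this, ← Module.End.mul_apply, h2, Module.End.one_apply]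

lemma wshift (c t h) : Intertw l (Fronsdal.wshift c t h : Op d R) (Fronsdal.wshift c t h) :=
  fun φ => Fock.ext' fun i => by
    rw [coeffMap_apply, wshift_apply, wshift_apply, coeffMap_apply, map_smul]

variable (l)
lemma dy (μ : Fin d) : Intertw l (Fronsdal.dy μ) (Fronsdal.dy μ) := wshift _ _ _
lemma my (μ : Fin d) : Intertw l (Fronsdal.my μ) (Fronsdal.my μ) := wshift _ _ _
lemma da (μ : Fin d) : Intertw l (Fronsdal.da μ) (Fronsdal.da μ) := wshift _ _ _
lemma ma (μ : Fin d) : Intertw l (Fronsdal.ma μ) (Fronsdal.ma μ) := wshift _ _ _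
lemma iy (μ : Fin d) : Intertw l (Fronsdal.iy μ) (Fronsdal.iy μ) := fun φ => Fock.ext' fun i => by
  rw [coeffMap_apply, Fronsdal.iy, Fronsdal.iy, yMode_apply, yMode_apply, coeffMap_apply, map_smul]
lemma ia (μ : Fin d) : Intertw l (Fronsdal.ia μ) (Fronsdal.ia μ) := fun φ => Fock.ext' fun i => by
  rw [coeffMap_apply, Fronsdal.ia, Fronsdal.ia, aMode_apply, aMode_apply, coeffMap_apply, map_smul]
lemma mo (g : OddVar d) : Intertw l (Fronsdal.mo g) (Fronsdal.mo g) := wshift _ _ _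
lemma dod (g : OddVar d) : Intertw l (Fronsdal.dod g) (Fronsdal.dod g) := wshift _ _ _

lemma opBox (η : Fin d → ℝ) : Intertw l (Fronsdal.opBox η) (Fronsdal.opBox η) :=
  sum _ fun μ _ => smul _ ((dy l μ).mul (dy l μ))
lemma opS (η : Fin d → ℝ) : Intertw l (Fronsdal.opS η) (Fronsdal.opS η) :=
  sum _ fun μ _ => smul _ ((da l μ).mul (dy l μ))
lemma opT (η : Fin d → ℝ) : Intertw l (Fronsdal.opT η) (Fronsdal.opT η) :=
  sum _ fun μ _ => smul _ ((da l μ).mul (da l μ))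
lemma opSdag : Intertw l (Fronsdal.opSdag : Op d R) Fronsdal.opSdag :=
  sum _ fun μ _ => (ma l μ).mul (dy l μ)
lemma opSbardag : Intertw l (Fronsdal.opSbardag : Op d R) Fronsdal.opSbardag :=
  sum _ fun μ _ => (my l μ).mul (da l μ)
lemma sig : Intertw l (Fronsdal.sig : Op d R) Fronsdal.sig :=
  neg (sum _ fun μ _ => (mo l _).mul (dy l μ))
lemma SdagDb : Intertw l (Fronsdal.SdagDb : Op d R) Fronsdal.SdagDb :=
  (opSdag l).mul (dod l _)

lemma projE0 : Intertw l (Fronsdal.projE0 : Op d R) Fronsdal.projE0 := fun φ => Fock.ext' fun i => by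
  rw [coeffMap_apply]
  simp only [Fronsdal.projE0, LinearMap.coe_mk, AddHom.coe_mk]
  split_ifs with h
  · rw [map_sum]
    refine Finset.sum_congr rfl fun n _ => ?_
    rw [map_smul, ← ((opSbardag l).pow n) φ, ← ((opSdag l).pow n) _, coeffMap_apply]
  · exact map_zero l

end Intertw

end Grading

/-! ### Homological perturbation in a ring -/

section Perturbation

variable {A : Type*} [Ring A]

/-- Tensor product of two contractions: if `h` contracts `a` to the image of `p` and `k`
contracts `b` to the image of `q`, then `h + p k` contracts `a + b` to the image of `p q`. -/
lemma contraction_add {a h p b k q : A} (hah : a * h + h * a = 1 - p) (hbk : b * k + k * b = 1 - q)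
    (hh : h * h = 0) (kk : k * k = 0) (hp : h * p = 0) (kq : k * q = 0)
    (pa : p * a = 0) (ap : a * p = 0) (ak : a * k = -(k * a)) (bh : b * h = -(h * b))
    (kh : k * h = -(h * k)) (ph : p * h = 0) (pk : p * k = k * p) (pb : p * b = b * p) :
    (a + b) * (h + p * k) + (h + p * k) * (a + b) = 1 - p * q ∧
      (h + p * k) * (h + p * k) = 0 ∧ (h + p * k) * (p * q) = 0 := by
  refine ⟨?_, ?_, ?_⟩
  · calc (a + b) * (h + p * k) + (h + p * k) * (a + b)
        = (a * h + h * a) + (b * h + h * b) + (a * p) * k + p * (k * a) + (b * p) * k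
          + p * k * b := by noncomm_ring
      _ = 1 - p + p * (b * k + k * b) - (p * a) * k := by
          rw [hah, bh, ap, ← pb, show k * a = -(a * k) by rw [ak, neg_neg]]; noncomm_ring
      _ = 1 - p * q := by rw [hbk, pa]; noncomm_ring
  · calc (h + p * k) * (h + p * k) = h * h + (h * p) * k + p * (k * h) + p * (k * p) * k := by
          noncomm_ring
      _ = -(p * h) * k + p * p * (k * k) := by rw [hh, hp, kh, ← pk]; noncomm_ring
      _ = 0 := by rw [ph, kk]; noncomm_ring
  · calc (h + p * k) * (p * q) = (h * p) * q + p * (k * p) * q := by noncomm_ring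
      _ = p * p * (k * q) := by rw [hp, ← pk]; noncomm_ring
      _ = 0 := by rw [kq]; noncomm_ring

/-- The perturbation lemma for a contraction `h` of `D0 = D - D1` to the image of `P0`, when `P0 D`
vanishes: with `h' = h (1 + D1 h)⁻¹` the operators `D h'` and `h' D` are orthogonal idempotents. -/
lemma perturbation {D D1 h P0 u : A} (DD : D * D = 0) (hh : h * h = 0)
    (hD : (D - D1) * h + h * (D - D1) = 1 - P0) (hP : h * P0 = 0) (PD : P0 * D = 0)
    (h1 : u * (1 + D1 * h) = 1) (h2 : (1 + D1 * h) * u = 1) :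
    (h * u) * (h * u) = 0 ∧ (h * u) * D * (h * u) = h * u ∧ D * (h * u) * D = D ∧
      h * u = h - h * u * D1 * h ∧
      1 - D * (h * u) - h * u * D =
        (1 - h * u * D1) * P0 * (1 - D * (h * u) - h * u * D) := by
  have hu : h * u = h - h * u * D1 * h := by
    calc h * u = h * (u * (1 + D1 * h)) - h * u * D1 * h := by noncomm_ring
      _ = _ := by rw [h1, mul_one]
  have huh : h * u * h = 0 := by
    rw [hu]
    calc (h - h * u * D1 * h) * h = h * h - h * u * D1 * (h * h) := by noncomm_ring
      _ = 0 := by rw [hh]; noncomm_ring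
  have huP : h * u * P0 = 0 := by
    rw [hu]
    calc (h - h * u * D1 * h) * P0 = h * P0 - h * u * D1 * (h * P0) := by noncomm_ring
      _ = 0 := by rw [hP]; noncomm_ring
  have Dh : D * h = (1 + D1 * h) - P0 - h * (D - D1) := by
    calc D * h = ((D - D1) * h + h * (D - D1)) + D1 * h - h * (D - D1) := by noncomm_ring
      _ = _ := by rw [hD]; noncomm_ring
  have hDh : h * D * h = h + h * D1 * h := by
    calc h * D * h = h * (D * h) := by noncomm_ring
      _ = h + h * D1 * h - h * P0 - (h * h) * (D - D1) := by rw [Dh]; noncomm_ring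
      _ = _ := by rw [hP, hh]; noncomm_ring
  have hhu : h * (h * u) = 0 := by rw [← mul_assoc, hh, zero_mul]
  have hDhu : h * D * (h * u) = h := by
    calc h * D * (h * u) = (h * D * h) * u := by noncomm_ring
      _ = h * ((1 + D1 * h) * u) := by rw [hDh]; noncomm_ring
      _ = h := by rw [h2, mul_one]
  have huDh : h * u * (D * h) = h := by
    calc h * u * (D * h) = h * (u * (1 + D1 * h)) - h * u * P0 - (h * u * h) * (D - D1) := by
          rw [Dh]; noncomm_ring
      _ = h := by rw [h1, huP, huh]; noncomm_ring
  have hu1 : (1 - h * u * D1) * (1 + h * D1) = 1 := by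
    calc (1 - h * u * D1) * (1 + h * D1) = 1 + h * D1 - h * (u * (1 + D1 * h)) * D1 := by
          noncomm_ring
      _ = 1 := by rw [h1]; noncomm_ring
  have hDX : D * (h * u) * D = D := by
    have hX : h * (D - D * (h * u) * D) = 0 := by
      calc h * (D - D * (h * u) * D) = h * D - (h * D * (h * u)) * D := by noncomm_ring
        _ = 0 := by rw [hDhu, sub_self]
    have DX : D * (D - D * (h * u) * D) = 0 := by
      calc D * (D - D * (h * u) * D) = D * D - (D * D) * (h * u) * D := by noncomm_ring
        _ = 0 := by rw [DD]; noncomm_ring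
    have PX : P0 * (D - D * (h * u) * D) = 0 := by
      calc P0 * (D - D * (h * u) * D) = P0 * D - (P0 * D) * (h * u) * D := by noncomm_ring
        _ = 0 := by rw [PD]; noncomm_ring
    generalize hXX : D - D * (h * u) * D = X at hX DX PX
    have e : (1 + h * D1) * X = 0 := by
      calc (1 + h * D1) * X = (1 - P0) * X + P0 * X + h * D1 * X := by noncomm_ring
        _ = P0 * X + (D - D1) * (h * X) + h * (D * X) := by rw [← hD]; noncomm_ring
        _ = 0 := by rw [hX, DX, PX]; noncomm_ring
    have : X = 0 := by
      calc X = (1 - h * u * D1) * (1 + h * D1) * X := by rw [hu1, one_mul]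
        _ = 0 := by rw [mul_assoc, e, mul_zero]
    rw [← sub_eq_zero, ← neg_eq_zero, neg_sub, hXX, this]
  refine ⟨?_, ?_, hDX, hu, ?_⟩
  · calc h * u * (h * u) = h * u * h * u := by noncomm_ring
      _ = 0 := by rw [huh, zero_mul]
  · calc h * u * D * (h * u) = h * u * (D * h) * u := by noncomm_ring
      _ = _ := by rw [huDh]
  · have hX : h * (1 - D * (h * u) - h * u * D) = 0 := by
      calc h * (1 - D * (h * u) - h * u * D) = h - h * D * (h * u) - h * (h * u) * D := by
            noncomm_ring
        _ = 0 := by rw [hDhu, hhu]; noncomm_ring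
    have DX : D * (1 - D * (h * u) - h * u * D) = 0 := by
      calc D * (1 - D * (h * u) - h * u * D) = D - (D * D) * (h * u) - D * (h * u) * D := by
            noncomm_ring
        _ = 0 := by rw [DD, hDX]; noncomm_ring
    generalize 1 - D * (h * u) - h * u * D = X at hX DX
    have e : (1 + h * D1) * X = P0 * X := by
      calc (1 + h * D1) * X = (1 - P0) * X + P0 * X + h * D1 * X := by noncomm_ring
        _ = P0 * X + (D - D1) * (h * X) + h * (D * X) := by rw [← hD]; noncomm_ring
        _ = P0 * X := by rw [hX, DX]; noncomm_ring
    rw [mul_assoc, ← e, ← mul_assoc, hu1, one_mul]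

end Perturbation

/-! ### Neumann series -/

section Neumann

variable {d : ℕ} {R : Type} [AddCommGroup R] [Module ℂ R]

lemma Low.neg_pow {w : Mono d → ℤ} {A : Op d R} (hA : Low w 1 A) (n : ℕ) :
    Low w n ((-A) ^ n) := by
  induction n with
  | zero => exact Sh.one.low (by simp)
  | succ n ih =>
    rw [pow_succ]
    exact ih.mul (Rel.neg hA) (by push_cast; ring)

lemma Sh.neg_pow {w : Mono d → ℤ} {A : Op d R} (hA : Sh w 0 A) (n : ℕ) :
    Sh w 0 ((-A) ^ n) := by
  induction n with
  | zero => exact Sh.one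
  | succ n ih =>
    rw [pow_succ]
    exact ih.mul (Rel.neg hA) (by ring)

/-- `1 + A` is invertible if `A` raises a nonnegative degree `w` and preserves a degree `v` that
differs from the `a†`-degree by a bounded amount (so that the Neumann series, which is finite on
each coefficient, preserves the boundedness of the `a†`-degree). -/
lemma neumann {A : Op d R} {w v : Mono d → ℤ} (hw : ∀ i, 0 ≤ w i) (hA : Low w 1 A) (C : ℕ)
    (hv : ∀ i, (i.adeg : ℤ) ≤ v i ∧ v i ≤ i.adeg + C) (hA' : Sh v 0 A) :
    ∃ B : Op d R, (1 + A) * B = 1 ∧ B * (1 + A) = 1 := by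
  have van : ∀ (φ : Fock d R) (i : Mono d) (n : ℕ), w i < n → (((-A) ^ n) φ).1 i = 0 :=
    fun φ i n hn => hA.neg_pow n φ i fun j hj => by have := hw j; omega
  let S : ℕ → Op d R := fun M => ∑ n ∈ Finset.range M, (-A) ^ n
  have S_apply : ∀ M (φ : Fock d R) i, (S M φ).1 i
      = ∑ n ∈ Finset.range M, (((-A) ^ n) φ).1 i := fun M φ i => by
    simp [S, LinearMap.sum_apply]
  let B : Op d R :=
    { toFun := fun φ => ⟨fun i => (S ((w i).toNat + 1) φ).1 i, by
        obtain ⟨M, hM⟩ := φ.2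
        refine ⟨M + C, fun i hi => ?_⟩
        show (S ((w i).toNat + 1) φ).1 i = 0
        rw [S_apply]
        refine Finset.sum_eq_zero fun n _ => hA'.neg_pow n φ i fun j hj => hM j ?_
        have := hv i
        have := hv j
        omega⟩
      map_add' := fun φ ψ => Fock.ext' fun i => by
        show (S _ (φ + ψ)).1 i = (S _ φ).1 i + (S _ ψ).1 i
        rw [map_add, coe_add']
      map_smul' := fun c φ => Fock.ext' fun i => by
        show (S _ (c • φ)).1 i = c • (S _ φ).1 i
        rw [map_smul, coe_smul'] }
  have B_apply : ∀ (φ : Fock d R) (i : Mono d) (M : ℕ), w i < M → (B φ).1 i = (S M φ).1 i := by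
    intro φ i M hM
    show (S ((w i).toNat + 1) φ).1 i = _
    rw [S_apply, S_apply]
    have := hw i
    refine Finset.sum_subset (fun n hn => ?_) fun n _ hn => van φ i n ?_
    · rw [Finset.mem_range] at hn ⊢; omega
    · rw [Finset.mem_range] at hn; omega
  have h1 : (1 + A) * B = 1 := by
    ext φ : 1
    refine Fock.ext' fun i => ?_
    have hi := hw i
    have e1 := hA (B φ - S ((w i).toNat + 1) φ) i fun j hj => by
      rw [coe_sub', B_apply φ j ((w i).toNat + 1) (by omega), sub_self]
    rw [map_sub, coe_sub', sub_eq_zero] at e1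
    have e2 : (1 + A) * S ((w i).toNat + 1) = 1 - (-A) ^ ((w i).toNat + 1) := by
      have := mul_neg_geom_sum (-A) ((w i).toNat + 1)
      rwa [sub_neg_eq_add] at this
    have e3 := congrArg (fun X : Op d R => (X φ).1 i) e2
    simp only [Module.End.mul_apply, LinearMap.add_apply, LinearMap.sub_apply, coe_add', coe_sub',
      Module.End.one_apply] at e3 ⊢
    rw [van φ i _ (by omega), sub_zero] at e3
    rw [B_apply φ i ((w i).toNat + 1) (by omega), e1, e3]
  refine ⟨B, h1, ?_⟩
  have inj : ∀ φ : Fock d R, (1 + A) φ = 0 → φ = 0 := fun φ hφ => by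
    have e : (-A) φ = φ := by
      rw [LinearMap.add_apply, Module.End.one_apply] at hφ
      rw [LinearMap.neg_apply, neg_eq_iff_add_eq_zero, add_comm, hφ]
    have e' : ∀ n : ℕ, ((-A) ^ n) φ = φ := fun n => by
      induction n with
      | zero => rfl
      | succ n ih => rw [pow_succ, Module.End.mul_apply, e, ih]
    refine Fock.ext' fun i => ?_
    have := hw i
    rw [← e' ((w i).toNat + 1), van φ i _ (by omega), coe_zero']
  ext φ : 1
  rw [← sub_eq_zero]
  apply inj
  rw [map_sub, ← Module.End.mul_apply, ← mul_assoc, h1, one_mul, Module.End.one_apply, sub_self]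

end Neumann

/-! ### Koszul complexes of operators with right inverses -/

section KoszulAlgebra

variable {A : Type*} [Ring A]

/-- A factor of a Koszul complex: an odd variable `t`, the derivative `s` with respect to it, an
operator `K` in other variables, and a right inverse `J` of `K`. -/
structure KoszulFactor (A : Type*) [Ring A] where
  t : A
  s : A
  K : A
  J : A
  tt : t * t = 0
  ss : s * s = 0
  st : s * t = 1 - t * s
  tK : Commute t K
  tJ : Commute t J
  sK : Commute s K
  sJ : Commute s J
  KJ : K * J = 1

namespace KoszulFactor

/-- The differential `t K`. -/
def diff (x : KoszulFactor A) : A := x.t * x.K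
/-- The contracting homotopy `s J`. -/
def htpy (x : KoszulFactor A) : A := x.s * x.J
/-- The projector on the states that are independent of `t` and lie in the kernel of `K`. -/
def harm (x : KoszulFactor A) : A := x.s * x.t * (1 - x.J * x.K)

variable (x y z : KoszulFactor A)

lemma s_harm : x.s * x.harm = 0 := by
  rw [harm, ← mul_assoc, ← mul_assoc, x.ss]; noncomm_ring

lemma harm_t : x.harm * x.t = 0 := by
  have h : Commute x.t (1 - x.J * x.K) := (Commute.one_right _).sub_right (x.tJ.mul_right x.tK)
  calc x.harm * x.t = x.s * x.t * ((1 - x.J * x.K) * x.t) := by rw [harm]; noncomm_ring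
    _ = x.s * (x.t * x.t) * (1 - x.J * x.K) := by rw [← h.eq]; noncomm_ring
    _ = 0 := by rw [x.tt]; noncomm_ring

lemma contraction : x.diff * x.htpy + x.htpy * x.diff = 1 - x.harm := by
  calc x.diff * x.htpy + x.htpy * x.diff
      = x.t * (x.K * x.s) * x.J + x.s * (x.J * x.t) * x.K := by rw [diff, htpy]; noncomm_ring
    _ = x.t * x.s * (x.K * x.J) + x.s * x.t * (x.J * x.K) := by
        rw [← x.sK.eq, ← x.tJ.eq]; noncomm_ring
    _ = 1 - x.harm := by rw [x.KJ, harm, mul_sub, x.st]; noncomm_ring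

lemma htpy_sq : x.htpy * x.htpy = 0 := by
  calc x.htpy * x.htpy = x.s * (x.J * x.s) * x.J := by rw [htpy]; noncomm_ring
    _ = (x.s * x.s) * x.J * x.J := by rw [← x.sJ.eq]; noncomm_ring
    _ = 0 := by rw [x.ss]; noncomm_ring

lemma htpy_harm : x.htpy * x.harm = 0 := by
  rw [htpy, x.sJ.eq, mul_assoc, s_harm, mul_zero]

lemma harm_htpy : x.harm * x.htpy = 0 := by
  have h : Commute x.s (1 - x.J * x.K) := (Commute.one_right _).sub_right (x.sJ.mul_right x.sK)
  calc x.harm * x.htpy = x.s * x.t * ((1 - x.J * x.K) * x.s) * x.J := by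
        rw [harm, htpy]; noncomm_ring
    _ = x.s * x.t * x.s * (x.J - x.J * (x.K * x.J)) := by rw [← h.eq]; noncomm_ring
    _ = 0 := by rw [x.KJ]; noncomm_ring

lemma diff_harm : x.diff * x.harm = 0 := by
  calc x.diff * x.harm = x.t * (x.K * x.s) * x.t * (1 - x.J * x.K) := by
        rw [diff, harm]; noncomm_ring
    _ = x.t * x.s * (x.K * x.t) * (1 - x.J * x.K) := by rw [← x.sK.eq]; noncomm_ring
    _ = x.t * x.s * x.t * (x.K - (x.K * x.J) * x.K) := by rw [← x.tK.eq]; noncomm_ring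
    _ = 0 := by rw [x.KJ]; noncomm_ring

lemma harm_diff : x.harm * x.diff = 0 := by rw [diff, ← mul_assoc, harm_t, zero_mul]

/-- Two Koszul factors are independent if their odd variables anticommute and everything else
commutes. -/
structure Indep : Prop where
  tt : x.t * y.t = -(y.t * x.t)
  ss : x.s * y.s = -(y.s * x.s)
  ts : x.t * y.s = -(y.s * x.t)
  st : x.s * y.t = -(y.t * x.s)
  xt : ∀ a, a = y.t ∨ a = y.s → Commute a x.K ∧ Commute a x.J
  yt : ∀ a, a = x.t ∨ a = x.s → Commute a y.K ∧ Commute a y.J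
  KK : Commute x.K y.K
  KJ : Commute x.K y.J
  JK : Commute x.J y.K
  JJ : Commute x.J y.J

/-- Products of anticommuting elements with commuting coefficients anticommute. -/
lemma anti_mul {t t' a a' : A} (h : t * t' = -(t' * t)) (h1 : Commute t' a) (h2 : Commute t a')
    (h3 : Commute a a') : (t * a) * (t' * a') = -((t' * a') * (t * a)) := by
  calc (t * a) * (t' * a') = t * (a * t') * a' := by noncomm_ring
    _ = (t * t') * (a * a') := by rw [← h1.eq]; noncomm_ring
    _ = -(t' * (t * a') * a) := by rw [h, h3.eq]; noncomm_ring
    _ = _ := by rw [h2.eq]; noncomm_ring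

lemma commute_harm {a : A} (h1 : Commute a (x.s * x.t)) (h2 : Commute a x.J)
    (h3 : Commute a x.K) : Commute a x.harm :=
  h1.mul_right ((Commute.one_right _).sub_right (h2.mul_right h3))

lemma commute_mul_of_anti {a s t : A} (h1 : a * s = -(s * a)) (h2 : a * t = -(t * a)) :
    Commute a (s * t) := by
  calc a * (s * t) = (a * s) * t := by noncomm_ring
    _ = -(s * (a * t)) := by rw [h1]; noncomm_ring
    _ = s * t * a := by rw [h2]; noncomm_ring

variable {x y z}

lemma Indep.symm (h : Indep x y) : Indep y x where
  tt := by rw [h.tt, neg_neg]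
  ss := by rw [h.ss, neg_neg]
  ts := by rw [h.st, neg_neg]
  st := by rw [h.ts, neg_neg]
  xt := h.yt
  yt := h.xt
  KK := h.KK.symm
  KJ := h.JK.symm
  JK := h.KJ.symm
  JJ := h.JJ.symm

variable (h : Indep x y)
include h

lemma Indep.t_harm : Commute x.t y.harm :=
  y.commute_harm (commute_mul_of_anti h.ts h.tt) (h.yt _ (Or.inl rfl)).2 (h.yt _ (Or.inl rfl)).1

lemma Indep.s_harm : Commute x.s y.harm :=
  y.commute_harm (commute_mul_of_anti h.ss h.st) (h.yt _ (Or.inr rfl)).2 (h.yt _ (Or.inr rfl)).1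

lemma Indep.K_harm : Commute x.K y.harm :=
  y.commute_harm ((h.xt _ (Or.inr rfl)).1.symm.mul_right (h.xt _ (Or.inl rfl)).1.symm) h.KJ h.KK

lemma Indep.J_harm : Commute x.J y.harm :=
  y.commute_harm ((h.xt _ (Or.inr rfl)).2.symm.mul_right (h.xt _ (Or.inl rfl)).2.symm) h.JJ h.JK

lemma Indep.diff_harm : Commute x.diff y.harm := h.t_harm.mul_left h.K_harm

lemma Indep.htpy_harm : Commute x.htpy y.harm := h.s_harm.mul_left h.J_harm

lemma Indep.harm_harm : Commute x.harm y.harm :=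
  (h.s_harm.mul_left h.t_harm).mul_left ((Commute.one_left _).sub_left (h.J_harm.mul_left h.K_harm))

lemma Indep.diff_htpy : x.diff * y.htpy = -(y.htpy * x.diff) :=
  anti_mul h.ts (h.xt _ (Or.inr rfl)).1 (h.yt _ (Or.inl rfl)).2 h.KJ

lemma Indep.htpy_htpy : x.htpy * y.htpy = -(y.htpy * x.htpy) :=
  anti_mul h.ss (h.xt _ (Or.inr rfl)).2 (h.yt _ (Or.inr rfl)).2 h.JJ

omit h

/-- The Koszul complex of three independent factors is contracted to the harmonic states. -/
lemma contraction_three (hxy : Indep x y) (hxz : Indep x z) (hyz : Indep y z) :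
    (x.diff + y.diff + z.diff) * (x.htpy + x.harm * y.htpy + x.harm * y.harm * z.htpy) +
      (x.htpy + x.harm * y.htpy + x.harm * y.harm * z.htpy) * (x.diff + y.diff + z.diff) =
      1 - x.harm * y.harm * z.harm ∧
    (x.htpy + x.harm * y.htpy + x.harm * y.harm * z.htpy) *
      (x.htpy + x.harm * y.htpy + x.harm * y.harm * z.htpy) = 0 ∧
    (x.htpy + x.harm * y.htpy + x.harm * y.harm * z.htpy) * (x.harm * y.harm * z.harm) = 0 := by
  obtain ⟨c1, c2, c3⟩ := contraction_add x.contraction y.contraction x.htpy_sq y.htpy_sq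
    x.htpy_harm y.htpy_harm x.harm_diff x.diff_harm hxy.diff_htpy hxy.symm.diff_htpy
    hxy.symm.htpy_htpy x.harm_htpy hxy.symm.htpy_harm.symm.eq hxy.symm.diff_harm.symm.eq
  refine contraction_add c1 z.contraction c2 z.htpy_sq c3 z.htpy_harm ?_ ?_ ?_ ?_ ?_ ?_ ?_ ?_
  · calc x.harm * y.harm * (x.diff + y.diff)
        = x.harm * (y.harm * x.diff) + x.harm * (y.harm * y.diff) := by noncomm_ring
      _ = (x.harm * x.diff) * y.harm := by
          rw [← hxy.diff_harm.eq, y.harm_diff]; noncomm_ring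
      _ = 0 := by rw [x.harm_diff, zero_mul]
  · calc (x.diff + y.diff) * (x.harm * y.harm)
        = (x.diff * x.harm) * y.harm + (y.diff * x.harm) * y.harm := by noncomm_ring
      _ = x.harm * (y.diff * y.harm) := by
          rw [hxy.symm.diff_harm.eq, x.diff_harm]; noncomm_ring
      _ = 0 := by rw [y.diff_harm, mul_zero]
  · rw [add_mul, mul_add, hxz.diff_htpy, hyz.diff_htpy]; abel
  · calc z.diff * (x.htpy + x.harm * y.htpy)
        = z.diff * x.htpy + (z.diff * x.harm) * y.htpy := by noncomm_ring
      _ = -(x.htpy * z.diff) + x.harm * (z.diff * y.htpy) := by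
          rw [hxz.symm.diff_htpy, hxz.symm.diff_harm.eq]; noncomm_ring
      _ = _ := by rw [hyz.symm.diff_htpy]; noncomm_ring
  · calc z.htpy * (x.htpy + x.harm * y.htpy)
        = z.htpy * x.htpy + (z.htpy * x.harm) * y.htpy := by noncomm_ring
      _ = -(x.htpy * z.htpy) + x.harm * (z.htpy * y.htpy) := by
          rw [hxz.symm.htpy_htpy, hxz.symm.htpy_harm.eq]; noncomm_ring
      _ = _ := by rw [hyz.symm.htpy_htpy]; noncomm_ring
  · calc x.harm * y.harm * (x.htpy + x.harm * y.htpy)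
        = x.harm * (y.harm * x.htpy) + x.harm * (y.harm * x.harm) * y.htpy := by noncomm_ring
      _ = (x.harm * x.htpy) * y.harm + x.harm * x.harm * (y.harm * y.htpy) := by
          rw [← hxy.htpy_harm.eq, ← hxy.harm_harm.eq]; noncomm_ring
      _ = 0 := by rw [x.harm_htpy, y.harm_htpy, zero_mul, mul_zero, add_zero]
  · exact (hxz.symm.htpy_harm.mul_right hyz.symm.htpy_harm).symm.eq
  · exact (hxz.symm.diff_harm.mul_right hyz.symm.diff_harm).symm.eq

end KoszulFactor

end KoszulAlgebra

/-! ### Operators in the commuting variables -/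

section Koszul

variable {d : ℕ} {R : Type} [AddCommGroup R] [Module ℂ R]

/-- Operators in the commuting variables only: they commute with the anticommuting variables and
with the derivatives with respect to these. -/
def Bos (A : Op d R) : Prop := ∀ g, Commute (mo g) A ∧ Commute (dod g) A

namespace Bos
variable {A B : Op d R}
lemma mul (hA : Bos A) (hB : Bos B) : Bos (A * B) :=
  fun g => ⟨(hA g).1.mul_right (hB g).1, (hA g).2.mul_right (hB g).2⟩
lemma neg (hA : Bos A) : Bos (-A) := fun g => ⟨(hA g).1.neg_right, (hA g).2.neg_right⟩
lemma sub (hA : Bos A) (hB : Bos B) : Bos (A - B) :=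
  fun g => ⟨(hA g).1.sub_right (hB g).1, (hA g).2.sub_right (hB g).2⟩
lemma smul (c : ℂ) (hA : Bos A) : Bos (c • A) :=
  fun g => ⟨(hA g).1.smul_right c, (hA g).2.smul_right c⟩
lemma one : Bos (1 : Op d R) := fun _ => ⟨Commute.one_right _, Commute.one_right _⟩
lemma sum {ι : Type} (s : Finset ι) {f : ι → Op d R} (h : ∀ a ∈ s, Bos (f a)) :
    Bos (∑ a ∈ s, f a) :=
  fun g => ⟨Commute.sum_right _ _ _ fun a ha => (h a ha g).1,
    Commute.sum_right _ _ _ fun a ha => (h a ha g).2⟩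
lemma dy (μ : Fin d) : Bos (Fronsdal.dy μ : Op d R) := fun g => ⟨mo_dy μ g, dod_dy μ g⟩
lemma my (μ : Fin d) : Bos (Fronsdal.my μ : Op d R) := fun g => ⟨mo_my μ g, dod_my μ g⟩
lemma da (μ : Fin d) : Bos (Fronsdal.da μ : Op d R) := fun g => ⟨mo_da μ g, dod_da μ g⟩
lemma ma (μ : Fin d) : Bos (Fronsdal.ma μ : Op d R) := fun g => ⟨mo_ma μ g, dod_ma μ g⟩
lemma iy (μ : Fin d) : Bos (Fronsdal.iy μ : Op d R) := fun g => ⟨mo_iy μ g, dod_iy μ g⟩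
lemma ia (μ : Fin d) : Bos (Fronsdal.ia μ : Op d R) := fun g => ⟨mo_ia μ g, dod_ia μ g⟩
lemma opBox (η : Fin d → ℝ) : Bos (Fronsdal.opBox η : Op d R) :=
  sum _ fun μ _ => smul _ ((dy μ).mul (dy μ))
lemma opS (η : Fin d → ℝ) : Bos (Fronsdal.opS η : Op d R) :=
  sum _ fun μ _ => smul _ ((da μ).mul (dy μ))
lemma opT (η : Fin d → ℝ) : Bos (Fronsdal.opT η : Op d R) :=
  sum _ fun μ _ => smul _ ((da μ).mul (da μ))
lemma opSdag : Bos (Fronsdal.opSdag : Op d R) := sum _ fun μ _ => (ma μ).mul (dy μ)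
lemma opSbardag : Bos (Fronsdal.opSbardag : Op d R) := sum _ fun μ _ => (my μ).mul (da μ)
end Bos

/-! ### The homotopy for the leading terms -/

variable (η : Fin d → ℝ) (k₁ k₂ k₃ : Fin d)

/-- Leading term of `-□`. -/
def leadL : Op d R := (-η k₁ : ℂ) • (dy k₁ * dy k₁)
/-- Leading term of `-i S`. -/
def leadS : Op d R := (-Complex.I * η k₃) • (da k₃ * dy k₃)
/-- Leading term of `T`. -/
def leadT : Op d R := (η k₂ : ℂ) • (da k₂ * da k₂)
/-- A right inverse of `leadL`. -/
def invL : Op d R := (-η k₁ : ℂ) • (iy k₁ * iy k₁)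
/-- A right inverse of `leadS`. -/
def invS : Op d R := (Complex.I * η k₃) • (ia k₃ * iy k₃)
/-- A right inverse of `leadT`. -/
def invT : Op d R := (η k₂ : ℂ) • (ia k₂ * ia k₂)

section
variable {η k₁ k₂ k₃}

lemma Bos.leadL : Bos (leadL η k₁ : Op d R) := ((Bos.dy _).mul (Bos.dy _)).smul _
lemma Bos.leadS : Bos (leadS η k₃ : Op d R) := ((Bos.da _).mul (Bos.dy _)).smul _
lemma Bos.leadT : Bos (leadT η k₂ : Op d R) := ((Bos.da _).mul (Bos.da _)).smul _
lemma Bos.invL : Bos (invL η k₁ : Op d R) := ((Bos.iy _).mul (Bos.iy _)).smul _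
lemma Bos.invS : Bos (invS η k₃ : Op d R) := ((Bos.ia _).mul (Bos.iy _)).smul _
lemma Bos.invT : Bos (invT η k₂ : Op d R) := ((Bos.ia _).mul (Bos.ia _)).smul _

lemma eta_sq {x : ℝ} (h : x = 1 ∨ x = -1) : (x : ℂ) * x = 1 := by
  rcases h with h | h <;> simp [h]

lemma leadL_invL (h : η k₁ = 1 ∨ η k₁ = -1) : (leadL η k₁ : Op d R) * invL η k₁ = 1 := by
  rw [leadL, invL, smul_mul_smul_comm, neg_mul_neg, eta_sq h, one_smul]
  calc (dy k₁ : Op d R) * dy k₁ * (iy k₁ * iy k₁) = dy k₁ * (dy k₁ * iy k₁) * iy k₁ := by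
        noncomm_ring
    _ = 1 := by rw [dy_iy, mul_one, dy_iy]

lemma leadT_invT (h : η k₂ = 1 ∨ η k₂ = -1) : (leadT η k₂ : Op d R) * invT η k₂ = 1 := by
  rw [leadT, invT, smul_mul_smul_comm, eta_sq h, one_smul]
  calc (da k₂ : Op d R) * da k₂ * (ia k₂ * ia k₂) = da k₂ * (da k₂ * ia k₂) * ia k₂ := by
        noncomm_ring
    _ = 1 := by rw [da_ia, mul_one, da_ia]

lemma leadS_invS (h : η k₃ = 1 ∨ η k₃ = -1) : (leadS η k₃ : Op d R) * invS η k₃ = 1 := by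
  rw [leadS, invS, smul_mul_smul_comm, show -Complex.I * (η k₃ : ℂ) * (Complex.I * η k₃)
    = -(Complex.I * Complex.I) * (η k₃ * η k₃) by ring, eta_sq h, Complex.I_mul_I, neg_neg, one_mul,
    one_smul]
  calc (da k₃ : Op d R) * dy k₃ * (ia k₃ * iy k₃) = da k₃ * (dy k₃ * ia k₃) * iy k₃ := by
        noncomm_ring
    _ = (da k₃ * ia k₃) * (dy k₃ * iy k₃) := by rw [dy_ia]; noncomm_ring
    _ = 1 := by rw [dy_iy, mul_one, da_ia]

end

/-- The differential `θ A + c† B + ξ C`. -/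
def kos (A B C : Op d R) : Op d R :=
  mo (gTheta d) * A + mo (gCdag d) * B + mo (gXi d) * C

lemma gne : gTheta d ≠ gCdag d ∧ gTheta d ≠ gXi d ∧ gCdag d ≠ gXi d ∧ gTheta d ≠ gBdag d ∧
    gCdag d ≠ gBdag d ∧ gXi d ≠ gBdag d := by
  simp [gTheta, gCdag, gXi, gBdag]

lemma gneC (μ : Fin d) : gTheta d ≠ gC μ ∧ gCdag d ≠ gC μ ∧ gXi d ≠ gC μ ∧ gBdag d ≠ gC μ := by
  simp [gTheta, gCdag, gXi, gBdag, gC]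

/-- The Koszul factor of an anticommuting variable and an operator in the commuting variables. -/
def bosFactor (g : OddVar d) (K J : Op d R) (hK : Bos K) (hJ : Bos J) (h : K * J = 1) :
    KoszulFactor (Op d R) where
  t := mo g
  s := dod g
  K := K
  J := J
  tt := mo_sq g
  ss := dod_sq g
  st := dod_mo_self g
  tK := (hK g).1
  tJ := (hJ g).1
  sK := (hK g).2
  sJ := (hJ g).2
  KJ := h

lemma bosFactor_indep {g g' : OddVar d} (hne : g ≠ g') {K J K' J' : Op d R} (hK hJ h hK' hJ' h')
    (c1 : Commute K K') (c2 : Commute K J') (c3 : Commute J K') (c4 : Commute J J') :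
    (bosFactor g K J hK hJ h).Indep (bosFactor g' K' J' hK' hJ' h') where
  tt := mo_mo_of_ne hne
  ss := dod_dod _ _ hne
  ts := by
    have := dod_mo (R := R) g' g hne.symm
    exact (neg_eq_iff_eq_neg.2 this).symm
  st := dod_mo _ _ hne
  xt := by
    rintro a (rfl | rfl)
    · exact ⟨(hK g').1, (hJ g').1⟩
    · exact ⟨(hK g').2, (hJ g').2⟩
  yt := by
    rintro a (rfl | rfl)
    · exact ⟨(hK' g).1, (hJ' g).1⟩
    · exact ⟨(hK' g).2, (hJ' g).2⟩
  KK := c1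
  KJ := c2
  JK := c3
  JJ := c4

/-- The differential of the leading terms. -/
def leadD : Op d R := kos (leadL η k₁) (leadS η k₃) (leadT η k₂)

/-- The harmonic projector of the Koszul factor of `g`, `K`, `J`. -/
def harmP (g : OddVar d) (K J : Op d R) : Op d R := dod g * mo g * (1 - J * K)

/-- The projector on the harmonic states of `leadD`. -/
def leadP : Op d R := harmP (gTheta d) (leadL η k₁) (invL η k₁) *
  harmP (gCdag d) (leadS η k₃) (invS η k₃) * harmP (gXi d) (leadT η k₂) (invT η k₂)

/-- The contracting homotopy of `leadD`. -/
def leadH : Op d R := dod (gTheta d) * invL η k₁ +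
  harmP (gTheta d) (leadL η k₁) (invL η k₁) * (dod (gCdag d) * invS η k₃) +
  harmP (gTheta d) (leadL η k₁) (invL η k₁) * harmP (gCdag d) (leadS η k₃) (invS η k₃) *
    (dod (gXi d) * invT η k₂)

variable {η k₁ k₂ k₃} (h12 : k₁ ≠ k₂) (h13 : k₁ ≠ k₃) (h23 : k₂ ≠ k₃)

section Comm

lemma Commute.mul_mul {A B C D : Op d R} {x y : ℂ} (h1 : Commute A C) (h2 : Commute A D)
    (h3 : Commute B C) (h4 : Commute B D) : Commute (x • (A * B)) (y • (C * D)) :=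
  (((h1.mul_right h2).mul_left (h3.mul_right h4)).smul_left x).smul_right y

include h13 in
lemma comm_LS : Commute (leadL η k₁ : Op d R) (leadS η k₃) ∧
    Commute (leadL η k₁ : Op d R) (invS η k₃) ∧ Commute (invL η k₁ : Op d R) (leadS η k₃) ∧
    Commute (invL η k₁ : Op d R) (invS η k₃) := by
  have a1 : Commute (dy k₁ : Op d R) (da k₃) := dy_da _ _
  have a2 : Commute (dy k₁ : Op d R) (dy k₃) := dy_dy _ _
  have a3 : Commute (dy k₁ : Op d R) (ia k₃) := dy_ia _ _
  have a4 : Commute (dy k₁ : Op d R) (iy k₃) := dy_iy_of_ne h13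
  have b1 : Commute (iy k₁ : Op d R) (da k₃) := iy_da _ _
  have b2 : Commute (iy k₁ : Op d R) (dy k₃) := (dy_iy_of_ne h13.symm).symm
  have b3 : Commute (iy k₁ : Op d R) (ia k₃) := iy_ia _ _
  have b4 : Commute (iy k₁ : Op d R) (iy k₃) := iy_iy_of_ne h13
  exact ⟨Commute.mul_mul a1 a2 a1 a2, Commute.mul_mul a3 a4 a3 a4, Commute.mul_mul b1 b2 b1 b2,
    Commute.mul_mul b3 b4 b3 b4⟩

lemma comm_LT : Commute (leadL η k₁ : Op d R) (leadT η k₂) ∧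
    Commute (leadL η k₁ : Op d R) (invT η k₂) ∧ Commute (invL η k₁ : Op d R) (leadT η k₂) ∧
    Commute (invL η k₁ : Op d R) (invT η k₂) := by
  have a1 : Commute (dy k₁ : Op d R) (da k₂) := dy_da _ _
  have a3 : Commute (dy k₁ : Op d R) (ia k₂) := dy_ia _ _
  have b1 : Commute (iy k₁ : Op d R) (da k₂) := iy_da _ _
  have b3 : Commute (iy k₁ : Op d R) (ia k₂) := iy_ia _ _
  exact ⟨Commute.mul_mul a1 a1 a1 a1, Commute.mul_mul a3 a3 a3 a3, Commute.mul_mul b1 b1 b1 b1,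
    Commute.mul_mul b3 b3 b3 b3⟩

include h23 in
lemma comm_ST : Commute (leadS η k₃ : Op d R) (leadT η k₂) ∧
    Commute (leadS η k₃ : Op d R) (invT η k₂) ∧ Commute (invS η k₃ : Op d R) (leadT η k₂) ∧
    Commute (invS η k₃ : Op d R) (invT η k₂) := by
  have a1 : Commute (dy k₃ : Op d R) (da k₂) := dy_da _ _
  have a2 : Commute (da k₃ : Op d R) (da k₂) := da_da _ _
  have a3 : Commute (dy k₃ : Op d R) (ia k₂) := dy_ia _ _
  have a4 : Commute (da k₃ : Op d R) (ia k₂) := da_ia_of_ne h23.symm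
  have b1 : Commute (iy k₃ : Op d R) (da k₂) := iy_da _ _
  have b2 : Commute (ia k₃ : Op d R) (da k₂) := (da_ia_of_ne h23).symm
  have b3 : Commute (iy k₃ : Op d R) (ia k₂) := iy_ia _ _
  have b4 : Commute (ia k₃ : Op d R) (ia k₂) := ia_ia_of_ne h23.symm
  exact ⟨Commute.mul_mul a2 a2 a1 a1, Commute.mul_mul a4 a4 a3 a3, Commute.mul_mul b2 b2 b1 b1,
    Commute.mul_mul b4 b4 b3 b3⟩

end Comm

include h13 h23 in
/-- As the indices are distinct, the leading terms and their right inverses involve disjoint sets of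
variables, so the three Koszul factors are independent and `contraction_three` applies. -/
lemma lead_contraction (hη : ∀ μ, η μ = 1 ∨ η μ = -1) :
    (leadD η k₁ k₂ k₃ : Op d R) * leadH η k₁ k₂ k₃ + leadH η k₁ k₂ k₃ * leadD η k₁ k₂ k₃ =
      1 - leadP η k₁ k₂ k₃ ∧
    (leadH η k₁ k₂ k₃ : Op d R) * leadH η k₁ k₂ k₃ = 0 ∧
    (leadH η k₁ k₂ k₃ : Op d R) * leadP η k₁ k₂ k₃ = 0 ∧
    (leadP η k₁ k₂ k₃ : Op d R) * mo (gTheta d) = 0 ∧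
    (leadP η k₁ k₂ k₃ : Op d R) * mo (gCdag d) = 0 ∧
    (leadP η k₁ k₂ k₃ : Op d R) * mo (gXi d) = 0 ∧
    dod (gTheta d) * (leadP η k₁ k₂ k₃ : Op d R) = 0 ∧
    dod (gCdag d) * (leadP η k₁ k₂ k₃ : Op d R) = 0 ∧
    dod (gXi d) * (leadP η k₁ k₂ k₃ : Op d R) = 0 := by
  obtain ⟨n1, n2, n3, -⟩ := gne (d := d)
  obtain ⟨x1, x2, x3, x4⟩ := comm_LS (R := R) (η := η) h13
  obtain ⟨y1, y2, y3, y4⟩ := comm_LT (R := R) (η := η) (k₁ := k₁) (k₂ := k₂)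
  obtain ⟨z1, z2, z3, z4⟩ := comm_ST (R := R) (η := η) h23
  let x := bosFactor (gTheta d) (leadL η k₁ : Op d R) _ Bos.leadL Bos.invL (leadL_invL (hη k₁))
  let y := bosFactor (gCdag d) (leadS η k₃ : Op d R) _ Bos.leadS Bos.invS (leadS_invS (hη k₃))
  let z := bosFactor (gXi d) (leadT η k₂ : Op d R) _ Bos.leadT Bos.invT (leadT_invT (hη k₂))
  have hxy : x.Indep y := bosFactor_indep n1 _ _ _ _ _ _ x1 x2 x3 x4
  have hxz : x.Indep z := bosFactor_indep n2 _ _ _ _ _ _ y1 y2 y3 y4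
  have hyz : y.Indep z := bosFactor_indep n3 _ _ _ _ _ _ z1 z2 z3 z4
  obtain ⟨c1, c2, c3⟩ := KoszulFactor.contraction_three hxy hxz hyz
  refine ⟨c1, c2, c3, ?_, ?_, ?_, ?_, ?_, ?_⟩
  · show x.harm * y.harm * z.harm * x.t = 0
    rw [mul_assoc, ← hxz.t_harm.eq, ← mul_assoc, mul_assoc x.harm, ← hxy.t_harm.eq, ← mul_assoc,
      x.harm_t, zero_mul, zero_mul]
  · show x.harm * y.harm * z.harm * y.t = 0
    rw [mul_assoc, ← hyz.t_harm.eq, ← mul_assoc, mul_assoc x.harm, y.harm_t, mul_zero, zero_mul]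
  · show x.harm * y.harm * z.harm * z.t = 0
    rw [mul_assoc, z.harm_t, mul_zero]
  · show x.s * (x.harm * y.harm * z.harm) = 0
    rw [← mul_assoc, ← mul_assoc, x.s_harm, zero_mul, zero_mul]
  · show y.s * (x.harm * y.harm * z.harm) = 0
    rw [← mul_assoc, ← mul_assoc, hxy.symm.s_harm.eq, mul_assoc x.harm, y.s_harm, mul_zero,
      zero_mul]
  · show z.s * (x.harm * y.harm * z.harm) = 0
    rw [← mul_assoc, ← mul_assoc, hxz.symm.s_harm.eq, mul_assoc x.harm, hyz.symm.s_harm.eq,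
      mul_assoc, mul_assoc, z.s_harm, mul_zero, mul_zero]

end Koszul

/-! ### The perturbed homotopy for the part of degree `-1` -/

section Degrees

variable {d : ℕ} {R : Type} [AddCommGroup R] [Module ℂ R] {η : Fin d → ℝ} {k₁ k₂ k₃ : Fin d}
  {α β : Fin d → ℤ} {γ : OddVar d → ℤ} {m : ℤ}

lemma sh_harmP {w : Mono d → ℤ} {g : OddVar d} {K J : Op d R} {a b : ℤ} (h1 : Sh w a (dod g : Op d R))
    (h2 : Sh w (-a) (mo g : Op d R)) (h3 : Sh w b K) (h4 : Sh w (-b) J) :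
    Sh w 0 (harmP g K J) := by
  have hp : Sh w 0 (1 - J * K) := Rel.sub Sh.one (h4.mul h3 (by ring))
  exact (h1.mul h2 (m := 0) (by ring)).mul hp (by ring)

variable (h1 : 2 * α k₁ = γ (gTheta d) + m) (h2 : α k₃ + β k₃ = γ (gCdag d) + m)
  (h3 : 2 * β k₂ = γ (gXi d) + m)
include h1 h2 h3

lemma sh_leadD : Sh (lw α β γ) (-m) (leadD η k₁ k₂ k₃ : Op d R) := by
  refine Rel.add (Rel.add ?_ ?_) ?_
  · exact (sh_mo α β γ _).mul (Rel.smul _ ((sh_dy α β γ k₁).mul (sh_dy α β γ k₁) rfl)) (by linarith)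
  · exact (sh_mo α β γ _).mul (Rel.smul _ ((sh_da α β γ k₃).mul (sh_dy α β γ k₃) rfl)) (by linarith)
  · exact (sh_mo α β γ _).mul (Rel.smul _ ((sh_da α β γ k₂).mul (sh_da α β γ k₂) rfl)) (by linarith)

lemma sh_leadH : Sh (lw α β γ) m (leadH η k₁ k₂ k₃ : Op d R) := by
  have L : Sh (lw α β γ) (-(2 * α k₁)) (leadL η k₁ : Op d R) :=
    Rel.smul _ ((sh_dy α β γ k₁).mul (sh_dy α β γ k₁) (by ring))
  have L' : Sh (lw α β γ) (2 * α k₁) (invL η k₁ : Op d R) :=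
    Rel.smul _ ((sh_iy α β γ k₁).mul (sh_iy α β γ k₁) (by ring))
  have S : Sh (lw α β γ) (-(α k₃ + β k₃)) (leadS η k₃ : Op d R) :=
    Rel.smul _ ((sh_da α β γ k₃).mul (sh_dy α β γ k₃) (by ring))
  have S' : Sh (lw α β γ) (α k₃ + β k₃) (invS η k₃ : Op d R) :=
    Rel.smul _ ((sh_ia α β γ k₃).mul (sh_iy α β γ k₃) (by ring))
  have T' : Sh (lw α β γ) (2 * β k₂) (invT η k₂ : Op d R) :=
    Rel.smul _ ((sh_ia α β γ k₂).mul (sh_ia α β γ k₂) (by ring))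
  have p1 := sh_harmP (sh_dod α β γ (gTheta d)) ((sh_mo α β γ _).sub_degree (by ring)) L
    (L'.sub_degree (by ring))
  have p2 := sh_harmP (sh_dod α β γ (gCdag d)) ((sh_mo α β γ _).sub_degree (by ring)) S
    (S'.sub_degree (by ring))
  refine Rel.add (Rel.add ?_ ?_) ?_
  · exact (sh_dod α β γ _).mul L' (by linarith)
  · exact p1.mul ((sh_dod α β γ _).mul S' rfl) (by linarith)
  · exact (p1.mul p2 rfl).mul ((sh_dod α β γ _).mul T' rfl) (by linarith)

end Degrees

section Contraction

variable {d : ℕ} {R : Type} [AddCommGroup R] [Module ℂ R] (η : Fin d → ℝ) (k₁ k₂ k₃ : Fin d)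

/-- `OmegaMinus` is the Koszul differential of `-□`, `-i S`, `T`. -/
lemma omegaMinus_eq (hη : ∀ μ, η μ = 1 ∨ η μ = -1) :
    (OmegaMinus η : Op d R) = kos (-opBox η) (-Complex.I • opS η) (opT η) := by
  have e1 : (conL η : Op d R) = -opBox η := by
    ext φ : 1
    simp only [conL, py, opBox, LinearMap.sum_apply, LinearMap.smul_apply, LinearMap.comp_apply,
      LinearMap.neg_apply, map_smul, ← Finset.sum_neg_distrib]
    refine Finset.sum_congr rfl fun μ _ => ?_
    simp only [smul_smul]
    rw [← neg_smul]
    congr 1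
    linear_combination (η μ : ℂ) * Complex.I_mul_I
  have e2 : (conS η : Op d R) = -Complex.I • opS η := by
    ext φ : 1
    simp only [conS, py, aop, opS, LinearMap.sum_apply, LinearMap.smul_apply, LinearMap.comp_apply,
      map_smul, Finset.smul_sum]
    refine Finset.sum_congr rfl fun μ _ => ?_
    rw [smul_smul, smul_smul, mul_comm, ← Module.End.mul_apply, dy_da, Module.End.mul_apply]
  have e3 : (conT η : Op d R) = opT η := by
    ext φ : 1
    simp only [conT, aop, opT, LinearMap.sum_apply, LinearMap.smul_apply, LinearMap.comp_apply,
      map_smul]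
    refine Finset.sum_congr rfl fun μ _ => ?_
    rw [smul_smul, smul_smul, eta_sq (hη μ), one_mul]
  rw [OmegaMinus, e1, e2, e3]
  rfl

lemma opBox_eq : (opBox η : Op d R) = ∑ μ, (η μ : ℂ) • (dy μ * dy μ) := rfl
lemma opS_eq : (opS η : Op d R) = ∑ μ, (η μ : ℂ) • (da μ * dy μ) := rfl
lemma opT_eq : (opT η : Op d R) = ∑ μ, (η μ : ℂ) • (da μ * da μ) := rfl

lemma commute_constraints : Commute (opBox η : Op d R) (opS η) ∧
    Commute (opBox η : Op d R) (opT η) ∧ Commute (opS η : Op d R) (opT η) := by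
  have a1 : ∀ μ ν, Commute (dy μ : Op d R) (dy ν) := dy_dy
  have a2 : ∀ μ ν, Commute (dy μ : Op d R) (da ν) := dy_da
  have a3 : ∀ μ ν, Commute (da μ : Op d R) (da ν) := da_da
  have a4 : ∀ μ ν, Commute (da μ : Op d R) (dy ν) := fun μ ν => (a2 ν μ).symm
  refine ⟨?_, ?_, ?_⟩
  · exact Commute.sum_left _ _ _ fun μ _ => Commute.sum_right _ _ _ fun ν _ =>
      Commute.mul_mul (a2 μ ν) (a1 μ ν) (a2 μ ν) (a1 μ ν)
  · exact Commute.sum_left _ _ _ fun μ _ => Commute.sum_right _ _ _ fun ν _ =>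
      Commute.mul_mul (a2 μ ν) (a2 μ ν) (a2 μ ν) (a2 μ ν)
  · exact Commute.sum_left _ _ _ fun μ _ => Commute.sum_right _ _ _ fun ν _ =>
      Commute.mul_mul (a3 μ ν) (a3 μ ν) (a2 μ ν) (a2 μ ν)

lemma kos_sq {A B C : Op d R} (hA : Bos A) (hB : Bos B) (hC : Bos C) (h1 : Commute A B)
    (h2 : Commute A C) (h3 : Commute B C) : kos A B C * kos A B C = 0 := by
  have sq : ∀ (g : OddVar d) {X : Op d R}, Bos X → mo g * X * (mo g * X) = 0 := fun g X hX => by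
    rw [mul_assoc, ← mul_assoc X, ← (hX g).1.eq, mul_assoc, ← mul_assoc, mo_sq, zero_mul]
  have anti : ∀ (g g' : OddVar d) {X Y : Op d R}, Bos X → Bos Y → Commute X Y →
      mo g * X * (mo g' * Y) = -(mo g' * Y * (mo g * X)) := fun g g' X Y hX hY h =>
    KoszulFactor.anti_mul (mo_mo g g') (hX g').1 (hY g).1 h
  rw [kos, add_mul, add_mul, mul_add, mul_add, mul_add, mul_add, mul_add, mul_add, sq _ hA, sq _ hB,
    sq _ hC, anti (gCdag d) (gTheta d) hB hA h1.symm, anti (gXi d) (gTheta d) hC hA h2.symm,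
    anti (gXi d) (gCdag d) hC hB h3.symm]
  abel

lemma omegaMinus_sq (hη : ∀ μ, η μ = 1 ∨ η μ = -1) :
    (OmegaMinus η : Op d R) * OmegaMinus η = 0 := by
  obtain ⟨h1, h2, h3⟩ := commute_constraints (R := R) η
  rw [omegaMinus_eq η hη]
  exact kos_sq (Bos.opBox η).neg ((Bos.opS η).smul _) (Bos.opT η) (h1.neg_left.smul_right _)
    h2.neg_left (h3.smul_left _)

/-- Weights of the variables `y`: together with `wA` and the weights `6`, `4`, `6` of `θ`, `c†`, `ξ`
they single out the leading terms as those of degree zero. -/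
def wY (μ : Fin d) : ℤ := if μ = k₁ then 3 else if μ = k₃ then 2 else 0
/-- Weights of the variables `a†`, chosen like `wY`. -/
def wA (μ : Fin d) : ℤ := if μ = k₂ then 3 else if μ = k₃ then 2 else 0
/-- A function of the anticommuting variables with values `x`, `y`, `z` at `θ`, `c†`, `ξ` that
vanishes at the other variables. -/
def wO (x y z : ℤ) (g : OddVar d) : ℤ :=
  if g = gTheta d then x else if g = gCdag d then y else if g = gXi d then z else 0

lemma wO_theta (x y z : ℤ) : wO x y z (gTheta d) = x := if_pos rfl
lemma wO_cdag (x y z : ℤ) : wO x y z (gCdag d) = y := by simp [wO, gne.1.symm]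
lemma wO_xi (x y z : ℤ) : wO x y z (gXi d) = z := by simp [wO, gne.2.1.symm, gne.2.2.1.symm]
lemma wO_bdag (x y z : ℤ) : wO x y z (gBdag d) = 0 := by
  obtain ⟨-, -, -, h1, h2, h3⟩ := gne (d := d)
  simp [wO, h1.symm, h2.symm, h3.symm]
lemma wO_C (x y z : ℤ) (μ : Fin d) : wO x y z (gC μ) = 0 := by
  obtain ⟨h1, h2, h3, -⟩ := gneC μ
  simp [wO, h1.symm, h2.symm, h3.symm]

/-- The homogeneity degree in `θ`, `c†`, `ξ`. -/
def kdeg : Mono d → ℤ := lw 0 0 (wO 1 1 1)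

/-- The `a†`-degree, corrected so that `OmegaMinus` preserves it. -/
def adeg' : Mono d → ℤ := lw 0 1 (wO 0 1 2)

/-- The degree preserved by the leading terms and raised by the others. -/
def wLead : Mono d → ℤ := lw (wY k₁ k₃) (wA k₂ k₃) (wO 6 4 6)

lemma wO_nonneg {x y z : ℤ} (hx : 0 ≤ x) (hy : 0 ≤ y) (hz : 0 ≤ z) (g : OddVar d) :
    0 ≤ wO x y z g := by
  unfold wO; split_ifs <;> first | assumption | exact le_rfl

lemma wLead_nonneg (i : Mono d) : 0 ≤ wLead k₁ k₂ k₃ i := by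
  refine add_nonneg (add_nonneg ?_ ?_) (Finset.sum_nonneg fun g _ => wO_nonneg ?_ ?_ ?_ g)
  · exact Finset.sum_nonneg fun μ _ => mul_nonneg (by unfold wY; split_ifs <;> norm_num) (by simp)
  · exact Finset.sum_nonneg fun μ _ => mul_nonneg (by unfold wA; split_ifs <;> norm_num) (by simp)
  all_goals norm_num

lemma adeg'_bound (i : Mono d) :
    (i.adeg : ℤ) ≤ adeg' i ∧ adeg' i ≤ i.adeg + (∑ g : OddVar d, wO 0 1 2 g).toNat := by
  have h0 : ∀ g : OddVar d, 0 ≤ wO 0 1 2 g := wO_nonneg le_rfl (by norm_num) (by norm_num)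
  have e : adeg' i = i.adeg + ∑ g ∈ i.odd, wO 0 1 2 g := by
    simp [adeg', lw, Mono.adeg]
  have h1 : 0 ≤ ∑ g ∈ i.odd, wO 0 1 2 g := Finset.sum_nonneg fun g _ => h0 g
  have h2 : ∑ g ∈ i.odd, wO 0 1 2 g ≤ ∑ g : OddVar d, wO 0 1 2 g :=
    Finset.sum_le_sum_of_subset_of_nonneg (Finset.subset_univ _) fun g _ _ => h0 g
  omega

variable {η k₁ k₂ k₃}

lemma sh_omegaMinus {a b m : ℤ} {γ : OddVar d → ℤ} (hη : ∀ μ, η μ = 1 ∨ η μ = -1)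
    (h1 : γ (gTheta d) - 2 * a = m) (h2 : γ (gCdag d) - a - b = m) (h3 : γ (gXi d) - 2 * b = m) :
    Sh (lw (fun _ => a) (fun _ => b) γ) m (OmegaMinus η : Op d R) := by
  rw [omegaMinus_eq η hη]
  refine Rel.add (Rel.add ?_ ?_) ?_
  · exact (sh_mo _ _ _ _).mul (Rel.neg (Rel.sum _ fun μ _ =>
      Rel.smul _ ((sh_dy _ _ γ μ).mul (sh_dy _ _ γ μ) rfl))) (by linarith)
  · exact (sh_mo _ _ _ _).mul (Rel.smul _ (Rel.sum _ fun μ _ =>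
      Rel.smul _ ((sh_da _ _ γ μ).mul (sh_dy _ _ γ μ) rfl))) (by linarith)
  · exact (sh_mo _ _ _ _).mul (Rel.sum _ fun μ _ =>
      Rel.smul _ ((sh_da _ _ γ μ).mul (sh_da _ _ γ μ) rfl)) (by linarith)

/-- The weights are such that the leading terms preserve the degree and all other terms raise it;
e.g. the terms `∂/∂a† ∂/∂y` with index `k₁` or `k₂` remove weight `3`, the leading one removes `4`. -/
lemma low_rest (h12 : k₁ ≠ k₂) (hη : ∀ μ, η μ = 1 ∨ η μ = -1) :
    Low (wLead k₁ k₂ k₃) 1 (OmegaMinus η - leadD η k₁ k₂ k₃ : Op d R) := by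
  have e : (OmegaMinus η - leadD η k₁ k₂ k₃ : Op d R) =
      mo (gTheta d) * (-∑ μ ∈ Finset.univ.erase k₁, (η μ : ℂ) • (dy μ * dy μ)) +
      mo (gCdag d) * (-Complex.I • ∑ μ ∈ Finset.univ.erase k₃, (η μ : ℂ) • (da μ * dy μ)) +
      mo (gXi d) * (∑ μ ∈ Finset.univ.erase k₂, (η μ : ℂ) • (da μ * da μ)) := by
    have e1 : (-opBox η : Op d R) = leadL η k₁ +
        -∑ μ ∈ Finset.univ.erase k₁, (η μ : ℂ) • (dy μ * dy μ) := by
      rw [opBox_eq, ← Finset.add_sum_erase _ _ (Finset.mem_univ k₁), leadL, neg_add]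
      exact congrArg (· + _) (neg_smul _ _).symm
    have e2 : (-Complex.I • opS η : Op d R) = leadS η k₃ +
        -Complex.I • ∑ μ ∈ Finset.univ.erase k₃, (η μ : ℂ) • (da μ * dy μ) := by
      rw [opS_eq, ← Finset.add_sum_erase _ _ (Finset.mem_univ k₃), leadS, smul_add, smul_smul]
    have e3 : (opT η : Op d R) = leadT η k₂ +
        ∑ μ ∈ Finset.univ.erase k₂, (η μ : ℂ) • (da μ * da μ) := by
      rw [opT_eq, ← Finset.add_sum_erase _ _ (Finset.mem_univ k₂), leadT]
    rw [omegaMinus_eq η hη, kos, leadD, kos, e1, e2, e3, mul_add, mul_add, mul_add]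
    abel
  rw [e]
  refine Rel.add (Rel.add ?_ ?_) ?_
  · refine ((sh_mo _ _ _ _).low (l := 6) (by rw [wO_theta])).mul (k := 6) (l := -5) (Rel.neg (Rel.sum _
      fun μ hμ => Rel.smul _ (((sh_dy _ _ _ μ).mul (sh_dy _ _ _ μ) rfl).low ?_))) (by ring)
    have := Finset.ne_of_mem_erase hμ
    simp only [wY, this, if_false]
    split_ifs <;> norm_num
  · refine ((sh_mo _ _ _ _).low (l := 4) (by rw [wO_cdag])).mul (k := 4) (l := -3) (Rel.smul _ (Rel.sum _
      fun μ hμ => Rel.smul _ (((sh_da _ _ _ μ).mul (sh_dy _ _ _ μ) rfl).low ?_))) (by ring)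
    have := Finset.ne_of_mem_erase hμ
    by_cases h1 : μ = k₁
    · subst h1
      simp [wY, wA, this, h12]
    · simp only [wY, wA, this, h1, if_false]
      split_ifs <;> norm_num
  · refine ((sh_mo _ _ _ _).low (l := 6) (by rw [wO_xi])).mul (k := 6) (l := -5) (Rel.sum _
      fun μ hμ => Rel.smul _ (((sh_da _ _ _ μ).mul (sh_da _ _ _ μ) rfl).low ?_)) (by ring)
    have := Finset.ne_of_mem_erase hμ
    simp only [wA, this, if_false]
    split_ifs <;> norm_num

variable (η k₁ k₂ k₃)

/-- The part of `OmegaMinus` besides the leading terms, composed with the homotopy. -/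
def restH : Op d R := (OmegaMinus η - leadD η k₁ k₂ k₃) * leadH η k₁ k₂ k₃

/-- The homotopy for `OmegaMinus` obtained by perturbation of the one for the leading terms. -/
def contr : Op d R := leadH η k₁ k₂ k₃ * Ring.inverse (1 + restH η k₁ k₂ k₃)

variable {η k₁ k₂ k₃} (h12 : k₁ ≠ k₂) (h13 : k₁ ≠ k₃) (h23 : k₂ ≠ k₃)
  (hη : ∀ μ, η μ = 1 ∨ η μ = -1)

include h12 h13 h23 hη in
lemma isUnit_restH : IsUnit (1 + restH η k₁ k₂ k₃ : Op d R) := by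
  obtain ⟨B, h1, h2⟩ := neumann (wLead_nonneg k₁ k₂ k₃)
    (A := (restH η k₁ k₂ k₃ : Op d R)) (by
      refine (low_rest h12 hη).mul ((sh_leadH (m := 0) ?_ ?_ ?_).low le_rfl) (by ring)
      · simp [wY, wO_theta]
      · simp [wY, wA, wO_cdag, h13.symm, h23.symm]
      · simp [wA, wO_xi])
    _ adeg'_bound (by
      refine Sh.mul (m := 0) (k := 0) (Rel.sub (sh_omegaMinus hη ?_ ?_ ?_)
        (sh_leadD (m := 0) ?_ ?_ ?_)) (sh_leadH (m := 0) ?_ ?_ ?_) (by ring)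
      all_goals simp [wO_theta, wO_cdag, wO_xi])
  exact ⟨⟨_, B, h1, h2⟩, rfl⟩

include h12 h13 h23 hη

/-- The homotopy inherits every grading in which `OmegaMinus` is homogeneous. -/
lemma sh_contr {a b m : ℤ} {γ : OddVar d → ℤ}
    (h1 : γ (gTheta d) - 2 * a = m) (h2 : γ (gCdag d) - a - b = m) (h3 : γ (gXi d) - 2 * b = m) :
    Sh (lw (fun _ => a) (fun _ => b) γ) (-m) (contr η k₁ k₂ k₃ : Op d R) := by
  have hH : Sh (lw (fun _ => a) (fun _ => b) γ) (-m) (leadH η k₁ k₂ k₃ : Op d R) :=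
    sh_leadH (by linarith) (by linarith) (by linarith)
  have hr : Sh (lw (fun _ => a) (fun _ => b) γ) 0 (restH η k₁ k₂ k₃ : Op d R) := by
    refine Sh.mul (k := m) (Rel.sub (sh_omegaMinus hη h1 h2 h3)
      (Sh.sub_degree (sh_leadD (m := -m) ?_ ?_ ?_) (neg_neg m))) hH (by ring) <;> linarith
  have hu := isUnit_restH (R := R) h12 h13 h23 hη
  exact hH.mul (Sh.inv (Rel.add Sh.one hr) (Ring.mul_inverse_cancel _ hu)
    (Ring.inverse_mul_cancel _ hu)) (by ring)

/-- Besides the relations of a homotopy: the harmonic projector factors through the harmonic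
projector of the leading terms. -/
lemma contr_relations :
    (contr η k₁ k₂ k₃ : Op d R) * contr η k₁ k₂ k₃ = 0 ∧
    (contr η k₁ k₂ k₃ : Op d R) * OmegaMinus η * contr η k₁ k₂ k₃ = contr η k₁ k₂ k₃ ∧
    (OmegaMinus η : Op d R) * contr η k₁ k₂ k₃ * OmegaMinus η = OmegaMinus η ∧
    (contr η k₁ k₂ k₃ : Op d R) = leadH η k₁ k₂ k₃ -
      contr η k₁ k₂ k₃ * (OmegaMinus η - leadD η k₁ k₂ k₃) * leadH η k₁ k₂ k₃ ∧
    (1 - OmegaMinus η * contr η k₁ k₂ k₃ - contr η k₁ k₂ k₃ * OmegaMinus η : Op d R) =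
      (1 - contr η k₁ k₂ k₃ * (OmegaMinus η - leadD η k₁ k₂ k₃)) * leadP η k₁ k₂ k₃ *
      (1 - OmegaMinus η * contr η k₁ k₂ k₃ - contr η k₁ k₂ k₃ * OmegaMinus η) := by
  have hu := isUnit_restH (R := R) h12 h13 h23 hη
  obtain ⟨c1, c2, c3, c4, c5, c6, -⟩ := lead_contraction (R := R) h13 h23 hη
  have e : (OmegaMinus η - (OmegaMinus η - leadD η k₁ k₂ k₃) : Op d R) = leadD η k₁ k₂ k₃ := by
    abel
  exact perturbation (omegaMinus_sq (R := R) η hη) c2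
    (D1 := OmegaMinus η - leadD η k₁ k₂ k₃) (by rw [e]; exact c1) c3 (by
      rw [omegaMinus_eq η hη, kos, mul_add, mul_add, ← mul_assoc, c4, ← mul_assoc, c5, ← mul_assoc,
        c6]; simp) (Ring.inverse_mul_cancel _ hu) (Ring.mul_inverse_cancel _ hu)

omit h12 h13 h23 hη in
lemma mem_ker_dod {g : OddVar d} {φ : Fock d R} :
    dod g φ = 0 ↔ ∀ i : Mono d, g ∈ i.odd → φ.1 i = 0 := by
  constructor
  · intro h i hi
    have h2 := congrArg (fun A : Op d R => (A φ).1 i) (dod_mo_self (R := R) g)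
    simp only [Module.End.mul_apply, LinearMap.sub_apply, Module.End.one_apply, h, map_zero,
      sub_zero] at h2
    rw [← h2, dod_eq, oMode_apply, if_pos hi, zero_smul]
  · intro h
    refine Fock.ext' fun i => ?_
    rw [dod_eq, oMode_apply, h _ (Finset.mem_insert_self g _), smul_zero]
    rfl

omit h12 h13 h23 hη in
/-- A state is independent of `θ`, `c†`, `ξ` iff its degree in these is zero. -/
lemma mem_ker_dod_iff_kdeg {φ : Fock d R} :
    (dod (gTheta d) φ = 0 ∧ dod (gCdag d) φ = 0 ∧ dod (gXi d) φ = 0) ↔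
      ∀ i : Mono d, kdeg i ≠ 0 → φ.1 i = 0 := by
  have h0 : ∀ g : OddVar d, 0 ≤ wO 1 1 1 g :=
    wO_nonneg (by norm_num) (by norm_num) (by norm_num)
  have e : ∀ i : Mono d, kdeg i = ∑ g ∈ i.odd, wO 1 1 1 g := fun i => by simp [kdeg, lw]
  simp only [mem_ker_dod]
  constructor
  · rintro ⟨h1, h2, h3⟩ i hi
    by_contra hφ
    refine hi ?_
    rw [e]
    refine Finset.sum_eq_zero fun g hg => ?_
    unfold wO
    split_ifs with g1 g2 g3
    · exact absurd (h1 i (g1 ▸ hg)) hφ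
    · exact absurd (h2 i (g2 ▸ hg)) hφ
    · exact absurd (h3 i (g3 ▸ hg)) hφ
    · rfl
  · intro h
    have key : ∀ g : OddVar d, wO 1 1 1 g = 1 → ∀ i : Mono d, g ∈ i.odd → φ.1 i = 0 :=
      fun g hg i hi => h i (by
        rw [e]
        have := Finset.single_le_sum (f := wO 1 1 1) (fun x _ => h0 x) hi
        omega)
    exact ⟨key _ (wO_theta _ _ _), key _ (wO_cdag _ _ _), key _ (wO_xi _ _ _)⟩

omit h12 h13 h23 hη in
lemma kdeg_bounds (i : Mono d) : 0 ≤ kdeg i ∧ kdeg i ≤ ∑ g : OddVar d, wO 1 1 1 g := by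
  have h0 : ∀ g : OddVar d, 0 ≤ wO 1 1 1 g :=
    wO_nonneg (by norm_num) (by norm_num) (by norm_num)
  have e : kdeg i = ∑ g ∈ i.odd, wO 1 1 1 g := by simp [kdeg, lw]
  rw [e]
  exact ⟨Finset.sum_nonneg fun g _ => h0 g,
    Finset.sum_le_sum_of_subset_of_nonneg (Finset.subset_univ _) fun g _ _ => h0 g⟩

/-- The harmonic projector of `OmegaMinus` takes values in the states without `θ`, `c†`, `ξ`. -/
lemma kdeg_harmonic (φ : Fock d R) (i : Mono d) (hi : kdeg i ≠ 0) :
    ((1 - OmegaMinus η * contr η k₁ k₂ k₃ - contr η k₁ k₂ k₃ * OmegaMinus η : Op d R) φ).1 i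
      = 0 := by
  obtain ⟨c1, -, -, -, -, -, c7, c8, c9⟩ := lead_contraction (R := R) h13 h23 hη
  obtain ⟨-, -, -, -, hP⟩ := contr_relations (R := R) h12 h13 h23 hη
  have s1 : Sh kdeg 1 (OmegaMinus η : Op d R) := sh_omegaMinus hη (by simp [wO_theta])
    (by simp [wO_cdag]) (by simp [wO_xi])
  have s2 : Sh kdeg (-1) (contr η k₁ k₂ k₃ : Op d R) := sh_contr h12 h13 h23 hη
    (by simp [wO_theta]) (by simp [wO_cdag]) (by simp [wO_xi])
  have sP : Sh kdeg 0 (1 - OmegaMinus η * contr η k₁ k₂ k₃ - contr η k₁ k₂ k₃ * OmegaMinus η :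
      Op d R) := Rel.sub (Rel.sub Sh.one (s1.mul s2 (by ring))) (s2.mul s1 (by ring))
  generalize (1 - OmegaMinus η * contr η k₁ k₂ k₃ - contr η k₁ k₂ k₃ * OmegaMinus η : Op d R) = P
    at hP sP
  let π : Op d R := diag (fun j => if kdeg j = kdeg i then 1 else 0)
  have hπ : π * P = P * π := Rel.diag_mul sP fun a b hab => by simp [hab]
  have hπ0 : leadP η k₁ k₂ k₃ * P * π = 0 := by
    rw [mul_assoc, ← hπ, ← mul_assoc]
    have s0 : Sh kdeg 0 (leadP η k₁ k₂ k₃ : Op d R) := by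
      have : (leadP η k₁ k₂ k₃ : Op d R) = 1 - (leadD η k₁ k₂ k₃ * leadH η k₁ k₂ k₃ +
          leadH η k₁ k₂ k₃ * leadD η k₁ k₂ k₃) := by rw [c1]; abel
      rw [this]
      have t1 : Sh kdeg (-(-1)) (leadD η k₁ k₂ k₃ : Op d R) := sh_leadD (by simp [wO_theta])
        (by simp [wO_cdag]) (by simp [wO_xi])
      have t2 : Sh kdeg (-1) (leadH η k₁ k₂ k₃ : Op d R) := sh_leadH (by simp [wO_theta])
        (by simp [wO_cdag]) (by simp [wO_xi])
      exact Rel.sub Sh.one (Rel.add (t1.mul t2 (by ring)) (t2.mul t1 (by ring)))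
    have hπ' : π * leadP η k₁ k₂ k₃ = leadP η k₁ k₂ k₃ * π :=
      Rel.diag_mul s0 fun a b hab => by simp [hab]
    have : π * leadP η k₁ k₂ k₃ = 0 := by
      ext ψ : 1
      refine Fock.ext' fun j => ?_
      have hz := (mem_ker_dod_iff_kdeg (φ := (leadP η k₁ k₂ k₃ : Op d R) ψ)).1
        ⟨LinearMap.congr_fun c7 ψ, LinearMap.congr_fun c8 ψ, LinearMap.congr_fun c9 ψ⟩ j
      rw [Module.End.mul_apply, diag_apply]
      split_ifs with hj
      · rw [hz (hj ▸ hi), smul_zero]; rfl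
      · rw [zero_smul]; rfl
    rw [← hπ', this, zero_mul]
  have hX : P * π = 0 := by
    rw [hP, mul_assoc _ (leadP η k₁ k₂ k₃) P, mul_assoc, hπ0, mul_zero]
  have := congrArg (fun A : Op d R => (A φ).1 i) (hπ.trans hX)
  simp only [Module.End.mul_apply] at this
  rw [diag_apply, if_pos rfl, one_smul] at this
  exact this

/-- The homotopy begins with a derivative with respect to `θ`, `c†` or `ξ`. -/
lemma contr_of_indep {φ : Fock d R} (h1 : dod (gTheta d) φ = 0)
    (h2 : dod (gCdag d) φ = 0) (h3 : dod (gXi d) φ = 0) : contr η k₁ k₂ k₃ φ = 0 := by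
  have hH : leadH η k₁ k₂ k₃ φ = 0 := by
    have key : ∀ (g : OddVar d) (J : Op d R), Bos J → dod g φ = 0 → (dod g * J : Op d R) φ = 0 :=
      fun g J hJ hg => by rw [(hJ g).2.eq, Module.End.mul_apply, hg, map_zero]
    rw [leadH, LinearMap.add_apply, LinearMap.add_apply, key _ _ Bos.invL h1,
      Module.End.mul_apply (harmP _ _ _), key _ _ Bos.invS h2,
      Module.End.mul_apply (harmP _ _ _ * _), key _ _ Bos.invT h3, map_zero, map_zero]
    simp
  rw [(contr_relations h12 h13 h23 hη).2.2.2.1, LinearMap.sub_apply, Module.End.mul_apply, hH, map_zero, sub_zero]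

end Contraction

/-! ### The algebra `sl(2)` and the space of traceless states -/

section SlTwo

variable {d : ℕ} {R : Type} [AddCommGroup R] [Module ℂ R]

/-! The instances found on `Op d R` agree with those of the ring `Op d R` only up to unfolding. -/

lemma op_mul_neg (A B : Op d R) : A * -B = -(A * B) := mul_neg A B
lemma op_neg_mul (A B : Op d R) : -A * B = -(A * B) := neg_mul A B
lemma op_neg_mul_neg (A B : Op d R) : -A * -B = A * B := neg_mul_neg A B
lemma op_smul_sub (c : ℂ) (A B : Op d R) : c • (A - B) = c • A - c • B := smul_sub c A B

lemma opSdag_eq : (opSdag : Op d R) = ∑ μ, ma μ * dy μ := rfl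
lemma opSbardag_eq : (opSbardag : Op d R) = ∑ μ, my μ * da μ := rfl
lemma sig_eq : (sig : Op d R) = -∑ μ, mo (gC μ) * dy μ := rfl
lemma sigbar_eq : (sigbar : Op d R) = -∑ μ, mo (gC μ) * da μ := rfl

lemma opSdag_dy (ν : Fin d) : (opSdag : Op d R) * dy ν = dy ν * opSdag := by
  rw [opSdag_eq, Finset.sum_mul, Finset.mul_sum]
  refine Finset.sum_congr rfl fun μ _ => ?_
  rw [mul_assoc, dy_dy, ← mul_assoc, ← dy_ma, mul_assoc]

lemma opSdag_da (ν : Fin d) : (opSdag : Op d R) * da ν = da ν * opSdag - dy ν := by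
  rw [eq_sub_iff_add_eq, opSdag_eq, Finset.sum_mul, Finset.mul_sum]
  have : ∀ μ : Fin d, da ν * (ma μ * dy μ) = ma μ * dy μ * da ν + if ν = μ then (dy μ : Op d R) else 0 :=
    fun μ => by
      rw [← mul_assoc, da_ma, add_mul, mul_assoc, ← dy_da, ← mul_assoc]
      split_ifs <;> simp
  simp only [this, Finset.sum_add_distrib, Finset.sum_ite_eq, Finset.mem_univ, if_true]

lemma opSbardag_da (ν : Fin d) : (opSbardag : Op d R) * da ν = da ν * opSbardag := by
  rw [opSbardag_eq, Finset.sum_mul, Finset.mul_sum]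
  refine Finset.sum_congr rfl fun μ _ => ?_
  rw [mul_assoc, da_da, ← mul_assoc, my_da, mul_assoc]

lemma opSbardag_dy (ν : Fin d) : (opSbardag : Op d R) * dy ν = dy ν * opSbardag - da ν := by
  rw [eq_sub_iff_add_eq, opSbardag_eq, Finset.sum_mul, Finset.mul_sum]
  have : ∀ μ : Fin d, dy ν * (my μ * da μ) = my μ * da μ * dy ν + if ν = μ then (da μ : Op d R) else 0 :=
    fun μ => by
      rw [← mul_assoc, dy_my, add_mul, mul_assoc, dy_da, ← mul_assoc]
      split_ifs <;> simp
  simp only [this, Finset.sum_add_distrib, Finset.sum_ite_eq, Finset.mem_univ, if_true]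

lemma opSdag_my (ν : Fin d) : (opSdag : Op d R) * my ν = my ν * opSdag + ma ν := by
  rw [opSdag_eq, Finset.sum_mul, Finset.mul_sum]
  have : ∀ μ : Fin d, ma μ * dy μ * my ν = my ν * (ma μ * dy μ) + if μ = ν then (ma μ : Op d R) else 0 :=
    fun μ => by
      rw [mul_assoc, dy_my, mul_add, ← mul_assoc, ← my_ma, mul_assoc]
      split_ifs <;> simp
  simp only [this, Finset.sum_add_distrib, Finset.sum_ite_eq', Finset.mem_univ, if_true]

/-- The weight operator `h = a†^μ ∂/∂a†^μ - y^μ ∂/∂y^μ`. -/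
def wt : Op d R := ∑ μ, ma μ * da μ - ∑ μ, my μ * dy μ

/-- `[e, f] = h`. -/
lemma opSdag_opSbardag : (opSdag : Op d R) * opSbardag = opSbardag * opSdag + wt := by
  rw [wt, opSbardag_eq, Finset.mul_sum, Finset.sum_mul, ← Finset.sum_sub_distrib,
    ← Finset.sum_add_distrib]
  refine Finset.sum_congr rfl fun μ _ => ?_
  rw [← mul_assoc, opSdag_my, add_mul, mul_assoc, opSdag_da, mul_sub, mul_assoc]
  abel

/-- The weight of a monomial: its `a†`-degree minus its `y`-degree. -/
def wdeg : Mono d → ℤ := lw (-1) 1 0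

lemma wdeg_eq (i : Mono d) : wdeg i = i.adeg - i.ydeg := by
  simp [wdeg, lw, Mono.adeg, Mono.ydeg]
  ring

lemma wt_eq : (wt : Op d R) = diag (fun i => (wdeg i : ℂ)) := by
  ext φ : 1
  refine Fock.ext' fun i => ?_
  have h1 : ∀ μ, (((ma μ * da μ : Op d R)) φ).1 i = (i.a μ : ℂ) • φ.1 i := fun μ => by
    rw [Module.End.mul_apply, da_eq, ma_eq, aMode_apply, aMode_apply]
    by_cases h : i.a μ = 0
    · simp [h]
    · have e : i.a μ - 1 + 1 = i.a μ := by omega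
      simp [h, e, Nat.cast_pred (Nat.pos_of_ne_zero h)]
  have h2 : ∀ μ, (((my μ * dy μ : Op d R)) φ).1 i = (i.y μ : ℂ) • φ.1 i := fun μ => by
    rw [Module.End.mul_apply, dy_eq, my_eq, yMode_apply, yMode_apply]
    by_cases h : i.y μ = 0
    · simp [h]
    · have e : i.y μ - 1 + 1 = i.y μ := by omega
      simp [h, e, Nat.cast_pred (Nat.pos_of_ne_zero h)]
  rw [wt, LinearMap.sub_apply, coe_sub', LinearMap.sum_apply, LinearMap.sum_apply,
    Submodule.coe_sum, Submodule.coe_sum, Finset.sum_apply, Finset.sum_apply,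
    Finset.sum_congr rfl fun μ _ => h1 μ, Finset.sum_congr rfl fun μ _ => h2 μ, ← Finset.sum_smul,
    ← Finset.sum_smul, ← sub_smul, diag_apply, wdeg_eq]
  simp [Mono.adeg, Mono.ydeg]

section
variable {a b : ℤ} (γ : OddVar d → ℤ)
lemma sh_opSdag : Sh (lw (fun _ => a) (fun _ => b) γ) (b - a) (opSdag : Op d R) :=
  Rel.sum _ fun μ _ => (sh_ma _ _ γ μ).mul (sh_dy _ _ γ μ) (by ring)
lemma sh_opSbardag : Sh (lw (fun _ => a) (fun _ => b) γ) (a - b) (opSbardag : Op d R) :=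
  Rel.sum _ fun μ _ => (sh_my _ _ γ μ).mul (sh_da _ _ γ μ) (by ring)
lemma sh_sig (h : ∀ μ, γ (gC μ) = 0) : Sh (lw (fun _ => a) (fun _ => b) γ) (-a) (sig : Op d R) :=
  Rel.neg (Rel.sum _ fun μ _ => (sh_mo _ _ γ _).mul (sh_dy _ _ γ μ) (by rw [h]; ring))
lemma sh_sigbar (h : ∀ μ, γ (gC μ) = 0) :
    Sh (lw (fun _ => a) (fun _ => b) γ) (-b) (sigbar : Op d R) :=
  Rel.neg (Rel.sum _ fun μ _ => (sh_mo _ _ γ _).mul (sh_da _ _ γ μ) (by rw [h]; ring))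
end

variable (η : Fin d → ℝ)

lemma opSdag_opBox : (opSdag : Op d R) * opBox η = opBox η * opSdag := by
  rw [opBox_eq, Finset.mul_sum, Finset.sum_mul]
  refine Finset.sum_congr rfl fun μ _ => ?_
  rw [mul_smul_comm, smul_mul_assoc, ← mul_assoc, opSdag_dy, mul_assoc, opSdag_dy, mul_assoc]

lemma opSdag_opS : (opSdag : Op d R) * opS η = opS η * opSdag - opBox η := by
  rw [opBox_eq, opS_eq, Finset.mul_sum, Finset.sum_mul, ← Finset.sum_sub_distrib]
  refine Finset.sum_congr rfl fun μ _ => ?_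
  rw [mul_smul_comm, smul_mul_assoc, ← op_smul_sub, ← mul_assoc, opSdag_da, sub_mul, mul_assoc,
    opSdag_dy, mul_assoc]

lemma opSdag_opT : (opSdag : Op d R) * opT η = opT η * opSdag - opS η - opS η := by
  rw [opT_eq, opS_eq, Finset.mul_sum, Finset.sum_mul, ← Finset.sum_sub_distrib,
    ← Finset.sum_sub_distrib]
  refine Finset.sum_congr rfl fun μ _ => ?_
  rw [mul_smul_comm, smul_mul_assoc, ← op_smul_sub, ← op_smul_sub, ← mul_assoc, opSdag_da, sub_mul,
    mul_assoc, opSdag_da, mul_sub, mul_assoc, dy_da]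

lemma opSbardag_opBox :
    (opSbardag : Op d R) * opBox η = opBox η * opSbardag - opS η - opS η := by
  rw [opBox_eq, opS_eq, Finset.mul_sum, Finset.sum_mul, ← Finset.sum_sub_distrib,
    ← Finset.sum_sub_distrib]
  refine Finset.sum_congr rfl fun μ _ => ?_
  rw [mul_smul_comm, smul_mul_assoc, ← op_smul_sub, ← op_smul_sub, ← mul_assoc, opSbardag_dy, sub_mul,
    mul_assoc, opSbardag_dy, mul_sub, mul_assoc, dy_da]

lemma opSbardag_opS : (opSbardag : Op d R) * opS η = opS η * opSbardag - opT η := by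
  rw [opT_eq, opS_eq, Finset.mul_sum, Finset.sum_mul, ← Finset.sum_sub_distrib]
  refine Finset.sum_congr rfl fun μ _ => ?_
  rw [mul_smul_comm, smul_mul_assoc, ← op_smul_sub, ← mul_assoc, opSbardag_da, mul_assoc,
    opSbardag_dy, mul_sub, mul_assoc]

lemma opSbardag_opT : (opSbardag : Op d R) * opT η = opT η * opSbardag := by
  rw [opT_eq, Finset.mul_sum, Finset.sum_mul]
  refine Finset.sum_congr rfl fun μ _ => ?_
  rw [mul_smul_comm, smul_mul_assoc, ← mul_assoc, opSbardag_da, mul_assoc, opSbardag_da, mul_assoc]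

/-! The doublet `σ`, `σ̄`. -/

lemma opSdag_sig : (opSdag : Op d R) * sig = sig * opSdag := by
  rw [sig_eq, op_mul_neg, op_neg_mul, Finset.mul_sum, Finset.sum_mul]
  congr 1
  refine Finset.sum_congr rfl fun μ _ => ?_
  rw [← mul_assoc, ← (Bos.opSdag _).1.eq, mul_assoc, opSdag_dy, mul_assoc]

lemma opSdag_sigbar : (opSdag : Op d R) * sigbar = sigbar * opSdag - sig := by
  rw [sig_eq, sigbar_eq, op_mul_neg, op_neg_mul, Finset.mul_sum, Finset.sum_mul, sub_neg_eq_add,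
    ← neg_inj, neg_neg, neg_add, neg_neg, ← sub_eq_add_neg, ← Finset.sum_sub_distrib]
  refine Finset.sum_congr rfl fun μ _ => ?_
  rw [← mul_assoc, ← (Bos.opSdag _).1.eq, mul_assoc, opSdag_da, mul_sub, mul_assoc]

lemma opSbardag_sigbar : (opSbardag : Op d R) * sigbar = sigbar * opSbardag := by
  rw [sigbar_eq, op_mul_neg, op_neg_mul, Finset.mul_sum, Finset.sum_mul]
  congr 1
  refine Finset.sum_congr rfl fun μ _ => ?_
  rw [← mul_assoc, ← (Bos.opSbardag _).1.eq, mul_assoc, opSbardag_da, mul_assoc]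

lemma opSbardag_sig : (opSbardag : Op d R) * sig = sig * opSbardag - sigbar := by
  rw [sig_eq, sigbar_eq, op_mul_neg, op_neg_mul, Finset.mul_sum, Finset.sum_mul, sub_neg_eq_add,
    ← neg_inj, neg_neg, neg_add, neg_neg, ← sub_eq_add_neg, ← Finset.sum_sub_distrib]
  refine Finset.sum_congr rfl fun μ _ => ?_
  rw [← mul_assoc, ← (Bos.opSbardag _).1.eq, mul_assoc, opSbardag_dy, mul_sub, mul_assoc]

/-- `σ̄ σ̄ = 0`. -/
lemma sigbar_sq : (sigbar : Op d R) * sigbar = 0 := by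
  have h : (sigbar : Op d R) * sigbar = -(sigbar * sigbar) := by
    rw [sigbar_eq, op_neg_mul_neg, Finset.sum_mul]
    simp only [Finset.mul_sum]
    conv_rhs => rw [Finset.sum_comm]
    simp only [← Finset.sum_neg_distrib]
    refine Finset.sum_congr rfl fun μ _ => Finset.sum_congr rfl fun ν _ => ?_
    exact KoszulFactor.anti_mul (mo_mo _ _) (mo_da _ _) (mo_da _ _) (da_da _ _)
  have h2 : (2 : ℂ) • ((sigbar : Op d R) * sigbar) = 0 := by
    rw [two_smul]; nth_rewrite 1 [h]; exact neg_add_cancel _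
  exact (smul_eq_zero.1 h2).resolve_left two_ne_zero

/-! ### Traceless states with arbitrary coefficients -/

variable (R)

/-- The space `hatE` with coefficients in `R`. -/
def hatS : Submodule ℂ (Fock d R) :=
  LinearMap.ker (dod (gTheta d)) ⊓ LinearMap.ker (dod (gCdag d)) ⊓ LinearMap.ker (dod (gXi d)) ⊓
    LinearMap.ker (opBox η) ⊓ LinearMap.ker (opS η) ⊓ LinearMap.ker (opT η)

variable {R η}

lemma mem_hatS {φ : Fock d R} : φ ∈ hatS R η ↔ (dod (gTheta d) φ = 0 ∧ dod (gCdag d) φ = 0 ∧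
    dod (gXi d) φ = 0) ∧ opBox η φ = 0 ∧ opS η φ = 0 ∧ opT η φ = 0 := by
  simp only [hatS, Submodule.mem_inf, LinearMap.mem_ker]
  tauto

lemma apply_comm {A B : Op d R} (h : A * B = B * A) (φ : Fock d R) : A (B φ) = B (A φ) :=
  LinearMap.congr_fun h φ

lemma apply_anti {A B : Op d R} (h : A * B = -(B * A)) (φ : Fock d R) : A (B φ) = -B (A φ) :=
  LinearMap.congr_fun h φ

/-- An operator preserves `hatS` if it commutes with the trace constraints and commutes or
anticommutes with the derivatives with respect to `θ`, `c†`, `ξ`. -/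
lemma hatS_of_comm {A : Op d R} {φ : Fock d R} (hφ : φ ∈ hatS R η)
    (hg : ∀ g, (g = gTheta d ∨ g = gCdag d ∨ g = gXi d) →
      (dod g * A = A * dod g ∨ dod g * A = -(A * dod g)))
    (h1 : opBox η * A = A * opBox η) (h2 : opS η * A = A * opS η) (h3 : opT η * A = A * opT η) :
    A φ ∈ hatS R η := by
  obtain ⟨⟨a, b, c⟩, e, f, k⟩ := mem_hatS.1 hφ
  have key : ∀ g, (g = gTheta d ∨ g = gCdag d ∨ g = gXi d) → dod g φ = 0 → dod g (A φ) = 0 :=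
    fun g hh h0 => by
      rcases hg g hh with h | h
      · rw [apply_comm h, h0, map_zero]
      · rw [apply_anti h, h0, map_zero, neg_zero]
  refine mem_hatS.2 ⟨⟨key _ (Or.inl rfl) a, key _ (Or.inr (Or.inl rfl)) b,
    key _ (Or.inr (Or.inr rfl)) c⟩, ?_, ?_, ?_⟩
  · rw [apply_comm h1, e, map_zero]
  · rw [apply_comm h2, f, map_zero]
  · rw [apply_comm h3, k, map_zero]

lemma hatS_mo_of_ne {g₀ : OddVar d} (h : gTheta d ≠ g₀ ∧ gCdag d ≠ g₀ ∧ gXi d ≠ g₀) {φ : Fock d R}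
    (hφ : φ ∈ hatS R η) : mo g₀ φ ∈ hatS R η := by
  refine hatS_of_comm hφ (fun g hg => Or.inr ?_) ?_ ?_ ?_
  · refine dod_mo _ _ ?_
    rcases hg with rfl | rfl | rfl
    exacts [h.1, h.2.1, h.2.2]
  · exact (Bos.opBox η _).1.eq.symm
  · exact (Bos.opS η _).1.eq.symm
  · exact (Bos.opT η _).1.eq.symm

lemma hatS_mo_C (μ : Fin d) {φ : Fock d R} (hφ : φ ∈ hatS R η) : mo (gC μ) φ ∈ hatS R η :=
  hatS_mo_of_ne ⟨(gneC μ).1, (gneC μ).2.1, (gneC μ).2.2.1⟩ hφ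

lemma hatS_mo_bdag {φ : Fock d R} (hφ : φ ∈ hatS R η) : mo (gBdag d) φ ∈ hatS R η :=
  hatS_mo_of_ne ⟨gne.2.2.2.1, gne.2.2.2.2.1, gne.2.2.2.2.2⟩ hφ

lemma hatS_dod_bdag {φ : Fock d R} (hφ : φ ∈ hatS R η) : dod (gBdag d) φ ∈ hatS R η := by
  obtain ⟨-, -, -, h1, h2, h3⟩ := gne (d := d)
  refine hatS_of_comm hφ (fun g hg => Or.inr ?_) ?_ ?_ ?_
  · refine dod_dod _ _ ?_
    rcases hg with rfl | rfl | rfl <;> assumption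
  · exact (Bos.opBox η _).2.eq.symm
  · exact (Bos.opS η _).2.eq.symm
  · exact (Bos.opT η _).2.eq.symm

lemma hatS_dy (μ : Fin d) {φ : Fock d R} (hφ : φ ∈ hatS R η) : dy μ φ ∈ hatS R η := by
  have h1 : ∀ ν, Commute (dy ν : Op d R) (dy μ) := fun ν => dy_dy ν μ
  have h2 : ∀ ν, Commute (da ν : Op d R) (dy μ) := fun ν => (dy_da μ ν).symm
  exact hatS_of_comm hφ (fun g _ => Or.inl (dod_dy μ g))
    (Commute.sum_left _ _ _ fun ν _ => ((h1 ν).mul_left (h1 ν)).smul_left _)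
    (Commute.sum_left _ _ _ fun ν _ => ((h2 ν).mul_left (h1 ν)).smul_left _)
    (Commute.sum_left _ _ _ fun ν _ => ((h2 ν).mul_left (h2 ν)).smul_left _)

lemma hatS_da (μ : Fin d) {φ : Fock d R} (hφ : φ ∈ hatS R η) : da μ φ ∈ hatS R η := by
  have h1 : ∀ ν, Commute (dy ν : Op d R) (da μ) := fun ν => dy_da ν μ
  have h2 : ∀ ν, Commute (da ν : Op d R) (da μ) := fun ν => da_da ν μ
  exact hatS_of_comm hφ (fun g _ => Or.inl (dod_da μ g))
    (Commute.sum_left _ _ _ fun ν _ => ((h1 ν).mul_left (h1 ν)).smul_left _)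
    (Commute.sum_left _ _ _ fun ν _ => ((h2 ν).mul_left (h1 ν)).smul_left _)
    (Commute.sum_left _ _ _ fun ν _ => ((h2 ν).mul_left (h2 ν)).smul_left _)

lemma hatS_opSdag {φ : Fock d R} (hφ : φ ∈ hatS R η) : opSdag φ ∈ hatS R η := by
  obtain ⟨⟨a, b, c⟩, e, f, k⟩ := mem_hatS.1 hφ
  have e1 := LinearMap.congr_fun (opSdag_opBox (R := R) η) φ
  have e2 := LinearMap.congr_fun (opSdag_opS (R := R) η) φ
  have e3 := LinearMap.congr_fun (opSdag_opT (R := R) η) φ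
  simp only [Module.End.mul_apply, LinearMap.sub_apply, e, f, k, map_zero, sub_zero] at e1 e2 e3
  refine mem_hatS.2 ⟨⟨?_, ?_, ?_⟩, e1.symm, e2.symm, e3.symm⟩
  · rw [apply_comm (Bos.opSdag _).2, a, map_zero]
  · rw [apply_comm (Bos.opSdag _).2, b, map_zero]
  · rw [apply_comm (Bos.opSdag _).2, c, map_zero]

lemma hatS_opSbardag {φ : Fock d R} (hφ : φ ∈ hatS R η) : opSbardag φ ∈ hatS R η := by
  obtain ⟨⟨a, b, c⟩, e, f, k⟩ := mem_hatS.1 hφ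
  have e1 := LinearMap.congr_fun (opSbardag_opBox (R := R) η) φ
  have e2 := LinearMap.congr_fun (opSbardag_opS (R := R) η) φ
  have e3 := LinearMap.congr_fun (opSbardag_opT (R := R) η) φ
  simp only [Module.End.mul_apply, LinearMap.sub_apply, e, f, k, map_zero, sub_zero] at e1 e2 e3
  refine mem_hatS.2 ⟨⟨?_, ?_, ?_⟩, e1.symm, e2.symm, e3.symm⟩
  · rw [apply_comm (Bos.opSbardag _).2, a, map_zero]
  · rw [apply_comm (Bos.opSbardag _).2, b, map_zero]
  · rw [apply_comm (Bos.opSbardag _).2, c, map_zero]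

lemma hatS_sig {φ : Fock d R} (hφ : φ ∈ hatS R η) : sig φ ∈ hatS R η := by
  rw [sig_eq, LinearMap.neg_apply, LinearMap.sum_apply]
  exact Submodule.neg_mem _ (Submodule.sum_mem _ fun μ _ => hatS_mo_C μ (hatS_dy μ hφ))

lemma hatS_sigbar {φ : Fock d R} (hφ : φ ∈ hatS R η) : sigbar φ ∈ hatS R η := by
  rw [sigbar_eq, LinearMap.neg_apply, LinearMap.sum_apply]
  exact Submodule.neg_mem _ (Submodule.sum_mem _ fun μ _ => hatS_mo_C μ (hatS_da μ hφ))

lemma hatS_SdagDb {φ : Fock d R} (hφ : φ ∈ hatS R η) : SdagDb φ ∈ hatS R η :=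
  hatS_opSdag (hatS_dod_bdag hφ)

lemma hatS_coeffMap {R' : Type} [AddCommGroup R'] [Module ℂ R'] (l : R →ₗ[ℂ] R') {φ : Fock d R}
    (hφ : φ ∈ hatS R η) : coeffMap l φ ∈ hatS R' η := by
  obtain ⟨⟨a, b, c⟩, e, f, k⟩ := mem_hatS.1 hφ
  refine mem_hatS.2 ⟨⟨?_, ?_, ?_⟩, ?_, ?_, ?_⟩
  · rw [← Intertw.dod l _ φ, a, map_zero]
  · rw [← Intertw.dod l _ φ, b, map_zero]
  · rw [← Intertw.dod l _ φ, c, map_zero]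
  · rw [← Intertw.opBox l η φ, e, map_zero]
  · rw [← Intertw.opS l η φ, f, map_zero]
  · rw [← Intertw.opT l η φ, k, map_zero]

/-- A diagonal operator preserves `hatS` if its eigenvalues are a function of the degrees in `y` and
in `a†`. -/
lemma hatS_diag (c : ℤ → ℤ → ℂ) {φ : Fock d R} (hφ : φ ∈ hatS R η) :
    diag (fun i => c (lw (fun _ => 1) 0 0 i) (lw 0 (fun _ => 1) 0 i)) φ ∈ hatS R η := by
  obtain ⟨⟨a, b, e⟩, f, k, l⟩ := mem_hatS.1 hφ
  have key : ∀ (A : Op d R) (p q : ℤ), Sh (lw (fun _ => 1) 0 0) p A → Sh (lw 0 (fun _ => 1) 0) q A →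
      A φ = 0 → A (diag (fun i => c (lw (fun _ => 1) 0 0 i) (lw 0 (fun _ => 1) 0 i)) φ) = 0 := by
    intro A p q hp hq h0
    have hr : Rel (fun i j => lw (fun _ => 1) 0 0 i = lw (fun _ => 1) 0 0 j + p ∧
        lw 0 (fun _ => 1) 0 i = lw 0 (fun _ => 1) 0 j + q) A := fun ψ i hψ => by
      -- Cut `ψ` down to the degrees in `a†` that contribute.
      have h1 := hp (diag (fun j => if lw 0 (fun _ => 1) 0 i = lw 0 (fun _ => 1) 0 j + q then 1
        else 0) ψ) i fun j hj => by
          rw [diag_apply]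
          split_ifs with hh
          · rw [hψ j ⟨hj, hh⟩, smul_zero]
          · rw [zero_smul]
      have h2 := hq (ψ - diag (fun j => if lw 0 (fun _ => 1) 0 i = lw 0 (fun _ => 1) 0 j + q then 1
        else 0) ψ) i fun j hj => by
          rw [coe_sub', diag_apply, if_pos hj, one_smul, sub_self]
      rw [map_sub, coe_sub', h1, sub_zero] at h2
      exact h2
    have := Rel.diag_mul hr (c := fun i => c (lw (fun _ => 1) 0 0 i - p) (lw 0 (fun _ => 1) 0 i - q))
      (c' := fun i => c (lw (fun _ => 1) 0 0 i) (lw 0 (fun _ => 1) 0 i))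
      (fun i j hij => by rw [hij.1, hij.2, add_sub_cancel_right, add_sub_cancel_right])
    have := LinearMap.congr_fun this φ
    rw [Module.End.mul_apply, Module.End.mul_apply, h0, map_zero] at this
    exact this.symm
  have hB : ∀ α β : ℤ, Sh (lw (fun _ => α) (fun _ => β) 0) (-(2 * α)) (opBox η : Op d R) :=
    fun α β => Rel.sum _ fun μ _ => Rel.smul _ ((sh_dy _ _ _ μ).mul (sh_dy _ _ _ μ) (by ring))
  have hS : ∀ α β : ℤ, Sh (lw (fun _ => α) (fun _ => β) 0) (-(β + α)) (opS η : Op d R) :=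
    fun α β => Rel.sum _ fun μ _ => Rel.smul _ ((sh_da _ _ _ μ).mul (sh_dy _ _ _ μ) (by ring))
  have hT : ∀ α β : ℤ, Sh (lw (fun _ => α) (fun _ => β) 0) (-(2 * β)) (opT η : Op d R) :=
    fun α β => Rel.sum _ fun μ _ => Rel.smul _ ((sh_da _ _ _ μ).mul (sh_da _ _ _ μ) (by ring))
  exact mem_hatS.2 ⟨⟨key _ _ _ (sh_dod _ _ _ _) (sh_dod _ _ _ _) a,
    key _ _ _ (sh_dod _ _ _ _) (sh_dod _ _ _ _) b, key _ _ _ (sh_dod _ _ _ _) (sh_dod _ _ _ _) e⟩,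
    key _ _ _ (hB 1 0) (hB 0 1) f, key _ _ _ (hS 1 0) (hS 0 1) k, key _ _ _ (hT 1 0) (hT 0 1) l⟩

end SlTwo

/-! ### Direct sums of three subspaces and reductions -/

section EFG

variable {V : Type} [AddCommGroup V] [Module ℂ V] {E F G : Submodule ℂ V}

/-- A direct sum decomposition into three subspaces from existence and uniqueness of components. -/
lemma IsEFG.of_unique (hex : ∀ v, ∃ e ∈ E, ∃ f ∈ F, ∃ g ∈ G, v = e + f + g)
    (hun : ∀ e ∈ E, ∀ f ∈ F, ∀ g ∈ G, e + f + g = 0 → e = 0 ∧ f = 0 ∧ g = 0) : IsEFG E F G := by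
  refine ⟨⟨?_, ?_⟩, ⟨?_, ?_⟩, ⟨?_, ?_⟩⟩
  · rw [Submodule.disjoint_def]
    intro x hx hx'
    obtain ⟨f, hf, g, hg, rfl⟩ := Submodule.mem_sup.1 hx'
    obtain ⟨-, h2, h3⟩ := hun _ hx _ (F.neg_mem hf) _ (G.neg_mem hg) (by abel)
    rw [neg_eq_zero.1 h2, neg_eq_zero.1 h3, add_zero]
  · rw [codisjoint_iff, eq_top_iff]
    intro v _
    obtain ⟨e, he, f, hf, g, hg, rfl⟩ := hex v
    rw [add_assoc]
    exact Submodule.add_mem_sup he (Submodule.add_mem_sup hf hg)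
  · rw [Submodule.disjoint_def]
    intro x hx hx'
    obtain ⟨e, he, g, hg, rfl⟩ := Submodule.mem_sup.1 hx'
    obtain ⟨h2, -, h3⟩ := hun _ (E.neg_mem he) _ hx _ (G.neg_mem hg) (by abel)
    rw [neg_eq_zero.1 h2, neg_eq_zero.1 h3, add_zero]
  · rw [codisjoint_iff, eq_top_iff]
    intro v _
    obtain ⟨e, he, f, hf, g, hg, rfl⟩ := hex v
    rw [add_comm e, add_assoc]
    exact Submodule.add_mem_sup hf (Submodule.add_mem_sup he hg)
  · rw [Submodule.disjoint_def]
    intro x hx hx'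
    obtain ⟨e, he, f, hf, rfl⟩ := Submodule.mem_sup.1 hx'
    obtain ⟨h2, h3, -⟩ := hun _ (E.neg_mem he) _ (F.neg_mem hf) _ hx (by abel)
    rw [neg_eq_zero.1 h2, neg_eq_zero.1 h3, add_zero]
  · rw [codisjoint_iff, eq_top_iff]
    intro v _
    obtain ⟨e, he, f, hf, g, hg, rfl⟩ := hex v
    rw [add_comm]
    exact Submodule.add_mem_sup hg (Submodule.add_mem_sup he hf)

lemma IsEFG.proj_E (h : IsEFG E F G) {e f g : V} (he : e ∈ E) (hf : f ∈ F) (hg : g ∈ G) :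
    E.projectionOnto (F ⊔ G) h.complE (e + f + g) = ⟨e, he⟩ := by
  rw [add_assoc, map_add, Submodule.projectionOnto_apply_of_mem_left _ he,
    Submodule.projectionOnto_apply_of_mem_right h.complE (Submodule.add_mem_sup hf hg), add_zero]

lemma IsEFG.proj_G (h : IsEFG E F G) {e f g : V} (he : e ∈ E) (hf : f ∈ F) (hg : g ∈ G) :
    G.projectionOnto (E ⊔ F) h.complG (e + f + g) = ⟨g, hg⟩ := by
  rw [map_add, Submodule.projectionOnto_apply_of_mem_left _ hg,
    Submodule.projectionOnto_apply_of_mem_right h.complG (Submodule.add_mem_sup he hf), zero_add]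

/-- If `Ω φ` and `Ω ζ`, `ζ ∈ F`, have the same component in `G`, then the reduced operator maps `φ`
to the difference of their components in `E`. -/
lemma IsEFG.reduced_apply (h : IsEFG E F G) {Om : V →ₗ[ℂ] V}
    (hb : Function.Bijective (h.blockGF Om)) (φ : E) {ζ : V} (hζ : ζ ∈ F) {e e' f f' g : V}
    (he : e ∈ E) (he' : e' ∈ E) (hf : f ∈ F) (hf' : f' ∈ F) (hg : g ∈ G)
    (h1 : Om φ = e + f + g) (h2 : Om ζ = e' + f' + g) : (h.reduced Om hb φ : V) = e - e' := by
  have hEE : h.blockEE Om φ = ⟨e, he⟩ := by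
    show E.projectionOnto (F ⊔ G) h.complE (Om φ) = _
    rw [h1, h.proj_E he hf hg]
  have hGE : h.blockGE Om φ = ⟨g, hg⟩ := by
    show G.projectionOnto (E ⊔ F) h.complG (Om φ) = _
    rw [h1, h.proj_G he hf hg]
  have hGF : h.blockGF Om ⟨ζ, hζ⟩ = ⟨g, hg⟩ := by
    show G.projectionOnto (E ⊔ F) h.complG (Om ζ) = _
    rw [h2, h.proj_G he' hf' hg]
  have hEF : h.blockEF Om ⟨ζ, hζ⟩ = ⟨e', he'⟩ := by
    show E.projectionOnto (F ⊔ G) h.complE (Om ζ) = _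
    rw [h2, h.proj_E he' hf' hg]
  have hinv : (LinearEquiv.ofBijective (h.blockGF Om) hb).symm (h.blockGE Om φ) = ⟨ζ, hζ⟩ := by
    rw [LinearEquiv.symm_apply_eq, LinearEquiv.ofBijective_apply, hGF, hGE]
  have : h.reduced Om hb φ = ⟨e, he⟩ - ⟨e', he'⟩ := by
    rw [IsEFG.reduced, LinearMap.sub_apply, LinearMap.comp_apply, LinearMap.comp_apply,
      LinearEquiv.coe_coe, hinv, hEE, hEF]
  rw [this]
  rfl

end EFG

/-! ### Sections -/

section Sections

variable {d : ℕ}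

lemma mem_secs {W : Submodule ℂ (State d)} {φ : Sec d} :
    φ ∈ secs W ↔ ∀ x, (evalAt x φ : State d) ∈ W := by
  simp [secs, Submodule.mem_iInf]

lemma sec_eq_zero {φ : Sec d} (h : ∀ x, (evalAt x φ : State d) = 0) : φ = 0 := by
  refine Fock.ext' fun i => ?_
  apply Subtype.ext
  funext x
  exact congrArg (fun ψ : State d => ψ.1 i) (h x)

/-- A natural operator annihilates a section iff it annihilates its values. -/
lemma sec_ker {A : Op d ℂ} {A' : Op d (Fld d)} (h : ∀ x, Intertw (evFld x) A' A) {φ : Sec d} :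
    A' φ = 0 ↔ ∀ x, A (evalAt x φ) = 0 := by
  constructor
  · intro h0 x
    rw [evalAt, ← h x, h0, map_zero]
  · intro h0
    refine sec_eq_zero fun x => ?_
    rw [evalAt, h x]
    exact h0 x

lemma secs_hatE (η : Fin d → ℝ) : secs (hatE η) = hatS (Fld d) η := by
  ext φ
  rw [mem_secs, mem_hatS, sec_ker (fun x => Intertw.dod (evFld x) _),
    sec_ker (fun x => Intertw.dod (evFld x) _), sec_ker (fun x => Intertw.dod (evFld x) _),
    sec_ker (fun x => Intertw.opBox (evFld x) η), sec_ker (fun x => Intertw.opS (evFld x) η),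
    sec_ker (fun x => Intertw.opT (evFld x) η)]
  have : ∀ x, evalAt x φ ∈ hatE η ↔ _ := fun x => mem_hatS (R := ℂ) (φ := evalAt x φ)
  simp only [this]
  constructor
  · exact fun h => ⟨⟨fun x => (h x).1.1, fun x => (h x).1.2.1, fun x => (h x).1.2.2⟩,
      fun x => (h x).2.1, fun x => (h x).2.2.1, fun x => (h x).2.2.2⟩
  · exact fun h x => ⟨⟨h.1.1 x, h.1.2.1 x, h.1.2.2 x⟩, h.2.1 x, h.2.2.1 x, h.2.2.2 x⟩

end Sections

/-! ### The parent operator -/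

section Parent

variable {d : ℕ} (η : Fin d → ℝ)

/-- The part of degree `0` of the parent operator that contains `∂/∂θ` or `∂/∂c†`. -/
def ghostPart {R : Type} [AddCommGroup R] [Module ℂ R] : Op d R :=
  -(Complex.I • (ghP * mo (gCdag d) * ghc)) + mo (gXi d) * ((2 : ℂ) • (ghc * ghb))

lemma dTot_eq : (dTot : Op d (Fld d)) = ∑ μ : Fin d, mo (gC μ) * dx μ := rfl

lemma omegaT_eq : (OmegaT η : Op d (Fld d)) =
    OmegaMinus η + (-Complex.I • ((dTot : Op d (Fld d)) + sig + SdagDb) + ghostPart) := by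
  have e1 : (∑ μ : Fin d, mo (gC μ) ∘ₗ (-Complex.I • dx μ - py μ) : Op d (Fld d)) =
      -Complex.I • ((dTot : Op d (Fld d)) + sig) := by
    ext φ : 1
    have key : ∀ μ : Fin d, mo (gC μ) (-Complex.I • dx μ φ - -Complex.I • dy μ φ) =
        -Complex.I • (mo (gC μ) (dx μ φ) + -(mo (gC μ) (dy μ φ))) := fun μ => by
      rw [← smul_sub, map_smul, map_sub, ← sub_eq_add_neg]
    simp only [LinearMap.sum_apply, LinearMap.comp_apply, dTot, sig, LinearMap.add_apply,
      LinearMap.neg_apply, LinearMap.smul_apply]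
    rw [← Finset.sum_neg_distrib, ← Finset.sum_add_distrib, Finset.smul_sum]
    exact Finset.sum_congr rfl fun μ _ => key μ
  have e2 : (conSdag ∘ₗ ghc : Op d (Fld d)) = -Complex.I • SdagDb := by
    ext φ : 1
    simp only [conSdag, ghc, SdagDb, opSdag, LinearMap.sum_apply, LinearMap.comp_apply,
      LinearMap.smul_apply, py, Finset.smul_sum]
    exact Finset.sum_congr rfl fun μ _ => by rw [apply_comm (dy_ma μ μ)]
  have e3 : (mo (gXi d) ∘ₗ (conT η + (2 : ℂ) • (ghc ∘ₗ ghb)) : Op d (Fld d)) =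
      mo (gXi d) * conT η + mo (gXi d) * ((2 : ℂ) • (ghc * ghb)) := mul_add _ _ _
  rw [OmegaT, OmegaY, e1, e2, e3, ghostPart, OmegaMinus]
  rw [show (mo (gXi d) ∘ₗ conT η : Op d (Fld d)) = mo (gXi d) * conT η from rfl,
    show (ghP ∘ₗ mo (gCdag d) ∘ₗ ghc : Op d (Fld d)) = ghP * mo (gCdag d) * ghc from rfl,
    show (-Complex.I • ((dTot : Op d (Fld d)) + sig + SdagDb) : Op d (Fld d)) =
      -Complex.I • ((dTot : Op d (Fld d)) + sig) + -Complex.I • SdagDb from smul_add _ _ _]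
  abel

lemma ghostPart_apply {R : Type} [AddCommGroup R] [Module ℂ R] {φ : Fock d R}
    (h1 : dod (gTheta d) φ = 0) (h2 : dod (gCdag d) φ = 0) : ghostPart φ = 0 := by
  obtain ⟨n1, -, -, n2, n3, -⟩ := gne (d := d)
  have e1 : (ghP * mo (gCdag d) * ghc : Op d R) φ = 0 := by
    simp only [Module.End.mul_apply, ghP, ghc, LinearMap.smul_apply]
    rw [apply_anti (dod_mo _ _ n1), apply_anti (dod_dod _ _ n2), h1]
    simp
  have e2 : (ghc * ghb : Op d R) φ = 0 := by
    simp only [Module.End.mul_apply, ghb, ghc, LinearMap.neg_apply, h2]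
    simp
  rw [ghostPart, LinearMap.add_apply, LinearMap.neg_apply, LinearMap.smul_apply, e1,
    Module.End.mul_apply, LinearMap.smul_apply, e2]
  simp

lemma Intertw.ghostPart {R R' : Type} [AddCommGroup R] [Module ℂ R] [AddCommGroup R'] [Module ℂ R']
    (l : R →ₗ[ℂ] R') : Intertw l (ghostPart : Op d R) ghostPart :=
  .add (.neg (.smul _ (.mul (.mul (.smul _ (.dod l _)) (.mo l _)) (.dod l _))))
    (.mul (.mo l _) (.smul _ (.mul (.dod l _) (.neg (.dod l _)))))

lemma sh_coeffMap {R : Type} [AddCommGroup R] [Module ℂ R] (w : Mono d → ℤ) (l : R →ₗ[ℂ] R) :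
    Sh w 0 (coeffMap l : Op d R) := fun φ i hφ => by
  rw [coeffMap_apply, hφ i (by omega), map_zero]

lemma kdeg_rest : Sh kdeg 0 (-Complex.I • ((dTot : Op d (Fld d)) + sig + SdagDb) + ghostPart : Op d (Fld d)) := by
  refine Rel.add (Rel.smul _ (Rel.add (Rel.add ?_ ?_) ?_)) (Rel.add (Rel.neg (Rel.smul _ ?_)) ?_)
  · exact Rel.sum _ fun μ _ => Sh.mul (sh_mo _ _ _ _) (sh_coeffMap _ _) (by simp [wO_C])
  · exact sh_sig (a := 0) (b := 0) _ (wO_C _ _ _)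
  · exact Sh.mul (sh_opSdag (a := 0) (b := 0) _) (sh_dod _ _ _ _) (by simp [wO_bdag])
  · exact Sh.mul (Sh.mul (Rel.smul _ (sh_dod _ _ _ _)) (sh_mo _ _ _ _) rfl) (sh_dod _ _ _ _)
      (by simp [wO_theta, wO_cdag, wO_bdag])
  · exact Sh.mul (sh_mo _ _ _ _) (Rel.smul _ (Sh.mul (sh_dod _ _ _ _)
      (Rel.neg (sh_dod _ _ _ _)) rfl)) (by simp [wO_xi, wO_cdag, wO_bdag])

lemma hatS_dTot {φ : Sec d} (hφ : φ ∈ hatS (Fld d) η) : dTot φ ∈ hatS (Fld d) η := by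
  rw [dTot_eq, LinearMap.sum_apply]
  exact Submodule.sum_mem _ fun μ _ => hatS_mo_C μ (hatS_coeffMap _ hφ)

end Parent

/-! ### Reduction to the traceless states -/

section FirstReduction

variable {d : ℕ} {R : Type} [AddCommGroup R] [Module ℂ R] {η : Fin d → ℝ} {k₁ k₂ k₃ : Fin d}

lemma Intertw.leadH {R' : Type} [AddCommGroup R'] [Module ℂ R'] (l : R →ₗ[ℂ] R') :
    Intertw l (leadH η k₁ k₂ k₃ : Op d R) (Fronsdal.leadH η k₁ k₂ k₃) := by
  have L : Intertw l (leadL η k₁ : Op d R) (leadL η k₁) := .smul _ (.mul (.dy l _) (.dy l _))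
  have S : Intertw l (leadS η k₃ : Op d R) (leadS η k₃) := .smul _ (.mul (.da l _) (.dy l _))
  have L' : Intertw l (invL η k₁ : Op d R) (invL η k₁) := .smul _ (.mul (.iy l _) (.iy l _))
  have S' : Intertw l (invS η k₃ : Op d R) (invS η k₃) := .smul _ (.mul (.ia l _) (.iy l _))
  have T' : Intertw l (invT η k₂ : Op d R) (invT η k₂) := .smul _ (.mul (.ia l _) (.ia l _))
  have p1 : Intertw l (harmP (gTheta d) (leadL η k₁) (invL η k₁) : Op d R)
      (harmP (gTheta d) (leadL η k₁) (invL η k₁)) :=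
    .mul (.mul (.dod l _) (.mo l _)) (.sub .one (.mul L' L))
  have p2 : Intertw l (harmP (gCdag d) (leadS η k₃) (invS η k₃) : Op d R)
      (harmP (gCdag d) (leadS η k₃) (invS η k₃)) :=
    .mul (.mul (.dod l _) (.mo l _)) (.sub .one (.mul S' S))
  exact .add (.add (.mul (.dod l _) L') (.mul p1 (.mul (.dod l _) S')))
    (.mul (.mul p1 p2) (.mul (.dod l _) T'))

lemma Intertw.leadD {R' : Type} [AddCommGroup R'] [Module ℂ R'] (l : R →ₗ[ℂ] R') :
    Intertw l (leadD η k₁ k₂ k₃ : Op d R) (Fronsdal.leadD η k₁ k₂ k₃) :=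
  .add (.add (.mul (.mo l _) (.smul _ (.mul (.dy l _) (.dy l _))))
    (.mul (.mo l _) (.smul _ (.mul (.da l _) (.dy l _)))))
    (.mul (.mo l _) (.smul _ (.mul (.da l _) (.da l _))))

variable (hη : ∀ μ, η μ = 1 ∨ η μ = -1)

include hη in
lemma Intertw.omegaMinus {R' : Type} [AddCommGroup R'] [Module ℂ R'] (l : R →ₗ[ℂ] R') :
    Intertw l (OmegaMinus η : Op d R) (OmegaMinus η) := by
  rw [omegaMinus_eq η hη, omegaMinus_eq η hη]
  exact .add (.add (.mul (.mo l _) (.neg (.opBox l η))) (.mul (.mo l _) (.smul _ (.opS l η))))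
    (.mul (.mo l _) (.opT l η))

lemma anticomm_kos {A B C : Op d R} (hA : Bos A) (hB : Bos B) (hC : Bos C) (μ : Fin d) :
    mo (gC μ) * kos A B C = -(kos A B C * mo (gC μ)) := by
  have key : ∀ (g : OddVar d) {X : Op d R}, Bos X →
      mo (gC μ) * (mo g * X) = -(mo g * X * mo (gC μ)) := fun g X hX => by
    rw [← mul_assoc, mo_mo, op_neg_mul, mul_assoc, (hX _).1.eq, mul_assoc]
  rw [kos, mul_add, mul_add, add_mul, add_mul, key _ hA, key _ hB, key _ hC]
  abel

lemma anticomm_leadH (μ : Fin d) :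
    mo (gC μ) * (leadH η k₁ k₂ k₃ : Op d R) = -(leadH η k₁ k₂ k₃ * mo (gC μ)) := by
  have key : ∀ {g : OddVar d} (_ : g ≠ gC μ) {X : Op d R}, Bos X →
      mo (gC μ) * (dod g * X) = -(dod g * X * mo (gC μ)) := fun hg X hX => by
    have h := dod_mo (R := R) _ _ hg
    rw [← mul_assoc, eq_neg_iff_add_eq_zero, mul_assoc (dod _), ← (hX _).1.eq, ← mul_assoc, h,
      op_neg_mul, add_neg_cancel]
  have comm : ∀ {g : OddVar d} (_ : g ≠ gC μ) {K J : Op d R}, Bos K → Bos J →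
      Commute (mo (gC μ)) (harmP g K J) := fun hg K J hK hJ => by
    refine Commute.mul_right (KoszulFactor.commute_mul_of_anti ?_ (mo_mo _ _))
      ((Bos.one.sub (hJ.mul hK)) _).1
    exact (neg_eq_iff_eq_neg.2 (dod_mo (R := R) _ _ hg)).symm
  obtain ⟨n1, n2, n3, -⟩ := gneC μ
  have p1 := comm n1 (Bos.leadL (R := R) (η := η) (k₁ := k₁)) (Bos.invL (R := R) (η := η) (k₁ := k₁))
  have p2 := comm n2 (Bos.leadS (R := R) (η := η) (k₃ := k₃)) (Bos.invS (R := R) (η := η) (k₃ := k₃))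
  rw [leadH, mul_add, mul_add, add_mul, add_mul, key n1 Bos.invL, ← mul_assoc (mo (gC μ)), p1.eq,
    mul_assoc _ (mo (gC μ)), key n2 Bos.invS, ← mul_assoc (mo (gC μ)) (_ * _),
    (p1.mul_right p2).eq, mul_assoc _ (mo (gC μ)), key n3 Bos.invT, op_mul_neg, op_mul_neg,
    ← mul_assoc, ← mul_assoc (harmP _ _ _ * _)]
  abel

variable (h12 : k₁ ≠ k₂) (h13 : k₁ ≠ k₃) (h23 : k₂ ≠ k₃)
include h12 h13 h23 hη

lemma Intertw.contr {R' : Type} [AddCommGroup R'] [Module ℂ R'] (l : R →ₗ[ℂ] R') :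
    Intertw l (contr η k₁ k₂ k₃ : Op d R) (Fronsdal.contr η k₁ k₂ k₃) := by
  have hr : Intertw l (1 + restH η k₁ k₂ k₃ : Op d R) (1 + restH η k₁ k₂ k₃) :=
    .add .one (.mul (.sub (.omegaMinus hη l) (.leadD l)) (.leadH l))
  exact .mul (.leadH l) (hr.inv (Ring.mul_inverse_cancel _ (isUnit_restH h12 h13 h23 hη))
    (Ring.inverse_mul_cancel _ (isUnit_restH h12 h13 h23 hη)))

lemma anticomm_contr (μ : Fin d) :
    mo (gC μ) * (contr η k₁ k₂ k₃ : Op d R) = -(contr η k₁ k₂ k₃ * mo (gC μ)) := by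
  have h1 : mo (gC μ) * (OmegaMinus η - leadD η k₁ k₂ k₃ : Op d R) =
      -((OmegaMinus η - leadD η k₁ k₂ k₃) * mo (gC μ)) := by
    rw [mul_sub, sub_mul, omegaMinus_eq η hη, leadD,
      anticomm_kos (Bos.opBox η).neg ((Bos.opS η).smul _) (Bos.opT η) μ,
      anticomm_kos Bos.leadL Bos.leadS Bos.leadT μ]
    abel
  have h2 : Commute (mo (gC μ)) (1 + restH η k₁ k₂ k₃ : Op d R) :=
    (Commute.one_right _).add_right (KoszulFactor.commute_mul_of_anti h1 (anticomm_leadH μ))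
  have hu := isUnit_restH (R := R) h12 h13 h23 hη
  have h3 : Commute (mo (gC μ)) (Ring.inverse (1 + restH η k₁ k₂ k₃) : Op d R) := by
    obtain ⟨u, hu'⟩ := hu
    rw [← hu', Ring.inverse_unit]
    rw [← hu'] at h2
    exact h2.units_inv_right
  rw [contr, ← mul_assoc, anticomm_leadH, op_neg_mul, mul_assoc, h3.eq, mul_assoc]

/-- The homotopy, being natural in the coefficients, anticommutes with `𝐝`. -/
lemma contr_dTot (φ : Sec d) :
    contr η k₁ k₂ k₃ (dTot φ) = -dTot (contr η k₁ k₂ k₃ φ) := by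
  rw [dTot_eq, LinearMap.sum_apply, LinearMap.sum_apply, map_sum, ← Finset.sum_neg_distrib]
  refine Finset.sum_congr rfl fun μ _ => ?_
  rw [Module.End.mul_apply, Module.End.mul_apply, dx, Intertw.contr hη h12 h13 h23 (dxFld μ),
    apply_anti (anticomm_contr hη h12 h13 h23 μ), neg_neg]

/-- The traceless states are the common kernel of `OmegaMinus` and its homotopy. -/
lemma mem_hatS_iff {φ : Fock d R} :
    φ ∈ hatS R η ↔ OmegaMinus η φ = 0 ∧ contr η k₁ k₂ k₃ φ = 0 := by
  constructor
  · intro h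
    obtain ⟨⟨a, b, c⟩, e, f, g⟩ := mem_hatS.1 h
    refine ⟨?_, contr_of_indep h12 h13 h23 hη a b c⟩
    rw [omegaMinus_eq η hη]
    simp [kos, e, f, g]
  · rintro ⟨h1, h2⟩
    have hk : ∀ i : Mono d, kdeg i ≠ 0 → φ.1 i = 0 := fun i hi => by
      have := kdeg_harmonic h12 h13 h23 hη φ i hi
      simpa only [LinearMap.sub_apply, Module.End.one_apply, Module.End.mul_apply, h1, h2, map_zero,
        sub_zero] using this
    obtain ⟨a, b, c⟩ := mem_ker_dod_iff_kdeg.2 hk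
    have key : ∀ (g g' : OddVar d) (X : Op d R), Bos X → dod g φ = 0 →
        dod g (mo g' (X φ)) = if g = g' then X φ else 0 := fun g g' X hX h0 => by
      split_ifs with hg
      · subst hg
        have := LinearMap.congr_fun (dod_mo_self (R := R) g) (X φ)
        simp only [Module.End.mul_apply, LinearMap.sub_apply, Module.End.one_apply] at this
        rw [this, apply_comm (hX g).2, h0, map_zero, map_zero, sub_zero]
      · rw [apply_anti (dod_mo _ _ hg), apply_comm (hX g).2, h0, map_zero, map_zero, neg_zero]
    obtain ⟨n1, n2, n3, -⟩ := gne (d := d)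
    rw [omegaMinus_eq η hη, kos] at h1
    simp only [LinearMap.add_apply, Module.End.mul_apply] at h1
    have e1 := congrArg (dod (gTheta d)) h1
    have e2 := congrArg (dod (gCdag d)) h1
    have e3 := congrArg (dod (gXi d)) h1
    rw [map_add, map_add, key _ _ _ (Bos.opBox η).neg a, key _ _ _ ((Bos.opS η).smul _) a,
      key _ _ _ (Bos.opT η) a, if_pos rfl, if_neg n1, if_neg n2, add_zero, add_zero, map_zero,
      LinearMap.neg_apply, neg_eq_zero] at e1
    rw [map_add, map_add, key _ _ _ (Bos.opBox η).neg b, key _ _ _ ((Bos.opS η).smul _) b,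
      key _ _ _ (Bos.opT η) b, if_neg n1.symm, if_pos rfl, if_neg n3, add_zero, zero_add, map_zero,
      LinearMap.smul_apply, smul_eq_zero, or_iff_right (by simp)] at e2
    rw [map_add, map_add, key _ _ _ (Bos.opBox η).neg c, key _ _ _ ((Bos.opS η).smul _) c,
      key _ _ _ (Bos.opT η) c, if_neg n2.symm, if_neg n3.symm, if_pos rfl, zero_add, zero_add,
      map_zero] at e3
    exact mem_hatS.2 ⟨⟨a, b, c⟩, e1, e2, e3⟩

/-- The Hodge-like decomposition of a state. -/
lemma hodge (φ : Fock d R) :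
    φ - OmegaMinus η (contr η k₁ k₂ k₃ φ) - contr η k₁ k₂ k₃ (OmegaMinus η φ) ∈ hatS R η := by
  obtain ⟨r1, r2, r3, -⟩ := contr_relations (R := R) h12 h13 h23 hη
  have DD := omegaMinus_sq (R := R) η hη
  have r1' := LinearMap.congr_fun r1
  have r2' := LinearMap.congr_fun r2
  have r3' := LinearMap.congr_fun r3
  have DD' := LinearMap.congr_fun DD
  simp only [Module.End.mul_apply, LinearMap.zero_apply] at r1' r2' r3' DD'
  rw [mem_hatS_iff hη h12 h13 h23, map_sub, map_sub, map_sub, map_sub, DD', r1', r2', r3']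
  simp

/-- The traceless states represent the cohomology of `OmegaMinus`. -/
lemma hatE_sup_range :
    hatE η ⊔ LinearMap.range (OmegaMinus η : State d →ₗ[ℂ] State d) =
      LinearMap.ker (OmegaMinus η : State d →ₗ[ℂ] State d) := by
  refine le_antisymm (sup_le ?_ ?_) ?_
  · exact fun φ hφ => ((mem_hatS_iff hη h12 h13 h23).1 (show φ ∈ hatS ℂ η from hφ)).1
  · rintro _ ⟨φ, rfl⟩
    exact LinearMap.congr_fun (omegaMinus_sq (R := ℂ) η hη) φ
  · intro φ hφ
    have h := hodge (R := ℂ) hη h12 h13 h23 φ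
    rw [LinearMap.mem_ker.1 hφ, map_zero, sub_zero] at h
    rw [← sub_add_cancel φ (OmegaMinus η (contr η k₁ k₂ k₃ φ))]
    exact Submodule.add_mem_sup h ⟨_, rfl⟩

/-- Since the homotopy is natural in the coefficients, the sections with values in the image of
`OmegaMinus` are those fixed by `OmegaMinus contr`. -/
lemma mem_secs_range {φ : Sec d} :
    φ ∈ secs (LinearMap.range (OmegaMinus η : State d →ₗ[ℂ] State d)) ↔
      OmegaMinus η (contr η k₁ k₂ k₃ φ) = φ := by
  have hr : ∀ ψ : State d, ψ ∈ LinearMap.range (OmegaMinus η : State d →ₗ[ℂ] State d) ↔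
      (OmegaMinus η * contr η k₁ k₂ k₃ - 1 : Op d ℂ) ψ = 0 := fun ψ => by
    rw [LinearMap.sub_apply, Module.End.mul_apply, Module.End.one_apply, sub_eq_zero]
    refine ⟨?_, fun h => ⟨_, h⟩⟩
    rintro ⟨χ, rfl⟩
    exact LinearMap.congr_fun (contr_relations (R := ℂ) h12 h13 h23 hη).2.2.1 χ
  rw [mem_secs]
  simp only [hr]
  rw [← sec_ker (A' := OmegaMinus η * contr η k₁ k₂ k₃ - 1) fun x =>
    .sub (.mul (.omegaMinus hη _) (.contr hη h12 h13 h23 _)) .one, LinearMap.sub_apply,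
    Module.End.mul_apply, Module.End.one_apply, sub_eq_zero]

lemma mem_secs_range_contr {φ : Sec d} :
    φ ∈ secs (LinearMap.range (contr η k₁ k₂ k₃ : State d →ₗ[ℂ] State d)) ↔
      contr η k₁ k₂ k₃ (OmegaMinus η φ) = φ := by
  have hr : ∀ ψ : State d, ψ ∈ LinearMap.range (contr η k₁ k₂ k₃ : State d →ₗ[ℂ] State d) ↔
      (contr η k₁ k₂ k₃ * OmegaMinus η - 1 : Op d ℂ) ψ = 0 := fun ψ => by
    rw [LinearMap.sub_apply, Module.End.mul_apply, Module.End.one_apply, sub_eq_zero]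
    refine ⟨?_, fun h => ⟨_, h⟩⟩
    rintro ⟨χ, rfl⟩
    exact LinearMap.congr_fun (contr_relations (R := ℂ) h12 h13 h23 hη).2.1 χ
  rw [mem_secs]
  simp only [hr]
  rw [← sec_ker (A' := contr η k₁ k₂ k₃ * OmegaMinus η - 1) fun x =>
    .sub (.mul (.contr hη h12 h13 h23 _) (.omegaMinus hη _)) .one, LinearMap.sub_apply,
    Module.End.mul_apply, Module.End.one_apply, sub_eq_zero]

/-- The component in the image of the homotopy is `contr OmegaMinus φ`, the one in the image of
`OmegaMinus` is `OmegaMinus contr φ`. -/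
lemma isEFG_first : IsEFG (secs (hatE η))
    (secs (LinearMap.range (contr η k₁ k₂ k₃ : State d →ₗ[ℂ] State d)))
    (secs (LinearMap.range (OmegaMinus η : State d →ₗ[ℂ] State d))) := by
  obtain ⟨r1, r2, r3, -⟩ := contr_relations (R := Fld d) h12 h13 h23 hη
  have DD := omegaMinus_sq (R := Fld d) η hη
  have r1' := LinearMap.congr_fun r1
  have r2' := LinearMap.congr_fun r2
  have r3' := LinearMap.congr_fun r3
  have DD' := LinearMap.congr_fun DD
  simp only [Module.End.mul_apply, LinearMap.zero_apply] at r1' r2' r3' DD'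
  refine IsEFG.of_unique (fun φ => ⟨φ - OmegaMinus η (contr η k₁ k₂ k₃ φ) -
    contr η k₁ k₂ k₃ (OmegaMinus η φ), ?_, contr η k₁ k₂ k₃ (OmegaMinus η φ), ?_,
    OmegaMinus η (contr η k₁ k₂ k₃ φ), ?_, ?_⟩) ?_
  · rw [secs_hatE]
    exact hodge hη h12 h13 h23 φ
  · rw [mem_secs_range_contr hη h12 h13 h23, r3']
  · rw [mem_secs_range hη h12 h13 h23, r2']
  · abel
  · intro e he f hf g hg h
    rw [secs_hatE, mem_hatS_iff hη h12 h13 h23] at he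
    rw [mem_secs_range_contr hη h12 h13 h23] at hf
    rw [mem_secs_range hη h12 h13 h23] at hg
    have a1 := congrArg (fun v => contr η k₁ k₂ k₃ (OmegaMinus η v)) h
    have a2 := congrArg (fun v => OmegaMinus η (contr η k₁ k₂ k₃ v)) h
    have hf0 : contr η k₁ k₂ k₃ f = 0 := by rw [← hf, r1']
    have hg0 : OmegaMinus η g = 0 := by rw [← hg, DD']
    simp only [map_add, map_zero, he.1, he.2, hf, hg, hf0, hg0, zero_add, add_zero] at a1 a2
    subst a1 a2
    simpa using h

lemma blockGF_first (h1 : IsEFG (secs (hatE η))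
    (secs (LinearMap.range (contr η k₁ k₂ k₃ : State d →ₗ[ℂ] State d)))
    (secs (LinearMap.range (OmegaMinus η : State d →ₗ[ℂ] State d))))
    (p : secs (LinearMap.range (contr η k₁ k₂ k₃ : State d →ₗ[ℂ] State d))) :
    (h1.blockGF (OmegaT η) p : Sec d) =
      OmegaMinus η (contr η k₁ k₂ k₃ (OmegaT η (p : Sec d))) := by
  obtain ⟨r1, r2, r3, -⟩ := contr_relations (R := Fld d) h12 h13 h23 hη
  have r2' := LinearMap.congr_fun r2
  have r3' := LinearMap.congr_fun r3
  simp only [Module.End.mul_apply] at r2' r3'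
  set ψ := OmegaT η (p : Sec d) with hψ
  have e : ψ = (ψ - OmegaMinus η (contr η k₁ k₂ k₃ ψ) - contr η k₁ k₂ k₃ (OmegaMinus η ψ)) +
      contr η k₁ k₂ k₃ (OmegaMinus η ψ) + OmegaMinus η (contr η k₁ k₂ k₃ ψ) := by abel
  have := h1.proj_G (e := ψ - OmegaMinus η (contr η k₁ k₂ k₃ ψ) - contr η k₁ k₂ k₃ (OmegaMinus η ψ))
    (f := contr η k₁ k₂ k₃ (OmegaMinus η ψ)) (g := OmegaMinus η (contr η k₁ k₂ k₃ ψ))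
    (by rw [secs_hatE]; exact hodge hη h12 h13 h23 ψ)
    (by rw [mem_secs_range_contr hη h12 h13 h23, r3'])
    (by rw [mem_secs_range hη h12 h13 h23, r2'])
  rw [← e] at this
  exact congrArg Subtype.val this

/-- The homotopy composed with the part of degree `0` of the parent operator lowers the degree in
`θ`, `c†`, `ξ`; so the block of the parent operator is invertible. -/
lemma isUnit_block : IsUnit (1 + contr η k₁ k₂ k₃ *
    (-Complex.I • ((dTot : Op d (Fld d)) + sig + SdagDb) + ghostPart) : Op d (Fld d)) := by
  have hs : Sh kdeg (-1) (contr η k₁ k₂ k₃ : Op d (Fld d)) := sh_contr h12 h13 h23 hη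
    (by simp [wO_theta]) (by simp [wO_cdag]) (by simp [wO_xi])
  have hN : Sh kdeg (-1) (contr η k₁ k₂ k₃ *
    (-Complex.I • ((dTot : Op d (Fld d)) + sig + SdagDb) + ghostPart) : Op d (Fld d)) := hs.mul kdeg_rest (by ring)
  set N : Op d (Fld d) := contr η k₁ k₂ k₃ *
    (-Complex.I • ((dTot : Op d (Fld d)) + sig + SdagDb) + ghostPart)
  have hpow : ∀ n : ℕ, Sh kdeg (-n) (N ^ n) := fun n => by
    induction n with
    | zero => simpa using Sh.one
    | succ n ih => rw [pow_succ]; exact ih.mul hN (by push_cast; ring)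
  refine IsNilpotent.isUnit_one_add ⟨(∑ g : OddVar d, wO 1 1 1 g).toNat + 1, ?_⟩
  ext φ : 1
  refine Fock.ext' fun i => ?_
  refine hpow _ φ i fun j hj => ?_
  have h1 := kdeg_bounds i
  have h2 := kdeg_bounds j
  omega

/-- On the image of the homotopy, `contr` composed with the parent operator is `1` plus a nilpotent
operator, which is invertible. The `x`-derivatives drop out of the block, because `contr`
anticommutes with `𝐝` and has square zero. -/
lemma algInvertible_first (h1 : IsEFG (secs (hatE η))
    (secs (LinearMap.range (contr η k₁ k₂ k₃ : State d →ₗ[ℂ] State d)))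
    (secs (LinearMap.range (OmegaMinus η : State d →ₗ[ℂ] State d)))) :
    AlgInvertible
      (fun p : secs (LinearMap.range (contr η k₁ k₂ k₃ : State d →ₗ[ℂ] State d)) => (p : Sec d))
      (fun q : secs (LinearMap.range (OmegaMinus η : State d →ₗ[ℂ] State d)) => (q : Sec d))
      (h1.blockGF (OmegaT η)) := by
  obtain ⟨r1, r2, r3, -⟩ := contr_relations (R := Fld d) h12 h13 h23 hη
  have r1' := LinearMap.congr_fun r1
  have r2' := LinearMap.congr_fun r2
  have r3' := LinearMap.congr_fun r3
  simp only [Module.End.mul_apply, LinearMap.zero_apply] at r1' r2' r3'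
  obtain ⟨u, hu⟩ := isUnit_block hη h12 h13 h23
  have hB := fun p => blockGF_first hη h12 h13 h23 h1 p
  have hinj : Function.Injective (h1.blockGF (OmegaT η)) := by
    rw [← LinearMap.ker_eq_bot, LinearMap.ker_eq_bot']
    rintro ⟨p, hp'⟩ h0
    have hp := (mem_secs_range_contr hη h12 h13 h23).1 hp'
    have h2 := hB ⟨p, hp'⟩
    rw [h0] at h2
    have h3 := congrArg (contr η k₁ k₂ k₃) h2
    rw [Submodule.coe_zero, map_zero, r2', omegaT_eq, LinearMap.add_apply, map_add, hp] at h3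
    have h4 : (u : Op d (Fld d)) p = 0 := by rw [hu]; exact h3.symm
    have h5 := congrArg ((↑u⁻¹ : Op d (Fld d))) h4
    rw [← Module.End.mul_apply, Units.inv_mul, map_zero] at h5
    exact Subtype.ext h5
  refine ⟨⟨hinj, ?_⟩, ?_⟩
  · rintro ⟨g, hg⟩
    have hg' := hg
    rw [mem_secs_range hη h12 h13 h23] at hg'
    set p : Sec d := (↑u⁻¹ : Op d (Fld d)) (contr η k₁ k₂ k₃ g) with hp
    have hup : (u : Op d (Fld d)) p = contr η k₁ k₂ k₃ g := by
      rw [hp, ← Module.End.mul_apply, Units.mul_inv, Module.End.one_apply]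
    rw [hu, LinearMap.add_apply, Module.End.one_apply, Module.End.mul_apply] at hup
    have hpF : contr η k₁ k₂ k₃ (OmegaMinus η p) = p := by
      have : p = contr η k₁ k₂ k₃
          (g - (-Complex.I • ((dTot : Op d (Fld d)) + sig + SdagDb) + ghostPart : Op d (Fld d)) p) := by
        rw [map_sub, ← hup]; abel
      rw [this, r2']
    refine ⟨⟨p, (mem_secs_range_contr hη h12 h13 h23).2 hpF⟩, Subtype.ext ?_⟩
    rw [hB, omegaT_eq, LinearMap.add_apply, map_add]
    exact (congrArg (OmegaMinus η) ((congrArg (· + _) hpF).trans hup)).trans hg'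
  · intro f p p' h
    have hF : ∀ q : Sec d, contr η k₁ k₂ k₃ (OmegaMinus η q) = q →
        contr η k₁ k₂ k₃ (dTot q) = 0 := fun q hq => by
      rw [contr_dTot hη h12 h13 h23, ← hq, r1', map_zero, neg_zero]
    have hnat : Intertw (LinearMap.mulLeft ℂ f : Fld d →ₗ[ℂ] Fld d)
        (OmegaMinus η * contr η k₁ k₂ k₃ *
          (OmegaMinus η + (-Complex.I • ((sig : Op d (Fld d)) + SdagDb) + ghostPart)) : Op d (Fld d))
        (OmegaMinus η * contr η k₁ k₂ k₃ *
          (OmegaMinus η + (-Complex.I • ((sig : Op d (Fld d)) + SdagDb) + ghostPart))) :=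
      .mul (.mul (.omegaMinus hη _) (.contr hη h12 h13 h23 _))
        (.add (.omegaMinus hη _) (.add (.smul _ (.add (.sig _) (.SdagDb _))) (.ghostPart _)))
    have hA : ∀ q : Sec d, contr η k₁ k₂ k₃ (OmegaMinus η q) = q →
        OmegaMinus η (contr η k₁ k₂ k₃ (OmegaT η q)) = (OmegaMinus η * contr η k₁ k₂ k₃ *
          (OmegaMinus η + (-Complex.I • ((sig : Op d (Fld d)) + SdagDb) + ghostPart)) : Op d (Fld d)) q :=
      fun q hq => by
        rw [omegaT_eq]
        simp only [LinearMap.add_apply, LinearMap.smul_apply, Module.End.mul_apply, map_add,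
          map_smul, hF q hq, smul_add, smul_zero, zero_add]
    have hp := (mem_secs_range_contr hη h12 h13 h23).1 p.2
    have hfp : contr η k₁ k₂ k₃ (OmegaMinus η (fmul f (p : Sec d))) = fmul f p := by
      rw [fmul, ← Intertw.omegaMinus hη _, ← Intertw.contr hη h12 h13 h23 _, hp]
    have : p' = ⟨fmul f p, (mem_secs_range_contr hη h12 h13 h23).2 hfp⟩ := by
      apply hinj
      apply Subtype.ext
      simp only [hB] at h ⊢
      rw [h, hA _ hp, hA _ hfp, fmul, hnat]
    rw [this]

/-- The homotopy is homogeneous in the ghost number. -/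
lemma ghPart_range (k : ℤ) (φ : State d)
    (hφ : φ ∈ LinearMap.range (contr η k₁ k₂ k₃ : State d →ₗ[ℂ] State d)) :
    ghPart k φ ∈ LinearMap.range (contr η k₁ k₂ k₃ : State d →ₗ[ℂ] State d) := by
  obtain ⟨ψ, rfl⟩ := hφ
  have e : ∀ i : Mono d, i.gh = lw (fun _ => 0) (fun _ => 0) oddGh i := fun i => by
    simp [lw, Mono.gh]
  obtain ⟨-, -, -, n1, n2, n3⟩ := gne (d := d)
  have hs := sh_contr (R := ℂ) h12 h13 h23 hη (a := 0) (b := 0) (m := 1) (γ := oddGh)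
    (by simp [oddGh, n1]) (by simp [oddGh, n2]) (by simp [oddGh, n3])
  have := Rel.diag_mul hs (c := fun i => if i.gh = k then 1 else 0)
    (c' := fun i => if i.gh = k + 1 then 1 else 0) (fun i j hij => by
      simp only [e, hij]
      congr 1
      rw [eq_iff_iff]
      constructor <;> intro h <;> omega)
  exact ⟨ghPart (k + 1) ψ, (LinearMap.congr_fun this ψ).symm⟩

omit h12 h13 h23 in
/-- On traceless sections the parent operator is `-i (𝐝 + σ + S† ∂/∂b†)`, and it preserves them. -/
lemma omegaT_hatS (k₁ k₂ k₃ : Fin d) (h12 : k₁ ≠ k₂) (h13 : k₁ ≠ k₃) (h23 : k₂ ≠ k₃) {φ : Sec d}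
    (hφ : φ ∈ hatS (Fld d) η) : OmegaT η φ = -Complex.I • (dTot φ + sig φ + SdagDb φ) := by
  have h0 := ((mem_hatS_iff hη h12 h13 h23).1 hφ).1
  obtain ⟨⟨a, b, -⟩, -⟩ := mem_hatS.1 hφ
  rw [omegaT_eq, LinearMap.add_apply, LinearMap.add_apply, h0, ghostPart_apply a b, zero_add,
    add_zero]
  rfl

omit h12 h13 h23 in
/-- For every choice of `F` the correction term of the reduction vanishes, since the parent operator
maps traceless sections to traceless sections. -/
lemma reduced_first (k₁ k₂ k₃ : Fin d) (h12 : k₁ ≠ k₂) (h13 : k₁ ≠ k₃) (h23 : k₂ ≠ k₃)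
    {F G : Submodule ℂ (Sec d)} (h1 : IsEFG (secs (hatE η)) F G)
    (b1 : Function.Bijective (h1.blockGF (OmegaT η))) (φ : secs (hatE η)) :
    ((h1.reduced (OmegaT η) b1 φ : secs (hatE η)) : Sec d) =
        -Complex.I • (dTot (φ : Sec d) + sig (φ : Sec d) + SdagDb (φ : Sec d)) := by
  have hφ : (φ : Sec d) ∈ hatS (Fld d) η := by rw [← secs_hatE]; exact φ.2
  have e := omegaT_hatS hη k₁ k₂ k₃ h12 h13 h23 hφ
  have := h1.reduced_apply b1 φ (ζ := 0) (e := -Complex.I • (dTot (φ : Sec d) + sig (φ : Sec d)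
    + SdagDb (φ : Sec d))) (e' := 0) (f := 0) (f' := 0) (g := 0) (zero_mem _) (by
      have hs : ∀ ψ, ψ ∈ hatS (Fld d) η → ψ ∈ secs (hatE η) := fun ψ h => by rwa [secs_hatE]
      refine hs _ ?_
      exact Submodule.smul_mem _ _ (add_mem (add_mem (hatS_dTot η hφ) (hatS_sig hφ))
        (hatS_SdagDb hφ))) (zero_mem _) (zero_mem _) (zero_mem _) (zero_mem _) (by simp [e]) (by simp)
  rw [this, sub_zero]

end FirstReduction

/-! ### Projectors for `sl(2)` in an associative algebra -/

section SlTwoRing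

variable {A : Type*} [Ring A]

/-- Elements `e`, `f` that generate, together with `h = D id`, an action of `sl(2)`, where `D` is
the functional calculus for an element `h` with integral eigenvalues. -/
structure SlTriple (e f : A) (D : (ℤ → ℂ) →+* A) : Prop where
  raise : ∀ g, e * D g = D (fun c => g (c - 2)) * e
  lower : ∀ g, f * D g = D (fun c => g (c + 2)) * f
  bracket : e * f = f * e + D (fun c => (c : ℂ))

/-- The functional calculus for `-h`. -/
def negCalc (D : (ℤ → ℂ) →+* A) : (ℤ → ℂ) →+* A :=
  D.comp (RingHom.pi fun c : ℤ => Pi.evalRingHom (fun _ : ℤ => ℂ) (-c))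

lemma negCalc_apply (D : (ℤ → ℂ) →+* A) (g : ℤ → ℂ) : negCalc D g = D (fun c => g (-c)) := rfl

/-- The coefficients of the projector on the lowest-weight vectors. -/
def lowCoef (k : ℕ) (c : ℤ) : ℂ :=
  if c ≤ 0 then ((k.factorial : ℂ) * ∏ j ∈ Finset.Icc 1 k, ((c : ℂ) - j - 1))⁻¹ else 0

lemma lowCoef_succ (k : ℕ) (c : ℤ) :
    lowCoef (k + 1) c * ((k + 1) * (c - k - 2)) = lowCoef k c := by
  unfold lowCoef
  split_ifs with hc
  · have h1 : ((k : ℂ) + 1) ≠ 0 := by exact_mod_cast Nat.succ_ne_zero k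
    have h2 : ((c : ℂ) - k - 2) ≠ 0 := by
      have : c - k - 2 ≠ 0 := by omega
      exact_mod_cast this
    rw [Finset.prod_Icc_succ_top (by omega), Nat.factorial_succ]
    have h3 : ((c : ℂ) - (k + 1 : ℕ) - 1) = c - k - 2 := by push_cast; ring
    rw [h3]
    push_cast
    rw [mul_inv, mul_inv, mul_inv, mul_inv]
    field_simp
  · simp

lemma lowCoef_zero (c : ℤ) : lowCoef 0 c = if c ≤ 0 then 1 else 0 := by simp [lowCoef]

/-- The coefficients of the operator that inverts the raising operator on positive weights. -/
def posCoef (k : ℕ) (c : ℤ) : ℂ :=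
  if 0 < c then (-1) ^ k * (((k + 1).factorial : ℂ) * ∏ j ∈ Finset.range (k + 1), ((c : ℂ) + j))⁻¹
  else 0

lemma posCoef_zero (c : ℤ) : posCoef 0 c * c = if 0 < c then 1 else 0 := by
  unfold posCoef
  split_ifs with hc
  · have : (c : ℂ) ≠ 0 := by exact_mod_cast hc.ne'
    simp [this]
  · simp

lemma posCoef_succ (k : ℕ) (c : ℤ) :
    posCoef (k + 1) c * ((k + 2) * (c + k + 1)) = -posCoef k c := by
  unfold posCoef
  split_ifs with hc
  · have h1 : ((k : ℂ) + 2) ≠ 0 := by exact_mod_cast (by omega : k + 2 ≠ 0)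
    have h2 : ((c : ℂ) + k + 1) ≠ 0 := by
      have : c + k + 1 ≠ 0 := by omega
      exact_mod_cast this
    rw [Finset.prod_range_succ, Nat.factorial_succ (k + 1), pow_succ]
    have h3 : ((c : ℂ) + (k + 1 : ℕ)) = c + k + 1 := by push_cast; ring
    have h4 : (((k + 1 + 1) * (k + 1).factorial : ℕ) : ℂ) = (k + 2) * ((k + 1).factorial : ℂ) := by
      push_cast; ring
    rw [h3, h4, mul_inv, mul_inv, mul_inv, mul_inv]
    field_simp
  · simp

namespace SlTriple

variable {e f : A} {D : (ℤ → ℂ) →+* A} (S : SlTriple e f D)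
include S

/-- The involution that exchanges `e` and `f` and changes the sign of `h`. -/
lemma swap : SlTriple f e (negCalc D) where
  raise g := by
    rw [negCalc_apply, S.lower, negCalc_apply]
    congr 3; funext c; congr 1; ring
  lower g := by
    rw [negCalc_apply, S.raise, negCalc_apply]
    congr 3; funext c; congr 1; ring
  bracket := by
    rw [S.bracket, negCalc_apply, add_assoc, ← map_add]
    have : ((fun c : ℤ => (c : ℂ)) + fun c : ℤ => ((-c : ℤ) : ℂ)) = 0 := by
      funext c; simp
    rw [this, map_zero, add_zero]

lemma raise_pow (k : ℕ) (g : ℤ → ℂ) : e ^ k * D g = D (fun c => g (c - 2 * k)) * e ^ k := by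
  induction k generalizing g with
  | zero => simp
  | succ k ih =>
    rw [pow_succ, mul_assoc, S.raise, ← mul_assoc, ih, mul_assoc]
    congr 3; funext c; congr 1; push_cast; ring

lemma lower_pow (k : ℕ) (g : ℤ → ℂ) : f ^ k * D g = D (fun c => g (c + 2 * k)) * f ^ k := by
  induction k generalizing g with
  | zero => simp
  | succ k ih =>
    rw [pow_succ, mul_assoc, S.lower, ← mul_assoc, ih, mul_assoc]
    congr 3; funext c; congr 1; push_cast; ring

lemma raise_pow_lower (k : ℕ) :
    f * e ^ (k + 1) = e ^ (k + 1) * f - D (fun c => (k + 1) * (c - k)) * e ^ k := by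
  have hfe : f * e = e * f - D (fun c => (c : ℂ)) := by rw [S.bracket]; abel
  induction k with
  | zero => simp [hfe]
  | succ k ih =>
    rw [pow_succ e (k + 1), ← mul_assoc, ih, sub_mul, mul_assoc, hfe, mul_sub, S.raise_pow,
      mul_assoc (D _) (e ^ k), ← pow_succ, ← mul_assoc, ← pow_succ, sub_sub, ← add_mul, ← map_add]
    congr 3
    funext c
    simp only [Pi.add_apply]
    push_cast
    ring

lemma lower_pow_raise (k : ℕ) :
    e * f ^ (k + 1) = f ^ (k + 1) * e + D (fun c => (k + 1) * (c + k)) * f ^ k := by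
  rw [S.swap.raise_pow_lower, negCalc_apply, sub_eq_add_neg, ← neg_mul, ← map_neg]
  congr 3
  funext c
  simp only [Pi.neg_apply]
  push_cast
  ring

/-- Multiplied by `f`, the partial sums of the projector on the lowest-weight vectors telescope. -/
lemma lower_lowProj (N : ℕ) : f * ∑ k ∈ Finset.range (N + 1), D (lowCoef k) * (e ^ k * f ^ k) =
    D (fun c => lowCoef N (c + 2)) * (e ^ N * f ^ (N + 1)) := by
  induction N with
  | zero => simp [← mul_assoc, S.lower]
  | succ N ih =>
    rw [Finset.sum_range_succ, mul_add, ih, ← mul_assoc f, S.lower, mul_assoc (D _) f,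
      ← mul_assoc f, S.raise_pow_lower, sub_mul, mul_sub, mul_assoc (D _) (e ^ N),
      ← mul_assoc (D _) (D _), ← map_mul, mul_assoc (e ^ (N + 1)), ← pow_succ' f]
    have : ((fun c => lowCoef (N + 1) (c + 2)) * fun c : ℤ => ((N : ℂ) + 1) * (c - N)) =
        fun c => lowCoef N (c + 2) := by
      funext c
      rw [Pi.mul_apply, ← lowCoef_succ N]
      push_cast
      ring
    rw [this]
    abel

/-- Multiplied by `e` on the right, the partial sums telescope as well. -/
lemma lowProj_raise (N : ℕ) :
    (∑ k ∈ Finset.range (N + 1), D (lowCoef k) * (e ^ k * f ^ k)) * e =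
    D (lowCoef N) * (e ^ (N + 1) * f ^ N) := by
  have hfe : ∀ k : ℕ, f ^ (k + 1) * e = e * f ^ (k + 1) - D (fun c => (k + 1) * (c + k)) * f ^ k :=
    fun k => by rw [S.lower_pow_raise]; abel
  induction N with
  | zero => simp
  | succ N ih =>
    rw [Finset.sum_range_succ, add_mul, ih, mul_assoc, mul_assoc, hfe, mul_sub, mul_sub,
      ← mul_assoc (e ^ (N + 1)) e, ← pow_succ, ← mul_assoc (e ^ (N + 1)) (D _), S.raise_pow,
      mul_assoc (D _) (e ^ _), ← mul_assoc (D _) (D _), ← map_mul]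
    have : (lowCoef (N + 1) * fun c : ℤ =>
        ((N : ℂ) + 1) * ((c - 2 * (N + 1 : ℕ) : ℤ) + N)) = lowCoef N := by
      funext c
      rw [Pi.mul_apply, ← lowCoef_succ N]
      push_cast
      ring
    rw [this]
    abel

lemma lowProj_eq_raise (N : ℕ) :
    ∑ k ∈ Finset.range (N + 1), D (lowCoef k) * (e ^ k * f ^ k) = D (lowCoef 0) +
      e * ∑ k ∈ Finset.range N, D (fun c => lowCoef (k + 1) (c + 2)) * (e ^ k * f ^ (k + 1)) := by
  rw [Finset.sum_range_succ', add_comm, pow_zero, pow_zero, mul_one, mul_one, Finset.mul_sum]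
  congr 1
  refine Finset.sum_congr rfl fun k _ => ?_
  rw [← mul_assoc e, S.raise, mul_assoc (D _), ← mul_assoc e, ← pow_succ']
  simp

omit S in
lemma lowProj_eq_lower (N : ℕ) :
    ∑ k ∈ Finset.range (N + 1), D (lowCoef k) * (e ^ k * f ^ k) = D (lowCoef 0) +
      (∑ k ∈ Finset.range N, D (lowCoef (k + 1)) * (e ^ (k + 1) * f ^ k)) * f := by
  rw [Finset.sum_range_succ', add_comm, pow_zero, pow_zero, mul_one, mul_one, Finset.sum_mul]
  congr 1
  refine Finset.sum_congr rfl fun k _ => ?_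
  rw [mul_assoc, mul_assoc, ← pow_succ]

omit S in
/-- The telescoping sum behind `raise_posInv` and `posInv_lower`. -/
lemma posInv_aux (N : ℕ) (X : ℕ → A) (hX : ∀ k, X k = D (posCoef k) *
      (f ^ (k + 1) * e ^ (k + 1) + D (fun c => (k + 1) * (c + k)) * (f ^ k * e ^ k))) :
    ∑ k ∈ Finset.range (N + 1), X k = D (fun c => if 0 < c then 1 else 0) +
      D (posCoef N) * (f ^ (N + 1) * e ^ (N + 1)) := by
  induction N with
  | zero =>
    have : (posCoef 0 * fun c : ℤ => (((0 : ℕ) : ℂ) + 1) * (c + (0 : ℕ))) =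
        fun c => if 0 < c then 1 else 0 := by
      funext c; rw [← posCoef_zero]; simp
    rw [Finset.sum_range_one, hX, mul_add, ← mul_assoc (D _) (D _), ← map_mul, this]
    simp [add_comm]
  | succ N ih =>
    have : (posCoef (N + 1) * fun c : ℤ => (((N + 1 : ℕ) : ℂ) + 1) * (c + (N + 1 : ℕ))) =
        -posCoef N := by
      funext c
      rw [Pi.neg_apply, ← posCoef_succ N, Pi.mul_apply]
      push_cast
      ring
    rw [Finset.sum_range_succ, ih, hX, mul_add, ← mul_assoc (D _) (D _), ← map_mul, this, map_neg,
      neg_mul]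
    abel

/-- On positive weights the identity is `e` times an operator, up to a term that vanishes on states
annihilated by a power of `e`. -/
lemma raise_posInv (N : ℕ) :
    e * ∑ k ∈ Finset.range (N + 1), D (fun c => posCoef k (c + 2)) * (f ^ (k + 1) * e ^ k) =
    D (fun c => if 0 < c then 1 else 0) + D (posCoef N) * (f ^ (N + 1) * e ^ (N + 1)) := by
  rw [Finset.mul_sum]
  refine posInv_aux N _ fun k => ?_
  rw [← mul_assoc e, S.raise, mul_assoc (D _), ← mul_assoc e, S.lower_pow_raise, add_mul,
    mul_assoc, ← pow_succ', mul_assoc]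
  simp

/-- On positive weights the identity is an operator times `f`, up to a term that vanishes on states
annihilated by a power of `e`. -/
lemma posInv_lower (N : ℕ) :
    (∑ k ∈ Finset.range (N + 1), D (posCoef k) * (f ^ k * e ^ (k + 1))) * f =
    D (fun c => if 0 < c then 1 else 0) + D (posCoef N) * (f ^ (N + 1) * e ^ (N + 1)) := by
  rw [Finset.sum_mul]
  refine posInv_aux N _ fun k => ?_
  have : e ^ (k + 1) * f = f * e ^ (k + 1) + D (fun c => (k + 1) * (c - k)) * e ^ k := by
    rw [S.raise_pow_lower]; abel
  rw [mul_assoc, mul_assoc, this, mul_add, ← mul_assoc (f ^ k), ← pow_succ, ← mul_assoc (f ^ k),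
    S.lower_pow, mul_assoc]
  congr 6
  funext c
  push_cast
  ring

end SlTriple

end SlTwoRing

/-! ### Lowest and highest weight states -/

section Weights

variable {d : ℕ} {R : Type} [AddCommGroup R] [Module ℂ R]

/-- The functional calculus of the weight operator: `wcalc g = g(h)`. -/
def wcalc : (ℤ → ℂ) →+* Op d R where
  toFun g := diag fun i => g (wdeg i)
  map_one' := by
    ext φ : 1
    refine Fock.ext' fun i => ?_
    rw [diag_apply]
    exact one_smul ℂ _
  map_mul' g g' := by
    ext φ : 1
    refine Fock.ext' fun i => ?_
    rw [diag_apply, Module.End.mul_apply, diag_apply, diag_apply, smul_smul]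
    rfl
  map_zero' := by
    ext φ : 1
    refine Fock.ext' fun i => ?_
    rw [diag_apply]
    exact zero_smul ℂ _
  map_add' g g' := by
    ext φ : 1
    refine Fock.ext' fun i => ?_
    rw [diag_apply, LinearMap.add_apply, coe_add', diag_apply, diag_apply, ← add_smul]
    rfl

lemma wcalc_apply (g : ℤ → ℂ) (φ : Fock d R) (i : Mono d) :
    (wcalc g φ).1 i = g (wdeg i) • φ.1 i := rfl

lemma slTriple : SlTriple (opSdag : Op d R) opSbardag wcalc where
  raise g := by
    refine (Rel.diag_mul (sh_opSdag (a := -1) (b := 1) 0) fun i j hij => ?_).symm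
    change wdeg i = wdeg j + _ at hij
    exact congrArg g (by rw [hij]; ring)
  lower g := by
    refine (Rel.diag_mul (sh_opSbardag (a := -1) (b := 1) 0) fun i j hij => ?_).symm
    change wdeg i = wdeg j + _ at hij
    exact congrArg g (by rw [hij]; ring)
  bracket := by rw [opSdag_opSbardag, wt_eq]; rfl

lemma Sh.pow {w : Mono d → ℤ} {k : ℤ} {A : Op d R} (hA : Sh w k A) (n : ℕ) :
    Sh w (n * k) (A ^ n) := by
  induction n with
  | zero => simpa using Sh.one
  | succ n ih => rw [pow_succ]; exact ih.mul hA (by push_cast; ring)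

lemma adeg_eq_lw (i : Mono d) : (i.adeg : ℤ) = lw (fun _ => 0) (fun _ => 1) 0 i := by
  simp [lw, Mono.adeg]

lemma coeff_raise_pow (n : ℕ) {φ : Fock d R} {i : Mono d}
    (h : ∀ j : Mono d, i.adeg = j.adeg + n → φ.1 j = 0) : ((opSdag ^ n : Op d R) φ).1 i = 0 :=
  (sh_opSdag (a := 0) (b := 1) 0).pow n φ i fun j hj => h j (by
    change lw _ _ _ i = lw _ _ _ j + _ at hj
    rw [← adeg_eq_lw, ← adeg_eq_lw] at hj
    omega)

lemma coeff_lower_pow (n : ℕ) {φ : Fock d R} {i : Mono d}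
    (h : ∀ j : Mono d, j.adeg = i.adeg + n → φ.1 j = 0) :
    ((opSbardag ^ n : Op d R) φ).1 i = 0 :=
  (sh_opSbardag (a := 0) (b := 1) 0).pow n φ i fun j hj => h j (by
    change lw _ _ _ i = lw _ _ _ j + _ at hj
    rw [← adeg_eq_lw, ← adeg_eq_lw] at hj
    omega)

/-- Since the degree in `a†` is bounded, a power of `f` annihilates a state, and a power of `e`
annihilates its terms of nonnegative weight. -/
lemma exists_bound (φ : Fock d R) : ∃ M : ℕ, ∀ N, M ≤ N →
    (opSbardag ^ N : Op d R) φ = 0 ∧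
    ∀ (g : ℤ → ℂ), (∀ c, c < 0 → g c = 0) → ∀ a, N ≤ a + 1 →
      wcalc g ((opSbardag ^ a : Op d R) ((opSdag ^ N : Op d R) φ)) = 0 := by
  obtain ⟨M, hM⟩ := φ.2
  have hf' : ∀ n : ℕ, Sh wdeg (n * (-1 - 1)) (opSbardag ^ n : Op d R) :=
    fun n => (sh_opSbardag (a := -1) (b := 1) 0).pow n
  refine ⟨M + 3, fun N hN => ⟨Fock.ext' fun i => ?_, fun g hg a ha => Fock.ext' fun i => ?_⟩⟩
  · exact coeff_lower_pow N fun j hj => hM j (by omega)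
  · rw [wcalc_apply]
    by_cases hi : wdeg i < 0
    · rw [hg _ hi, zero_smul]; rfl
    · rw [hf' a _ i fun j hj => coeff_raise_pow N fun k hk => hM k ?_, smul_zero]
      · rfl
      · change wdeg i = wdeg j + _ at hj
        have := wdeg_eq j
        omega

/-- The partial sums of `projE0`. -/
def lowSum (N : ℕ) : Op d R :=
  ∑ k ∈ Finset.range (N + 1), wcalc (lowCoef k) * (opSdag ^ k * opSbardag ^ k)

/-- The sum that defines `projE0` may be cut off at any sufficiently high term. -/
lemma projE0_eq (φ : Fock d R) : ∃ M : ℕ, ∀ N, M ≤ N → projE0 φ = lowSum N φ := by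
  obtain ⟨M, hM⟩ := exists_bound φ
  refine ⟨M, fun N hN => Fock.ext' fun i => ?_⟩
  set t : ℕ → R := fun k => lowCoef k (wdeg i) •
    ((opSdag ^ k : Op d R) ((opSbardag ^ k : Op d R) φ)).1 i with ht
  have t1 : ∀ k, i.adeg < k → t k = 0 := fun k hk => by
    rw [ht]
    dsimp only
    rw [coeff_raise_pow k fun j hj => by omega, smul_zero]
  have t2 : ∀ k, N < k → t k = 0 := fun k hk => by
    rw [ht]
    dsimp only
    rw [(hM k (by omega)).1, map_zero, coe_zero', smul_zero]
  have e1 : (lowSum N φ).1 i = ∑ k ∈ Finset.range (N + 1), t k := by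
    rw [lowSum, LinearMap.sum_apply, Submodule.coe_sum, Finset.sum_apply]
    rfl
  have e2 : (projE0 φ).1 i = ∑ k ∈ Finset.range (i.adeg + 1), t k := by
    show (if i.adeg ≤ i.ydeg then _ else _) = _
    have hw := wdeg_eq i
    split_ifs with h
    · refine Finset.sum_congr rfl fun k _ => ?_
      have hc : ((wdeg i : ℤ) : ℂ) = (i.adeg : ℂ) - i.ydeg := by rw [hw]; push_cast; ring
      rw [ht]
      dsimp only
      rw [lowCoef, if_pos (by omega), hc]
    · refine (Finset.sum_eq_zero fun k _ => ?_).symm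
      rw [ht]
      dsimp only
      rw [lowCoef, if_neg (by omega), zero_smul]
  rw [e1, e2]
  rcases le_total N i.adeg with h | h
  · refine (Finset.sum_subset (Finset.range_mono (by omega)) fun k _ hk => t2 k ?_).symm
    simpa using hk
  · refine Finset.sum_subset (Finset.range_mono (by omega)) fun k _ hk => t1 k ?_
    simpa using hk

lemma lower_projE0 (φ : Fock d R) : opSbardag (projE0 φ) = 0 := by
  obtain ⟨M, hM⟩ := projE0_eq φ
  obtain ⟨M', hM'⟩ := exists_bound φ
  rw [hM (max M M') (le_max_left _ _)]
  refine (LinearMap.congr_fun (slTriple.lower_lowProj (max M M')) φ).trans ?_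
  rw [Module.End.mul_apply, Module.End.mul_apply, (hM' _ (by omega)).1, map_zero, map_zero]

lemma projE0_raise (φ : Fock d R) : projE0 (opSdag φ) = 0 := by
  obtain ⟨M, hM⟩ := projE0_eq (opSdag φ)
  obtain ⟨M', hM'⟩ := exists_bound φ
  rw [hM (max M M') (le_max_left _ _)]
  refine (LinearMap.congr_fun (slTriple.lowProj_raise (max M M')) φ).trans ?_
  rw [Module.End.mul_apply, Module.End.mul_apply, (hM' _ (by omega)).1, map_zero, map_zero]

/-- A lowest-weight state has no terms of positive weight. -/
lemma coeff_of_lower {φ : Fock d R} (hφ : opSbardag φ = 0) {i : Mono d} (hi : 0 < wdeg i) :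
    φ.1 i = 0 := by
  obtain ⟨M, hM⟩ := exists_bound φ
  have h := LinearMap.congr_fun (slTriple.posInv_lower (A := Op d R) M) φ
  rw [LinearMap.add_apply, Module.End.mul_apply, Module.End.mul_apply, Module.End.mul_apply, hφ,
    map_zero, (hM _ (by omega)).2 _ (fun c hc => by rw [posCoef, if_neg (by omega)]) _ (Nat.le_succ _),
    add_zero] at h
  have := congrArg (fun ψ : Fock d R => ψ.1 i) h
  simpa [wcalc_apply, hi] using this.symm

/-- A highest-weight state has no terms of negative weight. -/
lemma coeff_of_raise {φ : Fock d R} (hφ : opSdag φ = 0) {i : Mono d} (hi : wdeg i < 0) :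
    φ.1 i = 0 := by
  obtain ⟨M, hM⟩ := exists_bound φ
  have h := LinearMap.congr_fun (slTriple.swap.posInv_lower (A := Op d R) M) φ
  rw [LinearMap.add_apply, Module.End.mul_apply, Module.End.mul_apply, Module.End.mul_apply, hφ,
    map_zero, (hM _ (by omega)).1, map_zero, map_zero, add_zero, negCalc_apply] at h
  have := congrArg (fun ψ : Fock d R => ψ.1 i) h
  simpa [wcalc_apply, hi] using this.symm

/-- All terms of the projector but the first contain `f`, and lowest-weight states have no terms of
positive weight. -/
lemma projE0_of_lower {φ : Fock d R} (hφ : opSbardag φ = 0) : projE0 φ = φ := by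
  obtain ⟨M, hM⟩ := projE0_eq φ
  rw [hM M le_rfl, lowSum, SlTriple.lowProj_eq_lower, LinearMap.add_apply, Module.End.mul_apply, hφ, map_zero,
    add_zero]
  refine Fock.ext' fun i => ?_
  rw [wcalc_apply, lowCoef_zero]
  split_ifs with h
  · exact one_smul ℂ _
  · rw [coeff_of_lower hφ (not_le.1 h), smul_zero]

variable {η : Fin d → ℝ}

variable (R η) in
/-- The space `hatE0` with coefficients in `R`. -/
def hatZ : Submodule ℂ (Fock d R) := hatS R η ⊓ LinearMap.ker (dod (gBdag d))

lemma mem_hatZ {φ : Fock d R} : φ ∈ hatZ R η ↔ φ ∈ hatS R η ∧ dod (gBdag d) φ = 0 := Iff.rfl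

lemma hatZ_opSdag {φ : Fock d R} (hφ : φ ∈ hatZ R η) : opSdag φ ∈ hatZ R η :=
  ⟨hatS_opSdag hφ.1, by
    refine LinearMap.mem_ker.2 ?_
    rw [apply_comm (Bos.opSdag _).2, LinearMap.mem_ker.1 hφ.2, map_zero]⟩

lemma hatZ_opSbardag {φ : Fock d R} (hφ : φ ∈ hatZ R η) : opSbardag φ ∈ hatZ R η :=
  ⟨hatS_opSbardag hφ.1, by
    refine LinearMap.mem_ker.2 ?_
    rw [apply_comm (Bos.opSbardag _).2, LinearMap.mem_ker.1 hφ.2, map_zero]⟩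

lemma hatS_wcalc (g : ℤ → ℂ) {φ : Fock d R} (hφ : φ ∈ hatS R η) : wcalc g φ ∈ hatS R η := by
  have := hatS_diag (fun a b => g (b - a)) hφ
  have e : ∀ i : Mono d, lw 0 (fun _ => 1) 0 i - lw (fun _ => 1) 0 0 i = wdeg i := fun i => by
    simp [wdeg, lw, neg_add_eq_sub]
  simp only [e] at this
  exact this

lemma wcalc_dod (g : ℤ → ℂ) (x : OddVar d) : dod x * wcalc g = (wcalc g * dod x : Op d R) :=
  (Rel.diag_mul (sh_dod (-1) 1 0 x) fun i j hij => by
    change wdeg i = wdeg j + _ at hij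
    exact congrArg g (by rw [hij]; simp)).symm

lemma hatZ_wcalc (g : ℤ → ℂ) {φ : Fock d R} (hφ : φ ∈ hatZ R η) : wcalc g φ ∈ hatZ R η :=
  ⟨hatS_wcalc g hφ.1, by
    refine LinearMap.mem_ker.2 ?_
    rw [apply_comm (wcalc_dod g _), LinearMap.mem_ker.1 hφ.2, map_zero]⟩

lemma hatZ_opSdag_pow (n : ℕ) {φ : Fock d R} (hφ : φ ∈ hatZ R η) :
    (opSdag ^ n : Op d R) φ ∈ hatZ R η := by
  induction n with
  | zero => exact hφ
  | succ n ih => rw [pow_succ', Module.End.mul_apply]; exact hatZ_opSdag ih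

lemma hatZ_opSbardag_pow (n : ℕ) {φ : Fock d R} (hφ : φ ∈ hatZ R η) :
    (opSbardag ^ n : Op d R) φ ∈ hatZ R η := by
  induction n with
  | zero => exact hφ
  | succ n ih => rw [pow_succ', Module.End.mul_apply]; exact hatZ_opSbardag ih

/-- Sums of the kind that occur in the projectors preserve the traceless states. -/
lemma hatZ_sum_raise (s : Finset ℕ) (g : ℕ → ℤ → ℂ) (a b : ℕ → ℕ) {φ : Fock d R}
    (hφ : φ ∈ hatZ R η) :
    (∑ k ∈ s, wcalc (g k) * (opSdag ^ a k * opSbardag ^ b k) : Op d R) φ ∈ hatZ R η := by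
  rw [LinearMap.sum_apply]
  exact Submodule.sum_mem _ fun k _ =>
    hatZ_wcalc _ (hatZ_opSdag_pow _ (hatZ_opSbardag_pow _ hφ))

lemma hatZ_sum_lower (s : Finset ℕ) (g : ℕ → ℤ → ℂ) (a b : ℕ → ℕ) {φ : Fock d R}
    (hφ : φ ∈ hatZ R η) :
    (∑ k ∈ s, wcalc (g k) * (opSbardag ^ a k * opSdag ^ b k) : Op d R) φ ∈ hatZ R η := by
  rw [LinearMap.sum_apply]
  exact Submodule.sum_mem _ fun k _ =>
    hatZ_wcalc _ (hatZ_opSbardag_pow _ (hatZ_opSdag_pow _ hφ))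

lemma hatZ_projE0 {φ : Fock d R} (hφ : φ ∈ hatZ R η) : projE0 φ ∈ hatZ R η := by
  obtain ⟨M, hM⟩ := projE0_eq φ
  rw [hM M le_rfl]
  exact hatZ_sum_raise _ _ _ _ hφ

/-- Every state is the sum of its projection to the lowest-weight states and of a state in the
image of `e`. -/
lemma sub_projE0 {φ : Fock d R} (hφ : φ ∈ hatZ R η) : ∃ ψ ∈ hatZ R η, φ - projE0 φ = opSdag ψ := by
  obtain ⟨M, hM⟩ := projE0_eq φ
  obtain ⟨M', hM'⟩ := exists_bound φ
  set N := max M M'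
  have h1 := LinearMap.congr_fun (slTriple.lowProj_eq_raise (A := Op d R) N) φ
  have h2 := LinearMap.congr_fun (slTriple.raise_posInv (A := Op d R) N) φ
  rw [LinearMap.add_apply, Module.End.mul_apply] at h1 h2
  rw [Module.End.mul_apply (wcalc _), Module.End.mul_apply (_ ^ _), (hM' _ (by omega)).2 _
    (fun c hc => by rw [posCoef, if_neg (by omega)]) _ (Nat.le_succ _), add_zero] at h2
  refine ⟨_, Submodule.sub_mem _ (hatZ_sum_lower (Finset.range (N + 1))
    (fun k c => posCoef k (c + 2)) (· + 1) (·) hφ) (hatZ_sum_raise (Finset.range N)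
      (fun k c => lowCoef (k + 1) (c + 2)) (·) (· + 1) hφ), ?_⟩
  rw [map_sub, h2, hM N (le_max_left _ _), lowSum, h1, ← sub_sub]
  congr 1
  refine Fock.ext' fun i => ?_
  rw [coe_sub', wcalc_apply, wcalc_apply, lowCoef_zero]
  by_cases h : wdeg i ≤ 0 <;> simp [h]

/-- Every state is the sum of a highest-weight state and of a state in the image of `f`. -/
lemma highest_decomp {χ : Fock d R} (hχ : χ ∈ hatZ R η) :
    ∃ l ∈ hatZ R η, ∃ ψ ∈ hatZ R η, opSdag l = 0 ∧ χ = l + opSbardag ψ := by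
  obtain ⟨N, hN⟩ := exists_bound χ
  have S := (slTriple (d := d) (R := R)).swap
  have h0 := LinearMap.congr_fun (S.lower_lowProj N) χ
  have h1 := LinearMap.congr_fun (S.lowProj_eq_raise N) χ
  have h2 := LinearMap.congr_fun (S.raise_posInv N) χ
  simp only [negCalc_apply] at h0 h1 h2
  rw [LinearMap.add_apply, Module.End.mul_apply] at h1 h2
  rw [Module.End.mul_apply (wcalc _), Module.End.mul_apply (_ ^ _), (hN _ (by omega)).1, map_zero,
    map_zero, add_zero] at h2
  rw [Module.End.mul_apply, Module.End.mul_apply (wcalc _), Module.End.mul_apply (_ ^ _),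
    (hN _ (by omega)).2 _ (fun c hc => by rw [lowCoef, if_neg (by omega)]) _ le_rfl] at h0
  refine ⟨_, hatZ_sum_lower (Finset.range (N + 1)) (fun k c => lowCoef k (-c)) _ _ hχ, _,
    Submodule.sub_mem _ (hatZ_sum_raise (Finset.range (N + 1))
    (fun k c => posCoef k (-c + 2)) (· + 1) (·) hχ) (hatZ_sum_lower (Finset.range N)
      (fun k c => lowCoef (k + 1) (-c + 2)) (·) (· + 1) hχ), h0, ?_⟩
  rw [map_sub, h2, h1, add_add_sub_cancel]
  refine Fock.ext' fun i => ?_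
  rw [coe_add', wcalc_apply, wcalc_apply, lowCoef_zero]
  by_cases h : wdeg i < 0 <;> simp [h]

/-- Highest-weight states in the image of `f` vanish. -/
lemma lower_eq_zero {ψ : Fock d R} (h : opSdag (opSbardag ψ) = 0) : opSbardag ψ = 0 := by
  obtain ⟨N, hN⟩ := exists_bound ψ
  have S := (slTriple (d := d) (R := R)).swap
  have h0 := LinearMap.congr_fun (S.lowProj_raise N) ψ
  simp only [negCalc_apply] at h0
  rw [Module.End.mul_apply, Module.End.mul_apply (wcalc _), Module.End.mul_apply (_ ^ _)] at h0
  rw [(hN _ le_rfl).2 _ (fun c hc => by rw [lowCoef, if_neg (by omega)]) _ (by omega)] at h0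
  have h1 := LinearMap.congr_fun (SlTriple.lowProj_eq_lower (D := negCalc (wcalc (d := d) (R := R)))
    (e := opSbardag) (f := opSdag) N) (opSbardag ψ)
  rw [LinearMap.add_apply, Module.End.mul_apply _ opSdag, h, map_zero, add_zero] at h1
  have h2 := h1.symm.trans h0
  refine Fock.ext' fun i => ?_
  by_cases hi : wdeg i < 0
  · exact coeff_of_raise h hi
  · have h3 := congrArg (fun χ : Fock d R => χ.1 i) h2
    simpa [negCalc_apply, wcalc_apply, lowCoef_zero, not_lt.1 hi] using h3

/-- A lowest-weight state without terms of weight `0` is in the image of `f`. -/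
lemma exists_lower {φ : Fock d R} (hφ : φ ∈ hatZ R η)
    (h : ∀ i, 0 ≤ wdeg i → φ.1 i = 0) : ∃ ψ ∈ hatZ R η, φ = opSbardag ψ := by
  obtain ⟨N, hN⟩ := exists_bound φ
  have h2 := LinearMap.congr_fun ((slTriple (d := d) (R := R)).swap.raise_posInv N) φ
  simp only [negCalc_apply] at h2
  rw [LinearMap.add_apply, Module.End.mul_apply, Module.End.mul_apply (wcalc _),
    Module.End.mul_apply (_ ^ _), (hN _ (by omega)).1, map_zero, map_zero, add_zero] at h2
  refine ⟨_, hatZ_sum_raise (Finset.range (N + 1)) (fun k c => posCoef k (-c + 2)) (· + 1) (·) hφ, ?_⟩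
  rw [h2]
  refine Fock.ext' fun i => ?_
  rw [wcalc_apply]
  by_cases hi : wdeg i < 0
  · simp [hi]
  · simp [h i (not_lt.1 hi)]

/-! The terms of weight `0`. -/

lemma projRect_eq : (projRect : Op d R) = wcalc fun c => if c = 0 then 1 else 0 := by
  ext φ : 1
  refine Fock.ext' fun i => ?_
  rw [wcalc_apply]
  show (if i.adeg = i.ydeg then (1 : ℂ) else 0) • φ.1 i = _
  have := wdeg_eq i
  by_cases h : i.adeg = i.ydeg
  · rw [if_pos h, if_pos (by omega)]
  · rw [if_neg h, if_neg (by omega)]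

lemma lower_projRect {φ : Fock d R} (hφ : opSbardag φ = 0) : opSbardag (projRect φ) = 0 := by
  have := LinearMap.congr_fun ((slTriple (d := d) (R := R)).lower fun c => if c = 0 then 1 else 0) φ
  rw [Module.End.mul_apply, Module.End.mul_apply, hφ, map_zero] at this
  rw [projRect_eq, this]

/-- Lowest-weight states of weight `0` are invariant. -/
lemma raise_projRect {φ : Fock d R} (hφ : opSbardag φ = 0) : opSdag (projRect φ) = 0 := by
  have h1 := LinearMap.congr_fun
    ((slTriple (d := d) (R := R)).raise fun c => if c = 0 then 1 else 0) φ
  have h2 := LinearMap.congr_fun (slTriple (d := d) (R := R)).bracket (projRect φ)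
  rw [LinearMap.add_apply, Module.End.mul_apply, Module.End.mul_apply, lower_projRect hφ, map_zero]
    at h2
  have h3 : wcalc (fun c => (c : ℂ)) (projRect φ) = 0 := Fock.ext' fun i => by
    rw [projRect_eq, wcalc_apply, wcalc_apply]
    by_cases h : wdeg i = 0 <;> simp [h, coe_zero']
  rw [h3, add_zero] at h2
  rw [Module.End.mul_apply, Module.End.mul_apply, ← projRect_eq] at h1
  refine Fock.ext' fun i => ?_
  by_cases hi : 0 < wdeg i
  · exact coeff_of_lower h2.symm hi
  · rw [h1, wcalc_apply, if_neg (by omega), zero_smul, coe_zero']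

lemma projRect_of_invariant {φ : Fock d R} (h1 : opSbardag φ = 0) (h2 : opSdag φ = 0) :
    projRect φ = φ := by
  refine Fock.ext' fun i => ?_
  rw [projRect_eq, wcalc_apply]
  by_cases h : wdeg i = 0
  · simp [h]
  · rcases lt_or_gt_of_ne h with h' | h'
    · rw [coeff_of_raise h2 h', smul_zero]
    · rw [coeff_of_lower h1 h', smul_zero]

lemma hatZ_projRect {φ : Fock d R} (hφ : φ ∈ hatZ R η) : projRect φ ∈ hatZ R η := by
  rw [projRect_eq]
  exact hatZ_wcalc _ hφ

end Weights

/-! ### The expansion of traceless states in `b†` -/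

section Expansion

variable {d : ℕ} {R : Type} [AddCommGroup R] [Module ℂ R] {η : Fin d → ℝ}

lemma mo_mo_self (g : OddVar d) (φ : Fock d R) : mo g (mo g φ) = 0 :=
  LinearMap.congr_fun (mo_sq (R := R) g) φ

lemma dod_dod_self (g : OddVar d) (φ : Fock d R) : dod g (dod g φ) = 0 :=
  LinearMap.congr_fun (dod_sq (R := R) g) φ

lemma dod_mo_apply (g : OddVar d) (φ : Fock d R) : dod g (mo g φ) = φ - mo g (dod g φ) :=
  LinearMap.congr_fun (dod_mo_self (R := R) g) φ

lemma dod_add_mo {g : OddVar d} {φ ψ : Fock d R} (hφ : dod g φ = 0) (hψ : dod g ψ = 0) :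
    dod g (φ + mo g ψ) = ψ := by
  rw [map_add, hφ, dod_mo_apply, hψ, map_zero, sub_zero, zero_add]

lemma dod_mo_add_mo {g : OddVar d} {φ ψ : Fock d R} (hφ : dod g φ = 0) :
    dod g (mo g (φ + mo g ψ)) = φ := by
  rw [map_add, mo_mo_self, add_zero, dod_mo_apply, hφ, map_zero, sub_zero]

lemma odd_expansion (g : OddVar d) (φ : Fock d R) : dod g (mo g φ) + mo g (dod g φ) = φ := by
  rw [dod_mo_apply, sub_add_cancel]

lemma hatZ_dod {φ : Fock d R} (hφ : φ ∈ hatS R η) : dod (gBdag d) φ ∈ hatZ R η :=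
  mem_hatZ.2 ⟨hatS_dod_bdag hφ, dod_dod_self _ _⟩

lemma hatZ_dod_mo {φ : Fock d R} (hφ : φ ∈ hatS R η) : dod (gBdag d) (mo (gBdag d) φ) ∈ hatZ R η :=
  hatZ_dod (hatS_mo_bdag hφ)

lemma anti_sig {g : OddVar d} : (mo g : Op d R) * sig = -(sig * mo g) := by
  rw [sig_eq, op_mul_neg, op_neg_mul, Finset.mul_sum, Finset.sum_mul, neg_inj,
    ← Finset.sum_neg_distrib]
  refine Finset.sum_congr rfl fun μ _ => ?_
  rw [← mul_assoc, mo_mo, op_neg_mul, mul_assoc, mo_dy, mul_assoc]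

lemma dod_anti_sig : (dod (gBdag d) : Op d R) * sig = -(sig * dod (gBdag d)) := by
  rw [sig_eq, op_mul_neg, op_neg_mul, Finset.mul_sum, Finset.sum_mul, neg_inj,
    ← Finset.sum_neg_distrib]
  refine Finset.sum_congr rfl fun μ _ => ?_
  rw [← mul_assoc, dod_mo _ _ (gneC μ).2.2.2, op_neg_mul, mul_assoc, dod_dy, mul_assoc]

lemma dod_anti_sigbar : (dod (gBdag d) : Op d R) * sigbar = -(sigbar * dod (gBdag d)) := by
  rw [sigbar_eq, op_mul_neg, op_neg_mul, Finset.mul_sum, Finset.sum_mul, neg_inj,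
    ← Finset.sum_neg_distrib]
  refine Finset.sum_congr rfl fun μ _ => ?_
  rw [← mul_assoc, dod_mo _ _ (gneC μ).2.2.2, op_neg_mul, mul_assoc, dod_da, mul_assoc]

lemma hatZ_sig {φ : Fock d R} (hφ : φ ∈ hatZ R η) : sig φ ∈ hatZ R η :=
  mem_hatZ.2 ⟨hatS_sig hφ.1, by rw [apply_anti dod_anti_sig, (mem_hatZ.1 hφ).2, map_zero, neg_zero]⟩

lemma hatZ_sigbar {φ : Fock d R} (hφ : φ ∈ hatZ R η) : sigbar φ ∈ hatZ R η :=
  mem_hatZ.2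
    ⟨hatS_sigbar hφ.1, by rw [apply_anti dod_anti_sigbar, (mem_hatZ.1 hφ).2, map_zero, neg_zero]⟩

lemma hatZ_coeffMap {R' : Type} [AddCommGroup R'] [Module ℂ R'] (l : R →ₗ[ℂ] R') {φ : Fock d R}
    (hφ : φ ∈ hatZ R η) : coeffMap l φ ∈ hatZ R' η :=
  mem_hatZ.2 ⟨hatS_coeffMap l hφ.1, by
    rw [← Intertw.dod l _ φ, (mem_hatZ.1 hφ).2, map_zero]⟩

/-- `σ σ = 0`. -/
lemma sig_sq : (sig : Op d R) * sig = 0 := by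
  have h : (sig : Op d R) * sig = -(sig * sig) := by
    rw [sig_eq, op_neg_mul_neg, Finset.sum_mul]
    simp only [Finset.mul_sum]
    conv_rhs => rw [Finset.sum_comm]
    simp only [← Finset.sum_neg_distrib]
    refine Finset.sum_congr rfl fun μ _ => Finset.sum_congr rfl fun ν _ => ?_
    exact KoszulFactor.anti_mul (mo_mo _ _) (mo_dy _ _) (mo_dy _ _) (dy_dy _ _)
  have h2 : (2 : ℂ) • ((sig : Op d R) * sig) = 0 := by
    rw [two_smul]; nth_rewrite 1 [h]; exact neg_add_cancel _
  exact (smul_eq_zero.1 h2).resolve_left two_ne_zero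

/-! ### The subspaces in terms of the expansion -/

lemma mem_spE0 {φ : State d} : φ ∈ spE0 η ↔ φ ∈ hatZ ℂ η ∧ opSbardag φ = 0 := Iff.rfl

lemma mem_spL1 {φ : State d} : φ ∈ spL1 η ↔ φ ∈ hatZ ℂ η ∧ opSdag φ = 0 := Iff.rfl

lemma mem_spE {φ : State d} : φ ∈ spE η ↔ φ ∈ hatS ℂ η ∧
    opSbardag (dod (gBdag d) (mo (gBdag d) φ)) = 0 ∧ opSdag (dod (gBdag d) φ) = 0 := by
  constructor
  · intro h
    obtain ⟨a, ha, -, ⟨l, hl, rfl⟩, rfl⟩ := Submodule.mem_sup.1 h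
    rw [mem_spE0] at ha
    rw [SetLike.mem_coe, mem_spL1] at hl
    rw [dod_add_mo ha.1.2 hl.1.2, dod_mo_add_mo ha.1.2]
    exact ⟨add_mem ha.1.1 (hatS_mo_bdag hl.1.1), ha.2, hl.2⟩
  · rintro ⟨h, h1, h2⟩
    rw [← odd_expansion (gBdag d) φ]
    exact Submodule.add_mem_sup (mem_spE0.2 ⟨hatZ_dod_mo h, h1⟩)
      ⟨_, mem_spL1.2 ⟨hatZ_dod h, h2⟩, rfl⟩

lemma mem_spF {φ : State d} :
    φ ∈ spF η ↔ ∃ ψ ∈ hatZ ℂ η, mo (gBdag d) (opSbardag ψ) = φ := by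
  constructor
  · rintro ⟨Φ, hΦ, rfl⟩
    refine ⟨_, hatZ_dod_mo hΦ, ?_⟩
    conv_rhs => rw [← odd_expansion (gBdag d) Φ, map_add, LinearMap.comp_apply,
      LinearMap.comp_apply, ← apply_comm (Bos.opSbardag _).1 (dod _ _), mo_mo_self, add_zero]
  · rintro ⟨ψ, hψ, rfl⟩
    exact ⟨ψ, hψ.1, rfl⟩

lemma mem_spG_iff_raise {φ : State d} : φ ∈ spG η ↔ ∃ ψ ∈ hatZ ℂ η, opSdag ψ = φ := by
  constructor
  · rintro ⟨Φ, hΦ, rfl⟩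
    exact ⟨_, hatZ_dod hΦ, rfl⟩
  · rintro ⟨ψ, hψ, rfl⟩
    refine ⟨mo (gBdag d) ψ, hatS_mo_bdag hψ.1, ?_⟩
    rw [SdagDb, LinearMap.comp_apply, dod_mo_apply, (mem_hatZ.1 hψ).2, map_zero, sub_zero]

/-- The image of `e` in the traceless states without `b†` is the kernel of `projE0`. -/
lemma exists_raise_iff {φ : Fock d R} :
    (∃ ψ ∈ hatZ R η, opSdag ψ = φ) ↔ φ ∈ hatZ R η ∧ projE0 φ = 0 := by
  constructor
  · rintro ⟨ψ, hψ, rfl⟩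
    exact ⟨hatZ_opSdag hψ, projE0_raise ψ⟩
  · rintro ⟨h, h0⟩
    obtain ⟨ψ, hψ, e⟩ := sub_projE0 h
    exact ⟨ψ, hψ, by rw [← e, h0, sub_zero]⟩

lemma mem_spG {φ : State d} : φ ∈ spG η ↔ φ ∈ hatZ ℂ η ∧ projE0 φ = 0 :=
  mem_spG_iff_raise.trans exists_raise_iff

/-- The space `E` represents the cohomology of `S† ∂/∂b†`. -/
lemma spE_sup_spG : spE η ⊔ spG η = hatE η ⊓ LinearMap.ker SdagDb := by
  refine le_antisymm (sup_le (fun φ h => ?_) fun φ h => ?_) fun φ h => ?_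
  · obtain ⟨h1, -, h2⟩ := mem_spE.1 h
    exact ⟨h1, h2⟩
  · obtain ⟨h1, -⟩ := mem_spG.1 h
    refine ⟨h1.1, ?_⟩
    show opSdag (dod (gBdag d) φ) = 0
    rw [(mem_hatZ.1 h1).2, map_zero]
  · obtain ⟨h1 : φ ∈ hatS ℂ η, h2 : opSdag (dod (gBdag d) φ) = 0⟩ := h
    have hZ := hatZ_dod_mo h1
    have e : φ = (projE0 (dod (gBdag d) (mo (gBdag d) φ)) + mo (gBdag d) (dod (gBdag d) φ)) +
        (dod (gBdag d) (mo (gBdag d) φ) - projE0 (dod (gBdag d) (mo (gBdag d) φ))) := by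
      conv_lhs => rw [← odd_expansion (gBdag d) φ]
      abel
    rw [e]
    refine Submodule.add_mem_sup (Submodule.add_mem_sup
      (mem_spE0.2 ⟨hatZ_projE0 hZ, lower_projE0 _⟩) ⟨_, mem_spL1.2 ⟨hatZ_dod h1, h2⟩, rfl⟩)
      (mem_spG_iff_raise.2 ?_)
    obtain ⟨ψ, hψ, e⟩ := sub_projE0 hZ
    exact ⟨ψ, hψ, e.symm⟩

/-! ### Their sections -/

lemma secs_hatZ (φ : Sec d) : (∀ x, evalAt x φ ∈ hatZ ℂ η) ↔ φ ∈ hatZ (Fld d) η := by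
  rw [mem_hatZ, ← secs_hatE, mem_secs, sec_ker fun x => Intertw.dod (evFld x) _, ← forall_and]
  rfl

lemma mem_secs_hatE0 {φ : Sec d} : φ ∈ secs (hatE0 η) ↔ φ ∈ hatZ (Fld d) η := by
  rw [mem_secs, ← secs_hatZ]
  rfl

lemma mem_secs_spE0 {φ : Sec d} : φ ∈ secs (spE0 η) ↔ φ ∈ hatZ (Fld d) η ∧ opSbardag φ = 0 := by
  rw [mem_secs, ← secs_hatZ, sec_ker fun x => Intertw.opSbardag (evFld x), ← forall_and]
  rfl

lemma mem_secs_spL1 {φ : Sec d} : φ ∈ secs (spL1 η) ↔ φ ∈ hatZ (Fld d) η ∧ opSdag φ = 0 := by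
  rw [mem_secs, ← secs_hatZ, sec_ker fun x => Intertw.opSdag (evFld x), ← forall_and]
  rfl

lemma mem_secs_spE {φ : Sec d} : φ ∈ secs (spE η) ↔ φ ∈ hatS (Fld d) η ∧
    opSbardag (dod (gBdag d) (mo (gBdag d) φ)) = 0 ∧ opSdag (dod (gBdag d) φ) = 0 := by
  have h1 : opSbardag (dod (gBdag d) (mo (gBdag d) φ)) = 0 ↔ ∀ x,
      opSbardag (dod (gBdag d) (mo (gBdag d) (evalAt x φ : State d))) = 0 :=
    sec_ker (A' := opSbardag * (dod (gBdag d) * mo (gBdag d)))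
      (A := opSbardag * (dod (gBdag d) * mo (gBdag d)))
      fun x => (Intertw.opSbardag (evFld x)).mul ((Intertw.dod _ _).mul (Intertw.mo _ _))
  have h2 : opSdag (dod (gBdag d) φ) = 0 ↔ ∀ x,
      opSdag (dod (gBdag d) (evalAt x φ : State d)) = 0 :=
    sec_ker (A' := opSdag * dod (gBdag d)) (A := opSdag * dod (gBdag d))
      fun x => (Intertw.opSdag (evFld x)).mul (Intertw.dod _ _)
  rw [h1, h2, ← secs_hatE, mem_secs, mem_secs, ← forall_and, ← forall_and]
  exact forall_congr' fun x => mem_spE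

lemma mem_secs_spG {φ : Sec d} : φ ∈ secs (spG η) ↔ φ ∈ hatZ (Fld d) η ∧ projE0 φ = 0 := by
  rw [mem_secs, ← secs_hatZ, sec_ker fun x => Intertw.projE0 (evFld x), ← forall_and]
  exact forall_congr' fun x => mem_spG

/-- A section with values in the image of `f` is the image of a section: by the decomposition into
highest-weight states and the image of `f`, which is natural in the coefficients. -/
lemma mem_secs_spF {φ : Sec d} :
    φ ∈ secs (spF η) ↔ ∃ ψ ∈ hatZ (Fld d) η, mo (gBdag d) (opSbardag ψ) = φ := by
  constructor
  · intro h
    rw [mem_secs] at h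
    simp only [mem_spF] at h
    have hS : φ ∈ hatS (Fld d) η := by
      rw [← secs_hatE, mem_secs]
      intro x
      obtain ⟨ψ, hψ, e⟩ := h x
      rw [← e]
      exact hatS_mo_bdag (hatZ_opSbardag hψ).1
    have hm : mo (gBdag d) φ = 0 := (sec_ker fun x => Intertw.mo (evFld x) _).2 fun x => by
      obtain ⟨ψ, hψ, e⟩ := h x
      rw [← e, mo_mo_self]
    obtain ⟨l, hl, ψ, hψ, hl0, e⟩ := highest_decomp (hatZ_dod hS)
    have hφ : φ = mo (gBdag d) (dod (gBdag d) φ) := by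
      conv_lhs => rw [← odd_expansion (gBdag d) φ, hm, map_zero, zero_add]
    have : l = 0 := sec_eq_zero fun x => by
      obtain ⟨χ, hχ, ex⟩ := h x
      have e1 : evalAt x (dod (gBdag d) φ) = opSbardag χ := by
        rw [evalAt, Intertw.dod (evFld x), ← evalAt, ← ex, dod_mo_apply,
          (mem_hatZ.1 (hatZ_opSbardag hχ)).2, map_zero, sub_zero]
      have e2 : evalAt x l = opSbardag (χ - evalAt x ψ) := by
        rw [map_sub, ← e1, evalAt, ← Intertw.opSbardag (evFld x), e, map_add, add_sub_cancel_right]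
      rw [e2]
      refine lower_eq_zero ?_
      rw [← e2, evalAt, ← Intertw.opSdag (evFld x), hl0, map_zero]
    rw [this, zero_add] at e
    exact ⟨ψ, hψ, by rw [← e, ← hφ]⟩
  · rintro ⟨ψ, hψ, rfl⟩
    rw [mem_secs]
    intro x
    refine mem_spF.2 ⟨evalAt x ψ, hatZ_coeffMap _ hψ, ?_⟩
    rw [evalAt, Intertw.mo (evFld x), Intertw.opSbardag (evFld x)]

lemma mem_secs_spG_iff_raise {φ : Sec d} :
    φ ∈ secs (spG η) ↔ ∃ ψ ∈ hatZ (Fld d) η, opSdag ψ = φ :=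
  mem_secs_spG.trans exists_raise_iff.symm

end Expansion

/-! ### The total differential -/

section Differential

variable {d : ℕ} {η : Fin d → ℝ}

lemma dTot_comm {A : Op d (Fld d)} (hA : ∀ μ, Intertw (dxFld μ) A A)
    (hC : ∀ μ, mo (gC μ) * A = A * mo (gC μ)) (φ : Sec d) : dTot (A φ) = A (dTot φ) := by
  rw [dTot_eq, LinearMap.sum_apply, LinearMap.sum_apply, map_sum]
  refine Finset.sum_congr rfl fun μ _ => ?_
  rw [Module.End.mul_apply, Module.End.mul_apply, dx, hA, apply_comm (hC μ)]

lemma dTot_anti {A : Op d (Fld d)} (hA : ∀ μ, Intertw (dxFld μ) A A)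
    (hC : ∀ μ, mo (gC μ) * A = -(A * mo (gC μ))) (φ : Sec d) : dTot (A φ) = -A (dTot φ) := by
  rw [dTot_eq, LinearMap.sum_apply, LinearMap.sum_apply, map_sum, ← Finset.sum_neg_distrib]
  refine Finset.sum_congr rfl fun μ _ => ?_
  rw [Module.End.mul_apply, Module.End.mul_apply, dx, hA, apply_anti (hC μ)]

lemma dTot_opSdag (φ : Sec d) : dTot (opSdag φ) = opSdag (dTot φ) :=
  dTot_comm (fun _ => Intertw.opSdag _) (fun μ => (Bos.opSdag (gC μ)).1.eq) φ

lemma dTot_opSbardag (φ : Sec d) : dTot (opSbardag φ) = opSbardag (dTot φ) :=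
  dTot_comm (fun _ => Intertw.opSbardag _) (fun μ => (Bos.opSbardag (gC μ)).1.eq) φ

lemma dTot_mo (g : OddVar d) (φ : Sec d) : dTot (mo g φ) = -mo g (dTot φ) :=
  dTot_anti (fun _ => Intertw.mo _ _) (fun _ => mo_mo _ _) φ

lemma dTot_dod (φ : Sec d) : dTot (dod (gBdag d) φ) = -dod (gBdag d) (dTot φ) :=
  dTot_anti (fun _ => Intertw.dod _ _) (fun μ => by
    rw [dod_mo _ _ (gneC μ).2.2.2, neg_neg]) φ

lemma hatZ_dTot {φ : Sec d} (hφ : φ ∈ hatZ (Fld d) η) : dTot φ ∈ hatZ (Fld d) η := by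
  refine mem_hatZ.2 ⟨hatS_dTot η hφ.1, ?_⟩
  rw [← neg_eq_zero, ← dTot_dod, (mem_hatZ.1 hφ).2, map_zero]

end Differential

/-! ### The unfolding of the curvatures -/

section Unfolding

variable {d : ℕ} {R : Type} [AddCommGroup R] [Module ℂ R] {η : Fin d → ℝ}

/-- For a lowest-weight state `φ` this is the solution `ω` of `e ω = (1 - Π) σ φ` in the image of
`f`, where `Π` is the projector on the lowest-weight states. -/
def omegaSol (φ : Fock d R) : Fock d R := sigbar (wcalc (fun c => ((c : ℂ) - 1)⁻¹) φ)

variable {φ : Fock d R}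

lemma lower_wcalc (g : ℤ → ℂ) (h : opSbardag φ = 0) : opSbardag (wcalc g φ) = 0 := by
  have := LinearMap.congr_fun ((slTriple (d := d) (R := R)).lower g) φ
  rw [Module.End.mul_apply, Module.End.mul_apply, h, map_zero] at this
  exact this

lemma lower_sig (h : opSbardag φ = 0) : opSbardag (sig φ) = -sigbar φ := by
  have := LinearMap.congr_fun (opSbardag_sig (R := R)) φ
  rw [Module.End.mul_apply, LinearMap.sub_apply, Module.End.mul_apply, h, map_zero, zero_sub] at this
  exact this

lemma omegaSol_eq_lower (h : opSbardag φ = 0) :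
    omegaSol φ = opSbardag (-sig (wcalc (fun c => ((c : ℂ) - 1)⁻¹) φ)) := by
  rw [map_neg, lower_sig (lower_wcalc _ h), neg_neg, omegaSol]

/-- Both `σ φ - e ω` and `Π σ φ` are lowest-weight states, and they agree modulo the image of `e`. -/
lemma raise_omegaSol (h : opSbardag φ = 0) :
    opSdag (omegaSol φ) = sig φ - projE0 (sig φ) := by
  set χ := wcalc (fun c => ((c : ℂ) - 1)⁻¹) φ with hχ
  have hf : opSbardag (omegaSol φ) = 0 := by
    rw [omegaSol, apply_comm opSbardag_sigbar, lower_wcalc _ h, map_zero]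
  -- `σ̄` lowers the weight by one.
  have hw : wcalc (fun c => (c : ℂ)) (sigbar χ) = sigbar (wcalc (fun c => (c : ℂ) - 1) χ) := by
    refine LinearMap.congr_fun (Rel.diag_mul (sh_sigbar (a := -1) (b := 1) 0 (by simp))
      fun i j hij => ?_) χ
    change wdeg i = wdeg j + _ at hij
    rw [hij]
    push_cast
    ring
  have hz : wcalc (fun c => (c : ℂ) - 1) χ = φ := by
    refine Fock.ext' fun i => ?_
    rw [hχ, wcalc_apply, wcalc_apply, smul_smul]
    by_cases hi : 0 < wdeg i
    · rw [coeff_of_lower h hi, smul_zero]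
    · have : ((wdeg i : ℤ) : ℂ) - 1 ≠ 0 := by
        have : wdeg i - 1 ≠ 0 := by omega
        exact_mod_cast this
      rw [mul_inv_cancel₀ this, one_smul]
  have hfe : opSbardag (opSdag (omegaSol φ)) = -sigbar φ := by
    have := LinearMap.congr_fun (slTriple (d := d) (R := R)).bracket (omegaSol φ)
    rw [LinearMap.add_apply, Module.End.mul_apply, Module.End.mul_apply, hf, map_zero] at this
    rw [omegaSol, hw, hz] at this
    rw [← eq_neg_iff_add_eq_zero.2 this.symm, omegaSol]
  have h0 : opSbardag (sig φ - opSdag (omegaSol φ)) = 0 := by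
    rw [map_sub, lower_sig h, hfe, sub_self]
  have h1 := projE0_of_lower h0
  rw [map_sub, projE0_raise, sub_zero] at h1
  rw [h1, sub_sub_cancel]

lemma hatZ_omegaSol (hφ : φ ∈ hatZ R η) : omegaSol φ ∈ hatZ R η :=
  hatZ_sigbar (hatZ_wcalc _ hφ)

/-- Up to the image of `f`, `σ ω` is `-σ σ̄` of the rectangular part. -/
lemma sig_omegaSol (hφ : φ ∈ hatZ R η) (h : opSbardag φ = 0) :
    ∃ ψ ∈ hatZ R η, sig (omegaSol φ) = -sig (sigbar (projRect φ)) + opSbardag ψ := by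
  obtain ⟨ψ, hψ, e⟩ := exists_lower (R := R) (η := η)
    (φ := wcalc ((fun c : ℤ => ((c : ℂ) - 1)⁻¹) + fun c : ℤ => if c = 0 then (1 : ℂ) else 0) φ)
    (hatZ_wcalc _ hφ) fun i hi => by
      rw [wcalc_apply]
      rcases hi.lt_or_eq with hi | hi
      · rw [coeff_of_lower h hi, smul_zero]
      · rw [← hi, Pi.add_apply]
        simp
  refine ⟨sig (sigbar ψ), hatZ_sig (hatZ_sigbar hψ), ?_⟩
  have h1 : opSbardag (sig (sigbar ψ)) = sig (sigbar (opSbardag ψ)) := by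
    have := LinearMap.congr_fun (opSbardag_sig (R := R)) (sigbar ψ)
    rw [Module.End.mul_apply, LinearMap.sub_apply, Module.End.mul_apply,
      show sigbar (sigbar ψ) = 0 from LinearMap.congr_fun sigbar_sq ψ, sub_zero,
      apply_comm opSbardag_sigbar] at this
    exact this
  rw [h1, ← e, map_add wcalc, LinearMap.add_apply, map_add, map_add, ← projRect_eq, omegaSol]
  abel

/-- `e` commutes with `σ`, its commutator with `σ̄` is `-σ`, and `σ σ = 0`. -/
lemma raise_sig_sigbar_projRect (h : opSbardag φ = 0) :
    opSdag (sig (sigbar (projRect φ))) = 0 := by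
  rw [apply_comm opSdag_sig]
  have := LinearMap.congr_fun (opSdag_sigbar (R := R)) (projRect φ)
  rw [Module.End.mul_apply, LinearMap.sub_apply, Module.End.mul_apply, raise_projRect h, map_zero,
    zero_sub] at this
  rw [this, map_neg, show sig (sig (projRect φ)) = 0 from LinearMap.congr_fun sig_sq _, neg_zero]

end Unfolding

/-! ### Reduction of the intermediate system -/

section SecondReduction

variable {d : ℕ} {η : Fin d → ℝ}

lemma mem_secs_hatE {φ : Sec d} : φ ∈ secs (hatE η) ↔ φ ∈ hatS (Fld d) η := by rw [secs_hatE]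

/-- The part without `b†` is decomposed by `projE0`, the part linear in `b†` by `highest_decomp`. -/
lemma isEFG_second : IsEFG (subSecs η (spE η)) (subSecs η (spF η)) (subSecs η (spG η)) := by
  refine IsEFG.of_unique ?_ ?_
  · rintro ⟨φ, hφ'⟩
    have hφ := mem_secs_hatE.1 hφ'
    have hZ := hatZ_dod_mo hφ
    obtain ⟨l, hl, ψ, hψ, hl0, e⟩ := highest_decomp (hatZ_dod hφ)
    set φ₀ := dod (gBdag d) (mo (gBdag d) φ) with h0
    have hE : projE0 φ₀ + mo (gBdag d) l ∈ secs (spE η) := by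
      rw [mem_secs_spE, dod_add_mo (hatZ_projE0 hZ).2 hl.2, dod_mo_add_mo (hatZ_projE0 hZ).2]
      exact ⟨add_mem (hatZ_projE0 hZ).1 (hatS_mo_bdag hl.1), lower_projE0 _, hl0⟩
    have hF : mo (gBdag d) (opSbardag ψ) ∈ secs (spF η) := mem_secs_spF.2 ⟨ψ, hψ, rfl⟩
    have hG : φ₀ - projE0 φ₀ ∈ secs (spG η) := by
      obtain ⟨χ, hχ, e⟩ := sub_projE0 hZ
      exact mem_secs_spG_iff_raise.2 ⟨χ, hχ, e.symm⟩
    refine ⟨⟨_, mem_secs_hatE.2 (mem_secs_spE.1 hE).1⟩, hE,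
      ⟨_, mem_secs_hatE.2 (hatS_mo_bdag (hatZ_opSbardag hψ).1)⟩, hF,
      ⟨_, mem_secs_hatE.2 (mem_secs_spG.1 hG).1.1⟩, hG, Subtype.ext ?_⟩
    show φ = projE0 φ₀ + mo (gBdag d) l + mo (gBdag d) (opSbardag ψ) + (φ₀ - projE0 φ₀)
    conv_lhs => rw [← odd_expansion (gBdag d) φ, e, map_add, ← h0]
    abel
  · rintro ⟨a, ha'⟩ ha ⟨b, hb'⟩ hb ⟨c, hc'⟩ hc h
    obtain ⟨-, ha1, ha2⟩ := mem_secs_spE.1 (show a ∈ secs (spE η) from ha)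
    obtain ⟨ψ, hψ, hb0⟩ := mem_secs_spF.1 (show b ∈ secs (spF η) from hb)
    obtain ⟨hc1, hc2⟩ := mem_secs_spG.1 (show c ∈ secs (spG η) from hc)
    have hsum : a + b + c = 0 := congrArg Subtype.val h
    have hbd : dod (gBdag d) b = opSbardag ψ := by
      rw [← hb0, dod_mo_apply, (mem_hatZ.1 (hatZ_opSbardag hψ)).2, map_zero, sub_zero]
    have hbm : mo (gBdag d) b = 0 := by rw [← hb0, mo_mo_self]
    have e1 := congrArg (dod (gBdag d)) hsum
    rw [map_add, map_add, hbd, (mem_hatZ.1 hc1).2, add_zero, map_zero] at e1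
    have e2 := congrArg (fun v => projE0 (dod (gBdag d) (mo (gBdag d) v))) hsum
    simp only [map_add, hbm, map_zero, add_zero] at e2
    rw [projE0_of_lower ha1, dod_mo_apply _ c, (mem_hatZ.1 hc1).2, map_zero, sub_zero, hc2,
      add_zero] at e2
    have hb1 : opSbardag ψ = 0 := lower_eq_zero (by
      rw [eq_neg_iff_add_eq_zero.2 ((add_comm _ _).trans e1), map_neg, ha2, neg_zero])
    rw [hb1, add_zero] at e1
    have ha0 : a = 0 := by rw [← odd_expansion (gBdag d) a, e1, e2, map_zero, add_zero]
    have hb2 : b = 0 := by rw [← hb0, hb1, map_zero]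
    have hc0 : c = 0 := by simpa [ha0, hb2] using hsum
    exact ⟨Subtype.ext ha0, Subtype.ext hb2, Subtype.ext hc0⟩

/-- The sections `b† χ` lie in `E ⊕ F̃`. -/
lemma mo_decomp {χ : Sec d} (hχ : χ ∈ hatZ (Fld d) η) :
    ∃ a ∈ subSecs η (spE η), ∃ b ∈ subSecs η (spF η), mo (gBdag d) χ = (a : Sec d) + (b : Sec d) := by
  obtain ⟨l, hl, ψ, hψ, hl0, e⟩ := highest_decomp hχ
  refine ⟨⟨mo (gBdag d) l, mem_secs_hatE.2 (hatS_mo_bdag hl.1)⟩, ?_,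
    ⟨mo (gBdag d) (opSbardag ψ), mem_secs_hatE.2 (hatS_mo_bdag (hatZ_opSbardag hψ).1)⟩,
    mem_secs_spF.2 ⟨ψ, hψ, rfl⟩, by rw [e, map_add]⟩
  have h1 : opSbardag (dod (gBdag d) (mo (gBdag d) (mo (gBdag d) l))) = 0 := by
    rw [mo_mo_self, map_zero, map_zero]
  have h2 : opSdag (dod (gBdag d) (mo (gBdag d) l)) = 0 := by
    rw [dod_mo_apply, (mem_hatZ.1 hl).2, map_zero, sub_zero, hl0]
  exact mem_secs_spE.2 ⟨hatS_mo_bdag hl.1, h1, h2⟩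

variable {T : secs (hatE η) →ₗ[ℂ] secs (hatE η)}
  (hT : ∀ φ : secs (hatE η), ((T φ : secs (hatE η)) : Sec d) =
    -Complex.I • (dTot (φ : Sec d) + sig (φ : Sec d) + SdagDb (φ : Sec d)))
include hT

lemma apply_mo {χ : Sec d} (hχ : χ ∈ hatZ (Fld d) η) {p : secs (hatE η)}
    (hp : (p : Sec d) = mo (gBdag d) χ) :
    (T p : Sec d) = -Complex.I • (-mo (gBdag d) (dTot χ + sig χ) + opSdag χ) := by
  have e : SdagDb (mo (gBdag d) χ) = opSdag χ := by
    rw [SdagDb, LinearMap.comp_apply, dod_mo_apply, (mem_hatZ.1 hχ).2, map_zero, sub_zero]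
  have e2 : sig (mo (gBdag d) χ) = -mo (gBdag d) (sig χ) := by
    rw [apply_anti (anti_sig (R := Fld d)), neg_neg]
  rw [hT, hp, dTot_mo, e, e2, map_add, neg_add]

lemma blockGF_second (h2 : IsEFG (subSecs η (spE η)) (subSecs η (spF η)) (subSecs η (spG η)))
    (p : subSecs η (spF η)) : ((h2.blockGF T p : secs (hatE η)) : Sec d) =
      -Complex.I • SdagDb ((p : secs (hatE η)) : Sec d) := by
  obtain ⟨ψ, hψ, e⟩ := mem_secs_spF.1 (show ((p : secs (hatE η)) : Sec d) ∈ secs (spF η) from p.2)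
  have hχ := hatZ_opSbardag hψ
  obtain ⟨a, ha, b, hb, hab⟩ := mo_decomp (add_mem (hatZ_dTot hχ) (hatZ_sig hχ))
  have hg : opSdag (opSbardag ψ) ∈ secs (spG η) := mem_secs_spG_iff_raise.2 ⟨_, hχ, rfl⟩
  have e1 := apply_mo hT hχ e.symm
  have e2 : T p = Complex.I • a + Complex.I • b +
      -Complex.I • ⟨opSdag (opSbardag ψ), mem_secs_hatE.2 (hatZ_opSdag hχ).1⟩ := by
    refine Subtype.ext (e1.trans ?_)
    rw [hab]
    simp only [Submodule.coe_add, Submodule.coe_smul, smul_add, smul_neg, neg_smul, neg_neg,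
      neg_add]
  have e3 := h2.proj_G (Submodule.smul_mem _ Complex.I ha) (Submodule.smul_mem _ Complex.I hb)
    (Submodule.smul_mem _ (-Complex.I) (show (⟨opSdag (opSbardag ψ), mem_secs_hatE.2
      (hatZ_opSdag hχ).1⟩ : secs (hatE η)) ∈ subSecs η (spG η) from hg))
  rw [← e2] at e3
  have e4 : SdagDb ((p : secs (hatE η)) : Sec d) = opSdag (opSbardag ψ) := by
    rw [← e, SdagDb, LinearMap.comp_apply, dod_mo_apply, (mem_hatZ.1 hχ).2, map_zero, sub_zero]
  rw [e4]
  exact congrArg (fun v : subSecs η (spG η) => ((v : secs (hatE η)) : Sec d)) e3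

/-- The block is `-i S† ∂/∂b†`: it is injective because no nonzero highest-weight state is in the
image of `f`, and surjective because the image of `e` is that of `e f`. -/
lemma algInvertible_second
    (h2 : IsEFG (subSecs η (spE η)) (subSecs η (spF η)) (subSecs η (spG η))) :
    AlgInvertible (fun p : subSecs η (spF η) => ((p : secs (hatE η)) : Sec d))
      (fun q : subSecs η (spG η) => ((q : secs (hatE η)) : Sec d)) (h2.blockGF T) := by
  have hB := blockGF_second hT h2
  -- `S† ∂/∂b†` is injective on `F̃`.
  have key : ∀ p : Sec d, p ∈ secs (spF η) → SdagDb p = 0 → p = 0 := fun p hp h0 => by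
    obtain ⟨ψ, hψ, e⟩ := mem_secs_spF.1 hp
    rw [← e, SdagDb, LinearMap.comp_apply, dod_mo_apply, (mem_hatZ.1 (hatZ_opSbardag hψ)).2,
      map_zero, sub_zero] at h0
    rw [← e, lower_eq_zero h0, map_zero]
  have hmul : ∀ (f : Fld d) (p : Sec d), p ∈ secs (spF η) → fmul f p ∈ secs (spF η) :=
    fun f p hp => by
      obtain ⟨ψ, hψ, e⟩ := mem_secs_spF.1 hp
      exact mem_secs_spF.2 ⟨fmul f ψ, hatZ_coeffMap _ hψ, by
        rw [← e, fmul, Intertw.mo, Intertw.opSbardag]⟩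
  have inj : ∀ p p' : Sec d, p ∈ secs (spF η) → p' ∈ secs (spF η) →
      -Complex.I • SdagDb p = -Complex.I • SdagDb p' → p = p' := fun p p' hp hp' h => by
    refine sub_eq_zero.1 (key _ (sub_mem hp hp') ?_)
    rw [map_sub, smul_right_injective _ (neg_ne_zero.2 Complex.I_ne_zero) h, sub_self]
  refine ⟨⟨fun p p' h => ?_, ?_⟩, fun f p p' h => ?_⟩
  · refine Subtype.ext (Subtype.ext (inj _ _ p.2 p'.2 ?_))
    rw [← hB, ← hB, h]
  · intro q
    obtain ⟨ψ, hψ, e⟩ :=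
      mem_secs_spG_iff_raise.1 (show ((q : secs (hatE η)) : Sec d) ∈ secs (spG η) from q.2)
    obtain ⟨l, hl, χ, hχ, hl0, e'⟩ := highest_decomp hψ
    have hp : mo (gBdag d) (opSbardag (Complex.I • χ)) ∈ secs (spF η) :=
      mem_secs_spF.2 ⟨_, Submodule.smul_mem _ _ hχ, rfl⟩
    have hχ' := hatZ_opSbardag (Submodule.smul_mem _ Complex.I hχ)
    refine ⟨⟨⟨_, mem_secs_hatE.2 (hatS_mo_bdag hχ'.1)⟩, hp⟩, Subtype.ext (Subtype.ext ?_)⟩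
    rw [hB]
    show -Complex.I • SdagDb (mo (gBdag d) (opSbardag (Complex.I • χ))) = _
    rw [SdagDb, LinearMap.comp_apply, dod_mo_apply, (mem_hatZ.1 hχ').2, map_zero, sub_zero, map_smul,
      map_smul, smul_smul, neg_mul, Complex.I_mul_I, neg_neg, one_smul, ← e, e', map_add, hl0,
      zero_add]
  · refine inj _ _ p'.2 (hmul f _ p.2) ((hB p').symm.trans (h.trans ?_))
    have e := hB p
    dsimp only
    rw [e, fmul, map_smul, Intertw.SdagDb]

/-- The reduced operator on `E`. The element of `F̃` that compensates the component of
`T (Ψ₀ + b† Ψ₁)` in `G̃` is `b† ω` with `ω = omegaSol Ψ₀`; the part of `T (b† ω)` in `E` contributes the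
term with `σ σ̄`. -/
lemma reduced_second (h2 : IsEFG (subSecs η (spE η)) (subSecs η (spF η)) (subSecs η (spG η)))
    (b2 : Function.Bijective (h2.blockGF T)) (Ψ : subSecs η (spE η)) {Ψ₀ Ψ₁ : Sec d}
    (h₀ : Ψ₀ ∈ hatZ (Fld d) η) (h₀' : opSbardag Ψ₀ = 0) (h₁ : Ψ₁ ∈ hatZ (Fld d) η)
    (h₁' : opSdag Ψ₁ = 0) (hΨ : ((Ψ : secs (hatE η)) : Sec d) = Ψ₀ + mo (gBdag d) Ψ₁) :
    ((h2.reduced T b2 Ψ : secs (hatE η)) : Sec d) =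
      -Complex.I • (dTot Ψ₀ + projE0 (sig Ψ₀) -
        mo (gBdag d) (dTot Ψ₁ + sig Ψ₁ + sig (sigbar (projRect Ψ₀)))) := by
  obtain ⟨ψ, hψ, eψ⟩ := sig_omegaSol h₀ h₀'
  set ρ := omegaSol Ψ₀ with hρ
  set r := sig (sigbar (projRect Ψ₀)) with hr
  set χ := -sig (wcalc (fun c => ((c : ℂ) - 1)⁻¹) Ψ₀) with hχ
  have hρχ : ρ = opSbardag χ := omegaSol_eq_lower h₀'
  have hχZ : χ ∈ hatZ (Fld d) η := neg_mem (hatZ_sig (hatZ_wcalc _ h₀))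
  have hρZ : ρ ∈ hatZ (Fld d) η := hatZ_omegaSol h₀
  have hrZ : r ∈ hatZ (Fld d) η := hatZ_sig (hatZ_sigbar (hatZ_projRect h₀))
  have heρ : opSdag ρ = sig Ψ₀ - projE0 (sig Ψ₀) := raise_omegaSol h₀'
  -- Sections of the form `a + b† l`.
  have hE : ∀ a l : Sec d, a ∈ hatZ (Fld d) η → opSbardag a = 0 → l ∈ hatZ (Fld d) η →
      opSdag l = 0 → a + mo (gBdag d) l ∈ secs (spE η) := fun a l ha ha' hl hl' => by
    rw [mem_secs_spE, dod_add_mo (mem_hatZ.1 ha).2 (mem_hatZ.1 hl).2,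
      dod_mo_add_mo (mem_hatZ.1 ha).2]
    exact ⟨add_mem ha.1 (hatS_mo_bdag hl.1), ha', hl'⟩
  have hsub : ∀ {φ : Sec d}, φ ∈ secs (spE η) → φ ∈ secs (hatE η) := fun h =>
    mem_secs_hatE.2 (mem_secs_spE.1 h).1
  have hlow : opSbardag (dTot Ψ₀ + projE0 (sig Ψ₀)) = 0 := by
    rw [map_add, ← dTot_opSbardag, h₀', map_zero, lower_projE0, add_zero]
  have hraise : opSdag (-(dTot Ψ₁ + sig Ψ₁)) = 0 := by
    rw [map_neg, map_add, ← dTot_opSdag, h₁', map_zero, apply_comm opSdag_sig, h₁', map_zero,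
      add_zero, neg_zero]
  have m1 := hE _ _ (add_mem (hatZ_dTot h₀) (hatZ_projE0 (hatZ_sig h₀))) hlow
    (neg_mem (add_mem (hatZ_dTot h₁) (hatZ_sig h₁))) hraise
  have m2 := hE 0 r (zero_mem _) (map_zero _) hrZ (raise_sig_sigbar_projRect h₀')
  have m3 : mo (gBdag d) (opSbardag (dTot χ + ψ)) ∈ secs (spF η) :=
    mem_secs_spF.2 ⟨_, add_mem (hatZ_dTot hχZ) hψ, rfl⟩
  have m4 : opSdag ρ ∈ secs (spG η) := mem_secs_spG_iff_raise.2 ⟨_, hρZ, rfl⟩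
  have m5 : mo (gBdag d) ρ ∈ secs (spF η) := mem_secs_spF.2 ⟨χ, hχZ, by rw [hρχ]⟩
  have hF3 : mo (gBdag d) (opSbardag (dTot χ + ψ)) ∈ secs (hatE η) :=
    mem_secs_hatE.2 (hatS_mo_bdag (hatZ_opSbardag (add_mem (hatZ_dTot hχZ) hψ)).1)
  have hF5 : mo (gBdag d) ρ ∈ secs (hatE η) := mem_secs_hatE.2 (hatS_mo_bdag hρZ.1)
  have hG4 : opSdag ρ ∈ secs (hatE η) := mem_secs_hatE.2 (hatZ_opSdag hρZ).1
  have e1 : T Ψ = -Complex.I • ⟨_, hsub m1⟩ + 0 + -Complex.I • ⟨_, hG4⟩ := by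
    refine Subtype.ext ?_
    have s1 : SdagDb (Ψ₀ + mo (gBdag d) Ψ₁) = 0 := by
      rw [SdagDb, LinearMap.comp_apply, dod_add_mo (mem_hatZ.1 h₀).2 (mem_hatZ.1 h₁).2, h₁']
    have s2 : sig (mo (gBdag d) Ψ₁) = -mo (gBdag d) (sig Ψ₁) := by
      rw [apply_anti (anti_sig (R := Fld d)), neg_neg]
    rw [hT, hΨ, s1, map_add, map_add, dTot_mo, s2]
    show _ = -Complex.I • (_ + mo (gBdag d) _) + 0 + -Complex.I • opSdag ρ
    rw [heρ, add_zero, add_zero, ← smul_add, map_neg, map_add]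
    congr 1
    abel
  have e2 : T ⟨_, hF5⟩ = -Complex.I • ⟨_, hsub m2⟩ + Complex.I • ⟨_, hF3⟩ +
      -Complex.I • ⟨_, hG4⟩ := by
    refine Subtype.ext ((apply_mo hT hρZ rfl).trans ?_)
    show _ = -Complex.I • (0 + mo (gBdag d) r) +
      Complex.I • mo (gBdag d) (opSbardag (dTot χ + ψ)) + -Complex.I • opSdag ρ
    rw [eψ, map_add opSbardag, ← dTot_opSbardag, ← hρχ, zero_add, smul_add]
    congr 1
    simp only [map_add, map_neg, smul_neg, neg_smul, neg_neg, smul_add]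
    abel
  refine (congrArg Subtype.val (h2.reduced_apply b2 Ψ (ζ := ⟨_, hF5⟩) m5
    (Submodule.smul_mem _ (-Complex.I) (show (⟨_, hsub m1⟩ : secs (hatE η)) ∈ subSecs η _ from m1))
    (Submodule.smul_mem _ (-Complex.I) (show (⟨_, hsub m2⟩ : secs (hatE η)) ∈ subSecs η _ from m2))
    (zero_mem _)
    (Submodule.smul_mem _ Complex.I (show (⟨_, hF3⟩ : secs (hatE η)) ∈ subSecs η _ from m3))
    (Submodule.smul_mem _ (-Complex.I) (show (⟨_, hG4⟩ : secs (hatE η)) ∈ subSecs η _ from m4))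
    e1 e2)).trans ?_
  show -Complex.I • (_ + mo (gBdag d) _) - -Complex.I • (0 + mo (gBdag d) r) = _
  rw [← smul_sub, zero_add, map_neg, map_add (mo _) _ r]
  congr 1
  abel

end SecondReduction

/-! ### Ghost numbers -/

section GhostNumber

variable {d : ℕ} {R : Type} [AddCommGroup R] [Module ℂ R] {η : Fin d → ℝ}

lemma mem_ghSpace {k : ℤ} {φ : Fock d R} :
    φ ∈ ghSpace d R k ↔ ∀ i : Mono d, i.gh ≠ k → φ.1 i = 0 := by
  rw [ghSpace, LinearMap.mem_ker, LinearMap.sub_apply, LinearMap.id_apply, sub_eq_zero]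
  have h : ∀ i, (ghPart k φ).1 i = (if i.gh = k then (1 : ℂ) else 0) • φ.1 i := fun i => rfl
  constructor
  · intro hφ i hi
    rw [← hφ, h, if_neg hi, zero_smul]
  · intro hφ
    refine Fock.ext' fun i => ?_
    rw [h]
    split_ifs with hi
    · exact one_smul ℂ _
    · rw [hφ i hi, smul_zero]

lemma gh_eq_lw (i : Mono d) : i.gh = lw (fun _ => 0) (fun _ => 0) oddGh i := by
  simp [lw, Mono.gh]

lemma ghSpace_mo_bdag {k l : ℤ} {φ : Fock d R} (hφ : φ ∈ ghSpace d R k) (h : k = l + 1) :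
    mo (gBdag d) φ ∈ ghSpace d R l := by
  rw [mem_ghSpace] at hφ ⊢
  refine fun i hi => sh_mo (fun _ => 0) (fun _ => 0) oddGh _ φ i fun j hj => hφ j ?_
  change lw _ _ _ i = lw _ _ _ j + _ at hj
  rw [← gh_eq_lw, ← gh_eq_lw, oddGh, if_pos rfl] at hj
  omega

lemma ghSpace_dod_bdag {k l : ℤ} {φ : Fock d R} (hφ : φ ∈ ghSpace d R k) (h : l = k + 1) :
    dod (gBdag d) φ ∈ ghSpace d R l := by
  rw [mem_ghSpace] at hφ ⊢
  refine fun i hi => sh_dod (fun _ => 0) (fun _ => 0) oddGh _ φ i fun j hj => hφ j ?_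
  change lw _ _ _ i = lw _ _ _ j + _ at hj
  rw [← gh_eq_lw, ← gh_eq_lw, oddGh, if_pos rfl] at hj
  omega

/-- Only `b†` has negative ghost number. -/
lemma eq_zero_of_gh_neg {k : ℤ} (hk : k < 0) {φ : Fock d R} (hφ : φ ∈ ghSpace d R k)
    (hb : dod (gBdag d) φ = 0) : φ = 0 := by
  refine Fock.ext' fun i => ?_
  by_cases hi : gBdag d ∈ i.odd
  · exact mem_ker_dod.1 hb i hi
  · refine mem_ghSpace.1 hφ i fun h => ?_
    have : 0 ≤ i.gh := Finset.sum_nonneg fun g hg => by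
      rw [oddGh, if_neg (by rintro rfl; exact hi hg)]
      exact zero_le_one
    omega

lemma expansion_inj {a a' l l' : Fock d R} (ha : a ∈ hatZ R η) (ha' : a' ∈ hatZ R η)
    (hl : l ∈ hatZ R η) (hl' : l' ∈ hatZ R η)
    (h : a + mo (gBdag d) l = a' + mo (gBdag d) l') : a = a' ∧ l = l' := by
  constructor
  · rw [← dod_mo_add_mo (ψ := l) (mem_hatZ.1 ha).2, h, dod_mo_add_mo (mem_hatZ.1 ha').2]
  · rw [← dod_add_mo (mem_hatZ.1 ha).2 (mem_hatZ.1 hl).2, h,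
      dod_add_mo (mem_hatZ.1 ha').2 (mem_hatZ.1 hl').2]

lemma add_mo_mem_spE {a l : Sec d} (ha : a ∈ secs (spE0 η)) (hl : l ∈ secs (spL1 η)) :
    a + mo (gBdag d) l ∈ secs (spE η) := by
  rw [mem_secs_spE0] at ha
  rw [mem_secs_spL1] at hl
  rw [mem_secs_spE, dod_add_mo (mem_hatZ.1 ha.1).2 (mem_hatZ.1 hl.1).2,
    dod_mo_add_mo (mem_hatZ.1 ha.1).2]
  exact ⟨add_mem ha.1.1 (hatS_mo_bdag hl.1.1), ha.2, hl.2⟩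

/-- The two fields are the terms of the expansion in `b†`. -/
lemma exists_unique_fields {Ψ : Sec d} (hΨ : Ψ ∈ secs (spE η)) (h0 : Ψ ∈ ghSpace d (Fld d) 0) :
    ∃! p : Sec d × Sec d,
      p.1 ∈ secs (spE0 η) ∧ p.1 ∈ ghSpace d (Fld d) 0 ∧
      p.2 ∈ secs (spL1 η) ∧ p.2 ∈ ghSpace d (Fld d) 1 ∧ Ψ = p.1 + mo (gBdag d) p.2 := by
  obtain ⟨h, h1, h2⟩ := mem_secs_spE.1 hΨ
  refine ⟨(dod (gBdag d) (mo (gBdag d) Ψ), dod (gBdag d) Ψ),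
    ⟨mem_secs_spE0.2 ⟨hatZ_dod_mo h, h1⟩, ghSpace_dod_bdag (ghSpace_mo_bdag (l := -1) h0 (by norm_num)) (by norm_num),
      mem_secs_spL1.2 ⟨hatZ_dod h, h2⟩, ghSpace_dod_bdag h0 (by norm_num), (odd_expansion _ _).symm⟩, ?_⟩
  rintro ⟨a, l⟩ ⟨ha, -, hl, -, e⟩
  have := expansion_inj (mem_secs_spE0.1 ha).1 (hatZ_dod_mo h) (mem_secs_spL1.1 hl).1 (hatZ_dod h)
    (e.symm.trans (odd_expansion (gBdag d) Ψ).symm)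
  exact Prod.ext this.1 this.2

/-- A section of ghost number `-1` has no term without `b†`. -/
lemma exists_unique_parameter {Ψ : Sec d} (hΨ : Ψ ∈ secs (spE η))
    (h0 : Ψ ∈ ghSpace d (Fld d) (-1)) :
    ∃! Λ : Sec d, Λ ∈ secs (spL1 η) ∧ Λ ∈ ghSpace d (Fld d) 0 ∧
      Ψ = -Complex.I • mo (gBdag d) Λ := by
  obtain ⟨h, h1, h2⟩ := mem_secs_spE.1 hΨ
  have hz : dod (gBdag d) (mo (gBdag d) Ψ) = 0 :=
    eq_zero_of_gh_neg (k := -1) (by norm_num) (ghSpace_dod_bdag (ghSpace_mo_bdag (l := -2) h0 (by norm_num)) (by norm_num))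
      (mem_hatZ.1 (hatZ_dod_mo h)).2
  refine ⟨Complex.I • dod (gBdag d) Ψ, ⟨Submodule.smul_mem _ _ (mem_secs_spL1.2 ⟨hatZ_dod h, h2⟩),
    Submodule.smul_mem _ _ (ghSpace_dod_bdag h0 (by norm_num)), ?_⟩, ?_⟩
  · rw [map_smul, smul_smul, neg_mul, Complex.I_mul_I, neg_neg, one_smul]
    conv_lhs => rw [← odd_expansion (gBdag d) Ψ, hz, zero_add]
  · rintro Λ ⟨hΛ, -, e⟩
    rw [e, map_smul, dod_mo_apply, (mem_hatZ.1 (mem_secs_spL1.1 hΛ).1).2, map_zero, sub_zero,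
      smul_smul, mul_neg, Complex.I_mul_I, neg_neg, one_smul]

variable {T : secs (hatE η) →ₗ[ℂ] secs (hatE η)}
  (hT : ∀ φ : secs (hatE η), ((T φ : secs (hatE η)) : Sec d) =
    -Complex.I • (dTot (φ : Sec d) + sig (φ : Sec d) + SdagDb (φ : Sec d)))
  (h2 : IsEFG (subSecs η (spE η)) (subSecs η (spF η)) (subSecs η (spG η)))
  (b2 : Function.Bijective (h2.blockGF T))
include hT

/-- The two equations are the terms of the reduced operator without `b†` and with `b†`. -/
lemma equations_of_motion {Ψ₀ Ψ₁ : Sec d} (h₀ : Ψ₀ ∈ secs (spE0 η))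
    (g₀ : Ψ₀ ∈ ghSpace d (Fld d) 0) (h₁ : Ψ₁ ∈ secs (spL1 η)) (g₁ : Ψ₁ ∈ ghSpace d (Fld d) 1) :
    ∃ Ψ : subSecs η (spE η),
      ((Ψ : secs (hatE η)) : Sec d) = Ψ₀ + mo (gBdag d) Ψ₁ ∧
      ((Ψ : secs (hatE η)) : Sec d) ∈ ghSpace d (Fld d) 0 ∧
      (h2.reduced T b2 Ψ = 0 ↔
        dTot Ψ₀ + projE0 (sig Ψ₀) = 0 ∧
        dTot Ψ₁ + sig Ψ₁ = -sig (sigbar (projRect Ψ₀))) := by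
  have hE := add_mo_mem_spE h₀ h₁
  have hZ₀ := (mem_secs_spE0.1 h₀).1
  have hZ₁ := (mem_secs_spL1.1 h₁).1
  refine ⟨⟨⟨_, mem_secs_hatE.2 (mem_secs_spE.1 hE).1⟩, hE⟩, rfl,
    add_mem g₀ (ghSpace_mo_bdag g₁ (by norm_num)), ?_⟩
  have hr := reduced_second hT h2 b2 ⟨⟨_, mem_secs_hatE.2 (mem_secs_spE.1 hE).1⟩, hE⟩ hZ₀
    (mem_secs_spE0.1 h₀).2 hZ₁ (mem_secs_spL1.1 h₁).2 rfl
  rw [← Subtype.coe_inj, ← Subtype.coe_inj, hr]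
  show -Complex.I • _ = (0 : Sec d) ↔ _
  rw [smul_eq_zero, or_iff_right (neg_ne_zero.2 Complex.I_ne_zero), sub_eq_zero]
  set A := dTot Ψ₀ + projE0 (sig Ψ₀)
  set B := dTot Ψ₁ + sig Ψ₁
  set C := sig (sigbar (projRect Ψ₀))
  have hA : A ∈ hatZ (Fld d) η := add_mem (hatZ_dTot hZ₀) (hatZ_projE0 (hatZ_sig hZ₀))
  have hBC : B + C ∈ hatZ (Fld d) η := add_mem (add_mem (hatZ_dTot hZ₁) (hatZ_sig hZ₁))
    (hatZ_sig (hatZ_sigbar (hatZ_projRect hZ₀)))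
  constructor
  · intro h
    have := expansion_inj hA (zero_mem _) (zero_mem _) hBC
      (by rw [map_zero, add_zero, zero_add, h])
    exact ⟨this.1, eq_neg_iff_add_eq_zero.2 this.2.symm⟩
  · rintro ⟨h, h'⟩
    rw [h, h', neg_add_cancel, map_zero]

/-- The reduced operator at a section `b† l`, which has no `b†`-independent part. -/
lemma gauge_transformations {Λ : Sec d} (hΛ : Λ ∈ secs (spL1 η))
    (g : Λ ∈ ghSpace d (Fld d) 0) :
    ∃ X : subSecs η (spE η),
      ((X : secs (hatE η)) : Sec d) = -Complex.I • mo (gBdag d) Λ ∧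
      ((X : secs (hatE η)) : Sec d) ∈ ghSpace d (Fld d) (-1) ∧
      ∀ δ₀ δ₁ : Sec d,
        δ₀ ∈ secs (spE0 η) → δ₁ ∈ secs (spL1 η) →
        (((h2.reduced T b2 X : secs (hatE η)) : Sec d) = δ₀ + mo (gBdag d) δ₁ ↔
          δ₀ = 0 ∧ δ₁ = dTot Λ + sig Λ) := by
  have hL : -Complex.I • Λ ∈ secs (spL1 η) := Submodule.smul_mem _ _ hΛ
  have hE := add_mo_mem_spE (η := η) (zero_mem _) hL
  rw [zero_add, map_smul] at hE
  have hZ := (mem_secs_spL1.1 hΛ).1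
  refine ⟨⟨⟨_, mem_secs_hatE.2 (mem_secs_spE.1 hE).1⟩, hE⟩, rfl,
    Submodule.smul_mem _ _ (ghSpace_mo_bdag g (by norm_num)), fun δ₀ δ₁ h₀ h₁ => ?_⟩
  have hX : -Complex.I • mo (gBdag d) Λ = 0 + mo (gBdag d) (-Complex.I • Λ) := by
    rw [zero_add, map_smul]
  have hr := reduced_second hT h2 b2 ⟨⟨_, mem_secs_hatE.2 (mem_secs_spE.1 hE).1⟩, hE⟩
    (zero_mem _) (map_zero _) (mem_secs_spL1.1 hL).1 (mem_secs_spL1.1 hL).2 hX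
  have e : -Complex.I • (dTot (0 : Sec d) + projE0 (sig 0) - mo (gBdag d)
      (dTot (-Complex.I • Λ) + sig (-Complex.I • Λ) + sig (sigbar (projRect 0)))) =
      0 + mo (gBdag d) (dTot Λ + sig Λ) := by
    simp only [map_zero, add_zero, zero_sub, zero_add]
    rw [map_smul, map_smul, ← smul_add, map_smul, smul_neg, smul_smul, neg_mul_neg, Complex.I_mul_I,
      neg_one_smul, neg_neg]
  rw [hr, e]
  constructor
  · intro h
    have := expansion_inj (zero_mem _) (mem_secs_spE0.1 h₀).1
      (add_mem (hatZ_dTot hZ) (hatZ_sig hZ)) (mem_secs_spL1.1 h₁).1 h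
    exact ⟨this.1.symm, this.2.symm⟩
  · rintro ⟨rfl, rfl⟩
    rfl

end GhostNumber

end Fronsdal

end

open Fronsdal in
theorem proposition4p4 (d : ℕ) (hd : 3 ≤ d) (η : Fin d → ℝ) (hη : ∀ μ, η μ = 1 ∨ η μ = -1) :
    -- First step: the cohomology of the part of degree `-1` is represented by `Ê`, and the
    -- parent system can be algebraically reduced to `Ê`.
    (hatE η ⊔ LinearMap.range (OmegaMinus η : State d →ₗ[ℂ] State d) =
        LinearMap.ker (OmegaMinus η : State d →ₗ[ℂ] State d)) ∧
    (∃ F : Submodule ℂ (State d), (∀ k : ℤ, ∀ φ ∈ F, ghPart k φ ∈ F) ∧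
      ∃ h1 : IsEFG (secs (hatE η)) (secs F)
          (secs (LinearMap.range (OmegaMinus η : State d →ₗ[ℂ] State d))),
        AlgInvertible (fun p : secs F => (p : Sec d))
          (fun q : secs (LinearMap.range (OmegaMinus η : State d →ₗ[ℂ] State d)) => (q : Sec d))
           (h1.blockGF (OmegaT η))) ∧
    -- Second step: the cohomology of `S† ∂/∂b†` on `Ê` is represented by `E`.
    (spE η ⊔ spG η = hatE η ⊓ LinearMap.ker SdagDb) ∧
    -- `Π^{E₀}` projects `Ê₀` onto `E₀` along the image of `S†`.
    (∀ φ ∈ secs (hatE0 η), projE0 φ ∈ secs (spE0 η) ∧ φ - projE0 φ ∈ secs (spG η)) ∧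
    (∀ φ ∈ secs (spE0 η), projE0 φ = φ) ∧
    (∀ φ ∈ secs (spG η), projE0 φ = 0) ∧
    -- `Π^R` projects `E₀` onto its `sl(2)` invariants.
    (∀ φ ∈ secs (spE0 η), projRect φ ∈ secs (spE0 η) ∧ opSdag (projRect φ) = 0) ∧
    (∀ φ ∈ secs (spE0 η), opSdag φ = 0 → projRect φ = φ) ∧
    -- For every choice of `F` in the first step:
    ∀ (F : Submodule ℂ (State d))
      (h1 : IsEFG (secs (hatE η)) (secs F)
        (secs (LinearMap.range (OmegaMinus η : State d →ₗ[ℂ] State d))))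
      (b1 : Function.Bijective (h1.blockGF (OmegaT η))),
      -- the intermediate BRST operator,
      (∀ φ : secs (hatE η), ((h1.reduced (OmegaT η) b1 φ : secs (hatE η)) : Sec d) =
        -Complex.I • (dTot (φ : Sec d) + sig (φ : Sec d) + SdagDb (φ : Sec d))) ∧
      -- which can be algebraically reduced to `E` along `F̃` and `G̃`;
      ∃ (h2 : IsEFG (subSecs η (spE η)) (subSecs η (spF η)) (subSecs η (spG η)))
        (b2 : AlgInvertible (fun p : subSecs η (spF η) => ((p : secs (hatE η)) : Sec d))
          (fun q : subSecs η (spG η) => ((q : secs (hatE η)) : Sec d)) (h2.blockGF (h1.reduced (OmegaT η) b1))),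
        -- the sections of `E` of ghost number `0` have the form `Ψ₀ + b† Ψ₁`,
        (∀ Ψ : subSecs η (spE η),
          ((Ψ : secs (hatE η)) : Sec d) ∈ ghSpace d (Fld d) 0 →
          ∃! p : Sec d × Sec d,
            p.1 ∈ secs (spE0 η) ∧ p.1 ∈ ghSpace d (Fld d) 0 ∧
            p.2 ∈ secs (spL1 η) ∧ p.2 ∈ ghSpace d (Fld d) 1 ∧
            ((Ψ : secs (hatE η)) : Sec d) = p.1 + mo (gBdag d) p.2) ∧
        -- and the equations of motion are the unfolded equations;
        (∀ Ψ₀ Ψ₁ : Sec d,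
          Ψ₀ ∈ secs (spE0 η) → Ψ₀ ∈ ghSpace d (Fld d) 0 →
          Ψ₁ ∈ secs (spL1 η) → Ψ₁ ∈ ghSpace d (Fld d) 1 →
          ∃ Ψ : subSecs η (spE η),
            ((Ψ : secs (hatE η)) : Sec d) = Ψ₀ + mo (gBdag d) Ψ₁ ∧
            ((Ψ : secs (hatE η)) : Sec d) ∈ ghSpace d (Fld d) 0 ∧
            (h2.reduced (h1.reduced (OmegaT η) b1) b2.1 Ψ = 0 ↔
              dTot Ψ₀ + projE0 (sig Ψ₀) = 0 ∧
              dTot Ψ₁ + sig Ψ₁ = -sig (sigbar (projRect Ψ₀)))) ∧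
        -- the sections of `E` of ghost number `-1` have the form `-i b† Λ`,
        (∀ Ψ : subSecs η (spE η),
          ((Ψ : secs (hatE η)) : Sec d) ∈ ghSpace d (Fld d) (-1) →
          ∃! Λ : Sec d, Λ ∈ secs (spL1 η) ∧ Λ ∈ ghSpace d (Fld d) 0 ∧
            ((Ψ : secs (hatE η)) : Sec d) = -Complex.I • mo (gBdag d) Λ) ∧
        -- and the gauge transformations are `δΨ₀ = 0`, `δΨ₁ = (𝐝 + σ) Λ`.
        (∀ Λ : Sec d, Λ ∈ secs (spL1 η) → Λ ∈ ghSpace d (Fld d) 0 →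
          ∃ X : subSecs η (spE η),
            ((X : secs (hatE η)) : Sec d) = -Complex.I • mo (gBdag d) Λ ∧
            ((X : secs (hatE η)) : Sec d) ∈ ghSpace d (Fld d) (-1) ∧
            ∀ δ₀ δ₁ : Sec d,
              δ₀ ∈ secs (spE0 η) → δ₀ ∈ ghSpace d (Fld d) 0 →
              δ₁ ∈ secs (spL1 η) → δ₁ ∈ ghSpace d (Fld d) 1 →
              (((h2.reduced (h1.reduced (OmegaT η) b1) b2.1 X : secs (hatE η)) : Sec d) =
                δ₀ + mo (gBdag d) δ₁ ↔
                δ₀ = 0 ∧ δ₁ = dTot Λ + sig Λ)) := by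
  have h12 : (⟨0, by omega⟩ : Fin d) ≠ ⟨1, by omega⟩ := by simp
  have h13 : (⟨0, by omega⟩ : Fin d) ≠ ⟨2, by omega⟩ := by simp
  have h23 : (⟨1, by omega⟩ : Fin d) ≠ ⟨2, by omega⟩ := by simp
  refine ⟨hatE_sup_range hη h12 h13 h23, ⟨_, fun k φ h => ghPart_range hη h12 h13 h23 k φ h,
    isEFG_first hη h12 h13 h23, algInvertible_first hη h12 h13 h23 _⟩, spE_sup_spG, ?_, ?_, ?_, ?_,
    ?_, ?_⟩
  · intro φ hφ
    have hZ := mem_secs_hatE0.1 hφ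
    obtain ⟨ψ, hψ, e⟩ := sub_projE0 hZ
    exact ⟨mem_secs_spE0.2 ⟨hatZ_projE0 hZ, lower_projE0 φ⟩,
      mem_secs_spG_iff_raise.2 ⟨ψ, hψ, e.symm⟩⟩
  · exact fun φ hφ => projE0_of_lower (mem_secs_spE0.1 hφ).2
  · exact fun φ hφ => (mem_secs_spG.1 hφ).2
  · intro φ hφ
    obtain ⟨h1, h2⟩ := mem_secs_spE0.1 hφ
    exact ⟨mem_secs_spE0.2 ⟨hatZ_projRect h1, lower_projRect h2⟩, raise_projRect h2⟩
  · exact fun φ hφ h => projRect_of_invariant (mem_secs_spE0.1 hφ).2 h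
  · intro F h1 b1
    have hT := reduced_first hη _ _ _ h12 h13 h23 h1 b1
    refine ⟨hT, isEFG_second, algInvertible_second hT _, ?_, ?_, ?_, ?_⟩
    · exact fun Ψ hΨ => exists_unique_fields Ψ.2 hΨ
    · exact fun Ψ₀ Ψ₁ a b c e => equations_of_motion hT _ _ a b c e
    · exact fun Ψ hΨ => exists_unique_parameter Ψ.2 hΨ
    · intro Λ a b
      obtain ⟨X, hX, hg, h⟩ := gauge_transformations hT isEFG_second
        (algInvertible_second hT isEFG_second).1 a b
      exact ⟨X, hX, hg, fun δ₀ δ₁ h₀ _ h₁ _ => h δ₀ δ₁ h₀ h₁⟩
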